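/- Let $n\ge 2$, let $B$ be the open unit ball of $\mathbb R^n$, and let $p\in C^\infty(B)$ be radial, $p(x)=p(|x|)$, with $1<p^-\le p^+<\infty$. Let $w$ be either the function $p$ or the constant $1$ (written $w(\varrho)$ as a function of the radius), and put $$u(x)=\int_{|x|}^1\big(w(\varrho)\varrho^{n-1}\big)^{-1/(p(\varrho)-1)}\,d\varrho\in[0,\infty],\qquad x\in B .$$ A weak solution of $-\operatorname{div}(w|\nabla h|^{p(x)-2}\nabla h)=0$ in an open set $D$ is a function $h\in W^{1,p(\cdot)}_{\rm loc}(D)$ with $\int_D w|\nabla h|^{p(x)-2}\nabla h\cdot\nabla\varphi\,dx=0$ for all compactly supported $\varphi\in W^{1,p(\cdot)}(D)$. A lower semicontinuous, a.e. finite function $B\to(-\infty,\infty]$ is called $p(\cdot)$-superharmonic (for the weight $w$) if, for every open $D\Subset B$ and every weak solution $h\in C(\overline D)$ in $D$ that it dominates on $\partial D$, it dominates $h$ in $D$. For a variable exponent $q$ on $B$ (measurable, $0<q^-\le q^+<\infty$), a measurable $f$ belongs to $w\text{-}L^{q(\cdot)}(B)$ if $\|f\|_{w\text{-}L^{q(\cdot)}(B)}:=\sup_{\lambda>0}\lambda\|\chi_{\{|f|>\lambda\}}\|_{L^{q(\cdot)}(B)}<\infty$,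 where $\|\cdot\|_{L^{q(\cdot)}(B)}$ is the Luxemburg norm. (1) The function $u$ is $p(\cdot)$-superharmonic in $B$, and it is finite and $C^1$ in $B\setminus\{0\}$. For every $k\in\mathbb R$ the truncation $\min(u,k)$ has the distributional gradient $\chi_{\{u<k\}}\nabla u$ in $B$, where $\nabla u$ is the classical gradient in $B\setminus\{0\}$; if $p(0)\ge2$, then $\nabla u$ is also the distributional gradient of $u$ in $B$. There is a $K>0$ such that $-\operatorname{div}(w|\nabla u|^{p(x)-2}\nabla u)=K\delta_0$ in $B$ in the sense of distributions. (2) Let $q$ be a log-Hölder continuous variable exponent on $B$. If $p(0)<n$, then $u\in w\text{-}L^{q(\cdot)}(B)$ if and only if $q(0)\le \frac{n(p(0)-1)}{n-p(0)}$. Moreover, $|\nabla u|\in w\text{-}L^{q(\cdot)}(B)$ if and only if $q(0)\le\frac{n(p(0)-1)}{n-1}$. (3) For every $r\in(0,1)$ there are unique $a_r,b_r\in\mathbb R$ such that $$v_r(x)=\begin{cases}a_r-b_r|x|,&|x|\le r,\\ u(x),&r<|x|<1,\end{cases}$$ is $C^1$ in $B\setminus\{0\}$. Here $b_r=|\nabla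 u(x)|$ for $|x|=r$, and $b_r\approx r^{-\frac{n-1}{p(0)-1}}$ for $r\in(0,1)$. Moreover, $v_r\in W^{1,p(\cdot)}_{\rm loc}(B)$ and $-\operatorname{div}(w|\nabla v_r|^{p(x)-2}\nabla v_r)=f_r$ in $B$ in the sense of distributions, where $f_r\in L^1(B)$ is given by $$f_r(x)=b_r^{p(x)-1}\Big(w(x)\Big(\frac{n-1}{|x|}+p'(x)\log b_r\Big)+w'(x)\Big)\quad(0<|x|<r),\qquad f_r=0\quad(|x|\ge r),$$ primes denoting radial derivatives. As $r\to0^+$, $v_r(x)\to u(x)$ for every $x\in B$. (4) There is an $r_0\in(0,1)$ such that $f_r>0$ in $B(0,r)\setminus\{0\}$ for all $0<r<r_0$; $\sup_{0<r<r_0}\|f_r\|_{L^1(B)}<\infty$; $v_r\le v_s$ in $B$ whenever $0<s\le r<r_0$; and, for every log-Hölder continuous variable exponent $q$ on $B$: if $p(0)<n$, then $\sup_{0<r<r_0}\|v_r\|_{w\text{-}L^{q(\cdot)}(B)}<\infty$ if and only if $q(0)\le\frac{n(p(0)-1)}{n-p(0)}$; and $\sup_{0<r<r_0}\||\nabla v_r|\|_{w\text{-}L^{q(\cdot)}(B)}<\infty$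 if and only if $q(0)\le\frac{n(p(0)-1)}{n-1}$. -/

import Mathlib

open MeasureTheory Set Filter Topology
open scoped ENNReal

noncomputable section

namespace VarExp

/-- Euclidean space `ℝⁿ`. -/
abbrev E (n : ℕ) : Type := EuclideanSpace ℝ (Fin n)

/-- The open unit ball of `ℝⁿ`. -/
abbrev unitBall (n : ℕ) : Set (E n) := Metric.ball (0 : E n) 1

variable {n : ℕ}

/-! ### Variable exponents and weak Lebesgue spaces -/

/-- Variable exponents on `A`: measurable `q : A → (0, ∞)` with `0 < q⁻ ≤ q⁺ < ∞`. -/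
def IsExponent (A : Set (E n)) (q : E n → ℝ) : Prop :=
  AEMeasurable q (volume.restrict A) ∧ (∀ x ∈ A, 0 < q x) ∧
    ∃ a b : ℝ, 0 < a ∧ ∀ᵐ x ∂(volume.restrict A), a ≤ q x ∧ q x ≤ b

/-- Log-Hölder continuity: the local condition together with the decay condition at infinity. -/
def IsLogHolder (A : Set (E n)) (q : E n → ℝ) : Prop :=
  (∃ c : ℝ, ∀ x ∈ A, ∀ y ∈ A,
      |q x - q y| ≤ c / Real.log (Real.exp 1 + 1 / ‖x - y‖)) ∧
    ∃ qinf c : ℝ, 1 ≤ qinf ∧ 0 < c ∧ ∀ x ∈ A,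
      |q x - qinf| ≤ c / Real.log (Real.exp 1 + ‖x‖)

/-- The modular `∫_A |f|^{q(x)} dx`. -/
def modular (q : E n → ℝ) (A : Set (E n)) (f : E n → ℝ) : ℝ≥0∞ :=
  ∫⁻ x in A, ENNReal.ofReal (|f x| ^ q x)

/-- The Luxemburg norm of `L^{q(·)}(A)`, with value `∞` outside the space. -/
def luxNorm (q : E n → ℝ) (A : Set (E n)) (f : E n → ℝ) : ℝ≥0∞ :=
  ⨅ (t : ℝ) (_ : 0 < t) (_ : modular q A (fun x => f x / t) ≤ 1), ENNReal.ofReal t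

/-- The weak norm `sup_{t > 0} t ‖χ_{|f| > t}‖_{L^{q(·)}(A)}`. -/
def weakNorm (q : E n → ℝ) (A : Set (E n)) (f : E n → ℝ) : ℝ≥0∞ :=
  ⨆ (t : ℝ) (_ : 0 < t),
    ENNReal.ofReal t * luxNorm q A (indicator {x | t < |f x|} (fun _ => (1 : ℝ)))

/-- Membership in the weak Lebesgue space `w-L^{q(·)}(A)`. -/
def MemWeakL (q : E n → ℝ) (A : Set (E n)) (f : E n → ℝ) : Prop :=
  AEMeasurable f (volume.restrict A) ∧ weakNorm q A f < ⊤

/-! ### Weak derivatives -/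

/-- Test functions `C_0^∞(U)`. -/
def IsTest (U : Set (E n)) (φ : E n → ℝ) : Prop :=
  ContDiff ℝ ((⊤ : ℕ∞) : WithTop ℕ∞) φ ∧ HasCompactSupport φ ∧ tsupport φ ⊆ U

/-- `G` is the distributional gradient of `f` in the open set `U`, both locally integrable. -/
def HasWeakGradient (U : Set (E n)) (f : E n → ℝ) (G : E n → E n) : Prop :=
  LocallyIntegrableOn f U ∧ LocallyIntegrableOn G U ∧
    ∀ φ : E n → ℝ, IsTest U φ →
      ∫ x in U, f x • gradient φ x = - ∫ x in U, φ x • G x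

/-- `G` is the gradient of `f` in the sense of nonlinear potential theory: each truncation
`min (f, k)` is weakly differentiable, with gradient `G` on `{f < k}` and `0` elsewhere. -/
def HasTruncGradient (U : Set (E n)) (f : E n → ℝ) (G : E n → E n) : Prop :=
  ∀ k : ℝ, HasWeakGradient U (fun x => min (f x) k) (indicator {x | f x < k} G)

/-- `f ∈ W^{1,p(·)}_loc(U)` with distributional gradient `G`. -/
def MemSobolevLoc (p : E n → ℝ) (U : Set (E n)) (f : E n → ℝ) (G : E n → E n) : Prop :=
  HasWeakGradient U f G ∧ ∀ K : Set (E n), IsCompact K → K ⊆ U →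
    modular p K f < ⊤ ∧ modular p K (fun x => ‖G x‖) < ⊤

/-! ### The `p(·)`-Laplacian with weight `w` -/

/-- The vector field `w |G|^{p(x)-2} G`. -/
def flux (w p : E n → ℝ) (G : E n → E n) (x : E n) : E n :=
  (w x * ‖G x‖ ^ (p x - 2)) • G x

/-- `-div (w |G|^{p(x)-2} G) = T` in `U` in the sense of distributions. -/
def SatisfiesEq (w p : E n → ℝ) (U : Set (E n)) (G : E n → E n)
    (T : (E n → ℝ) → ℝ) : Prop :=
  LocallyIntegrableOn (flux w p G) U ∧
    ∀ φ : E n → ℝ, IsTest U φ →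
      ∫ x in U, inner ℝ (flux w p G x) (gradient φ x) = T φ

/-- Weak solutions of `-div (w |∇h|^{p(x)-2} ∇h) = 0` in the open set `D`, tested with the
compactly supported functions in `W^{1,p(·)}(D)`. -/
def IsWeakSolution (w p : E n → ℝ) (D : Set (E n)) (h : E n → ℝ) : Prop :=
  ∃ H : E n → E n, MemSobolevLoc p D h H ∧
    ∀ (φ : E n → ℝ) (Φ : E n → E n), MemSobolevLoc p D φ Φ →
      (∃ K : Set (E n), IsCompact K ∧ K ⊆ D ∧ ∀ x ∈ D \ K, φ x = 0) →
      ∫ x in D, inner ℝ (flux w p H x) (Φ x) = 0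

/-- `p(·)`-superharmonic functions `u : Ω → (-∞, ∞]` for the operator with weight `w`. -/
structure IsSuperharmonic (w p : E n → ℝ) (Ω : Set (E n)) (u : E n → EReal) : Prop where
  ne_bot : ∀ x ∈ Ω, u x ≠ ⊥
  lsc : LowerSemicontinuousOn u Ω
  finite_ae : ∀ᵐ x ∂(volume.restrict Ω), u x ≠ ⊤
  comparison : ∀ D : Set (E n), IsOpen D → IsCompact (closure D) → closure D ⊆ Ω →
    ∀ h : E n → ℝ, ContinuousOn h (closure D) → IsWeakSolution w p D h →
      (∀ x ∈ frontier D, (h x : EReal) ≤ u x) → ∀ x ∈ D, (h x : EReal) ≤ u x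

/-! ### The fundamental-type function and its modifications

A radial function on the ball is given by its profile: `p(x) = P ‖x‖`, `w(x) = W ‖x‖`. -/

/-- The radial function with profile `P`. -/
def radial (n : ℕ) (P : ℝ → ℝ) : E n → ℝ := fun x => P ‖x‖

/-- `u(x) = ∫_{|x|}^1 (w(ρ) ρ^{n-1})^{-1/(p(ρ)-1)} dρ`, with values in `[0, ∞]`. -/
def fundE (n : ℕ) (P W : ℝ → ℝ) (x : E n) : ℝ≥0∞ :=
  ∫⁻ ρ in Ioo ‖x‖ 1, ENNReal.ofReal ((W ρ * ρ ^ (n - 1)) ^ (-1 / (P ρ - 1)))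

/-- The real-valued version of `u`; it differs from `u` at most at the origin. -/
def fund (n : ℕ) (P W : ℝ → ℝ) (x : E n) : ℝ := (fundE n P W x).toReal

/-- The function equal to `a - b |x|` for `|x| ≤ r` and to `u` otherwise. -/
def capped (n : ℕ) (P W : ℝ → ℝ) (r a b : ℝ) (x : E n) : ℝ :=
  if ‖x‖ ≤ r then a - b * ‖x‖ else fund n P W x

/-- `b^{p(x)-1} (w(x) ((n-1)/|x| + p'(x) log b) + w'(x))` in `B(0,r)`, and `0` outside;
primes are radial derivatives. -/
def cappedData (n : ℕ) (P W : ℝ → ℝ) (r b : ℝ) (x : E n) : ℝ :=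
  if ‖x‖ < r then
    b ^ (P ‖x‖ - 1) *
      (W ‖x‖ * (((n : ℝ) - 1) / ‖x‖ + deriv P ‖x‖ * Real.log b) + deriv W ‖x‖)
  else 0

end VarExp

end

open MeasureTheory Set Filter Topology
open scoped ENNReal

noncomputable section

namespace VarExp

/-! Everything is reduced to one radial variable. The slope `s = (w ρ^{n-1})^{-1/(p-1)}` is chosen
so that `ρ^{n-1} w s^{p-1} = 1`. Hence the flux of `u` is the Newtonian field `-x|x|^{-n}`, whatever
`p` and `w` are, and on every ray its pairing with a test function telescopes to `φ(0)`. The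
constant `K` is the total measure of the unit sphere (`satisfiesEq_dirac`).

The functions `u` and `v_r` belong to one family: the radial functions whose gradient has norm
`s(max(|x|, r))`. The value `r = 0` gives `u`, and freezing the slope inside `B(0,r)` is exactly the
`C^1` affine continuation, so `r > 0` gives `v_r`. Gradients, bounds and weak norms are treated
once, with constants independent of `r`. Since `p` is Lipschitz at the origin, replacing `p(ρ)` by
`p(0)` changes the slope only by a bounded factor, so `s(ρ) ≈ ρ^{-β}` with `β = (n-1)/(p(0)-1)`
(`slope_bounds`).

The weak spaces see only this power. Log-Hölder continuity at the origin gives `‖χ_{B(0,R)}‖_{q(·)}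
≈ R^{n/q(0)}`, so a function of size `|x|^{-α}` is in the weak space exactly when `q(0) ≤ n/α`. This
is applied with `α = β` for gradients and, when `p(0) < n`, with `α = β - 1` for functions.

With the slope frozen at `b`, the function `ρ^{n-1} w b^{p-1}` has derivative `ρ^{n-1} f_r`, which
yields the equation for `v_r`. For small `r` the term `(n-1)/ρ > (n-1)/r` dominates `p' log b_r`,
which is only of order `|log r|`; hence `f_r > 0`. Positivity makes the slope decreasing near the
origin, so `v_r` increases as `r` decreases, and testing with a function equal to `1` near the
origin shows that `f_r` has the same total mass as `K δ_0`.

Superharmonicity is proved by a direct comparison (`sub_truncFund_le`). The equation of `h` is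
tested with a smooth cutoff of `h - min(u,k)`. The Newtonian field pairs with the right sign against
gradients of nonnegative compactly supported functions, and strict monotonicity of the operator then
forces the gradient of the cutoff to vanish. Making this test function admissible requires a chain
rule for weak gradients, proved by mollification, and finite energy of the truncations of `u`. -/

/-- The structural properties of the exponent profile `P` and the weight profile `W`. -/
structure Admissible (n : ℕ) (P W : ℝ → ℝ) : Prop where
  two_le : 2 ≤ n
  exp_bounds : ∃ p₁ p₂ : ℝ, 1 < p₁ ∧ ∀ ρ ∈ Ico (0 : ℝ) 1, p₁ ≤ P ρ ∧ P ρ ≤ p₂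
  weight_bounds : ∃ C : ℝ, ∀ ρ ∈ Ico (0 : ℝ) 1, 1 ≤ W ρ ∧ W ρ ≤ C
  contDiffOn_exp : ContDiffOn ℝ 1 P (Ioo 0 1)
  contDiffOn_weight : ContDiffOn ℝ 1 W (Ioo 0 1)
  continuousOn_exp : ContinuousOn P (Ico 0 1)
  continuousOn_weight : ContinuousOn W (Ico 0 1)
  deriv_bounds : ∀ R < (1 : ℝ), ∃ C : ℝ, ∀ ρ ∈ Ioo (0 : ℝ) R, |deriv P ρ| ≤ C ∧ |deriv W ρ| ≤ C
  lipschitz_zero : ∃ L : ℝ, ∀ ρ ∈ Ico (0 : ℝ) 1, |P ρ - P 0| ≤ L * ρ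

/-- The profile `(w(ρ) ρ^{n-1})^{-1/(p(ρ)-1)}` of `|∇u|`. -/
def slope (n : ℕ) (P W : ℝ → ℝ) (ρ : ℝ) : ℝ := (W ρ * ρ ^ (n - 1)) ^ (-1 / (P ρ - 1))

/-- The profile of the function whose gradient has norm `slope (max |x| r)`. -/
def profile (n : ℕ) (P W : ℝ → ℝ) (r ρ : ℝ) : ℝ := ∫ s in ρ..1, slope n P W (max s r)

/-- The gradient of the function with profile `profile r`. -/
def radialField (n : ℕ) (P W : ℝ → ℝ) (r : ℝ) (x : E n) : E n :=
  (-slope n P W (max ‖x‖ r) * ‖x‖⁻¹) • x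

/-- The order of growth of `|∇u|` at the origin. -/
def growth (n : ℕ) (P : ℝ → ℝ) : ℝ := ((n : ℝ) - 1) / (P 0 - 1)

variable {n : ℕ} {P W : ℝ → ℝ}

/-! ### Growth of the slope and calculus of the profiles -/

namespace Admissible

theorem exp_gt_one (h : Admissible n P W) {ρ : ℝ} (hρ : ρ ∈ Ico (0 : ℝ) 1) : 1 < P ρ := by
  obtain ⟨p₁, p₂, h1, h2⟩ := h.exp_bounds
  exact h1.trans_le (h2 ρ hρ).1

theorem weight_pos (h : Admissible n P W) {ρ : ℝ} (hρ : ρ ∈ Ico (0 : ℝ) 1) : 0 < W ρ := by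
  obtain ⟨C, hC⟩ := h.weight_bounds
  linarith [(hC ρ hρ).1]

theorem growth_pos (h : Admissible n P W) : 0 < growth n P := by
  have h1 := h.exp_gt_one (ρ := 0) (by simp)
  have h2 : (2 : ℝ) ≤ n := by exact_mod_cast h.two_le
  exact div_pos (by linarith) (by linarith)

theorem slope_pos (h : Admissible n P W) {ρ : ℝ} (hρ : ρ ∈ Ioo (0 : ℝ) 1) :
    0 < slope n P W ρ :=
  Real.rpow_pos_of_pos (mul_pos (h.weight_pos ⟨hρ.1.le, hρ.2⟩) (pow_pos hρ.1 _)) _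

theorem slope_rpow (h : Admissible n P W) {ρ : ℝ} (hρ : ρ ∈ Ioo (0 : ℝ) 1) :
    slope n P W ρ ^ (P ρ - 1) = (W ρ * ρ ^ (n - 1))⁻¹ := by
  have h1 := h.exp_gt_one ⟨hρ.1.le, hρ.2⟩
  have h2 : 0 < W ρ * ρ ^ (n - 1) := mul_pos (h.weight_pos ⟨hρ.1.le, hρ.2⟩) (pow_pos hρ.1 _)
  rw [slope, ← Real.rpow_mul h2.le, div_mul_cancel₀ _ (by linarith), Real.rpow_neg_one]

theorem continuousOn_slope (h : Admissible n P W) : ContinuousOn (slope n P W) (Ioo 0 1) := by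
  unfold slope
  refine ContinuousOn.rpow ?_ ?_ ?_
  · exact h.contDiffOn_weight.continuousOn.mul (by fun_prop)
  · refine ContinuousOn.div continuousOn_const
      (h.contDiffOn_exp.continuousOn.sub continuousOn_const) fun ρ hρ => ?_
    have := h.exp_gt_one ⟨hρ.1.le, hρ.2⟩
    linarith
  · intro ρ hρ
    exact Or.inl (mul_pos (h.weight_pos ⟨hρ.1.le, hρ.2⟩) (pow_pos hρ.1 _)).ne'

/-- On the logarithmic scale the error splits in two. The weight contributes at most `log C / (p₁ -
1)`. Freezing the exponent at the origin costs a multiple of `|log ρ| |P ρ - P 0| ≤ L ρ |log ρ| ≤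
L`, by the Lipschitz bound at `0`. -/
theorem slope_bounds (h : Admissible n P W) : ∃ c : ℝ, 1 ≤ c ∧ ∀ ρ ∈ Ioo (0 : ℝ) 1,
    c⁻¹ * ρ ^ (-growth n P) ≤ slope n P W ρ ∧ slope n P W ρ ≤ c * ρ ^ (-growth n P) := by
  obtain ⟨p₁, p₂, hp₁, hp⟩ := h.exp_bounds
  obtain ⟨C, hC⟩ := h.weight_bounds
  obtain ⟨L, hL⟩ := h.lipschitz_zero
  have hn : (2 : ℝ) ≤ n := by exact_mod_cast h.two_le
  have hn1 : 0 ≤ (n : ℝ) - 1 := by linarith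
  have hC1 : 1 ≤ C := (hC 0 (by simp)).1.trans (hC 0 (by simp)).2
  have hp0 := hp 0 (by simp)
  have hL0 : 0 ≤ L := by
    have := (abs_nonneg _).trans (hL (1/2) (by norm_num))
    linarith
  set M : ℝ := Real.log C / (p₁ - 1) + (n - 1) * L / ((p₁ - 1) * (p₁ - 1)) with hM
  have hlogC : 0 ≤ Real.log C := Real.log_nonneg hC1
  have hq : 0 < p₁ - 1 := by linarith
  have hM0 : 0 ≤ M := by positivity
  have key : ∀ ρ ∈ Ioo (0 : ℝ) 1,
      |Real.log (slope n P W ρ) - Real.log (ρ ^ (-growth n P))| ≤ M := by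
    intro ρ hρ
    have hρ' : ρ ∈ Ico (0 : ℝ) 1 := ⟨hρ.1.le, hρ.2⟩
    have hW := hC ρ hρ'
    have hW0 : 0 < W ρ := by linarith
    have hPρ := hp ρ hρ'
    rw [slope, Real.log_rpow (by positivity [hρ.1]), Real.log_rpow hρ.1,
      Real.log_mul hW0.ne' (pow_pos hρ.1 _).ne', Real.log_pow,
      Nat.cast_sub (by have := h.two_le; omega)]
    have e : -1 / (P ρ - 1) * (Real.log (W ρ) + ((n : ℝ) - (1 : ℕ)) * Real.log ρ)
        - -growth n P * Real.log ρ = -(Real.log (W ρ) / (P ρ - 1)) +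
        (n - 1) * ((Real.log ρ * (P ρ - P 0)) / ((P ρ - 1) * (P 0 - 1))) := by
      have h1 : P ρ - 1 ≠ 0 := by linarith
      have h2 : P 0 - 1 ≠ 0 := by linarith
      rw [growth]
      field_simp
      push_cast
      ring
    rw [e]
    refine (abs_add_le _ _).trans (add_le_add ?_ ?_)
    · rw [abs_neg, abs_div, abs_of_nonneg (Real.log_nonneg hW.1), abs_of_pos (by linarith)]
      exact div_le_div₀ hlogC (Real.log_le_log hW0 hW.2) hq (by linarith)
    · rw [abs_mul, abs_of_nonneg hn1, mul_div_assoc ((n : ℝ) - 1) L]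
      refine mul_le_mul_of_nonneg_left ?_ hn1
      rw [abs_div]
      refine div_le_div₀ hL0 ?_ (by positivity) ?_
      · rw [abs_mul]
        have h1 := Real.abs_log_mul_self_lt ρ hρ.1 hρ.2.le
        rw [abs_mul, abs_of_pos hρ.1] at h1
        calc |Real.log ρ| * |P ρ - P 0| ≤ |Real.log ρ| * (L * ρ) := by
              gcongr; exact hL ρ hρ'
          _ = L * (|Real.log ρ| * ρ) := by ring
          _ ≤ L * 1 := by gcongr
          _ = L := mul_one L
      · rw [abs_mul, abs_of_pos (by linarith : (0:ℝ) < P ρ - 1),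
          abs_of_pos (by linarith : (0:ℝ) < P 0 - 1)]
        gcongr <;> linarith
  refine ⟨Real.exp M, Real.one_le_exp hM0, fun ρ hρ => ?_⟩
  have hk := abs_le.1 (key ρ hρ)
  have hs := h.slope_pos hρ
  have ht : 0 < ρ ^ (-growth n P) := Real.rpow_pos_of_pos hρ.1 _
  constructor
  · rw [← Real.exp_neg]
    calc Real.exp (-M) * ρ ^ (-growth n P)
        = Real.exp (-M + Real.log (ρ ^ (-growth n P))) := by rw [Real.exp_add, Real.exp_log ht]
      _ ≤ Real.exp (Real.log (slope n P W ρ)) := Real.exp_le_exp.2 (by linarith)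
      _ = _ := Real.exp_log hs
  · calc slope n P W ρ = Real.exp (Real.log (slope n P W ρ)) := (Real.exp_log hs).symm
      _ ≤ Real.exp (M + Real.log (ρ ^ (-growth n P))) := Real.exp_le_exp.2 (by linarith)
      _ = _ := by rw [Real.exp_add, Real.exp_log ht]

theorem max_mem {s r : ℝ} (hs : s ∈ Ioo (0 : ℝ) 1) (hr : r ∈ Ico (0 : ℝ) 1) :
    max s r ∈ Ioo (0 : ℝ) 1 := ⟨lt_max_of_lt_left hs.1, max_lt hs.2 hr.2⟩

theorem continuousOn_slope_max (h : Admissible n P W) {r : ℝ} (hr : r ∈ Ico (0 : ℝ) 1) :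
    ContinuousOn (fun s => slope n P W (max s r)) (Ioo 0 1) :=
  h.continuousOn_slope.comp (by fun_prop) fun _ hs => max_mem hs hr

/-- The constant does not depend on `r`, so the second bound serves as a common majorant for `u` and
all the `v_r`. -/
theorem slope_max_le (h : Admissible n P W) : ∃ c : ℝ, 1 ≤ c ∧ ∀ r ∈ Ico (0 : ℝ) 1,
    ∀ ρ ∈ Ioo (0 : ℝ) 1, slope n P W (max ρ r) ≤ c * (max ρ r) ^ (-growth n P) ∧
      slope n P W (max ρ r) ≤ c * ρ ^ (-growth n P) := by
  obtain ⟨c, hc, hb⟩ := h.slope_bounds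
  refine ⟨c, hc, fun r hr ρ hρ => ?_⟩
  have h1 := (hb _ (max_mem hρ hr)).2
  refine ⟨h1, h1.trans ?_⟩
  gcongr ?_ * ?_
  exact Real.rpow_le_rpow_of_nonpos hρ.1 (le_max_left _ _) (by linarith [h.growth_pos])

/-- The condition `0 < max ρ r` covers both uses: `r > 0` up to the origin, and `r = 0` away from
it. -/
theorem integrableOn_slope_max (h : Admissible n P W) {r ρ : ℝ} (hr : r ∈ Ico (0 : ℝ) 1)
    (hρ : 0 ≤ ρ) (hm : 0 < max ρ r) :
    IntegrableOn (fun s => slope n P W (max s r)) (Ioo ρ 1) := by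
  obtain ⟨c, hc, hb⟩ := h.slope_max_le
  have hsub : Ioo ρ 1 ⊆ Ioo (0 : ℝ) 1 := Ioo_subset_Ioo_left hρ
  refine IntegrableOn.of_bound (C := c * (max ρ r) ^ (-growth n P)) (by simp)
    (((h.continuousOn_slope_max hr).mono hsub).aestronglyMeasurable measurableSet_Ioo) ?_
  refine (ae_restrict_iff' measurableSet_Ioo).2 (ae_of_all _ fun s hs => ?_)
  have hs' := hsub hs
  rw [Real.norm_of_nonneg (h.slope_pos (max_mem hs' hr)).le]
  refine (hb r hr s hs').1.trans ?_
  gcongr ?_ * ?_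
  exact Real.rpow_le_rpow_of_nonpos hm (max_le_max_right _ hs.1.le) (by linarith [h.growth_pos])

theorem intervalIntegrable_slope_max (h : Admissible n P W) {r ρ : ℝ} (hr : r ∈ Ico (0 : ℝ) 1)
    (hρ : 0 ≤ ρ) (hm : 0 < max ρ r) (hρ1 : ρ ≤ 1) :
    IntervalIntegrable (fun s => slope n P W (max s r)) volume ρ 1 := by
  rw [intervalIntegrable_iff_integrableOn_Ioo_of_le hρ1]
  exact h.integrableOn_slope_max hr hρ hm

theorem hasDerivAt_profile (h : Admissible n P W) {r ρ : ℝ} (hr : r ∈ Ico (0 : ℝ) 1)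
    (hρ : ρ ∈ Ioo (0 : ℝ) 1) :
    HasDerivAt (profile n P W r) (-slope n P W (max ρ r)) ρ := by
  refine intervalIntegral.integral_hasDerivAt_left
    (h.intervalIntegrable_slope_max hr hρ.1.le (lt_max_of_lt_left hρ.1) hρ.2.le) ?_ ?_
  · exact (h.continuousOn_slope_max hr).stronglyMeasurableAtFilter isOpen_Ioo _ hρ
  · exact (h.continuousOn_slope_max hr).continuousAt (isOpen_Ioo.mem_nhds hρ)

theorem contDiffOn_profile (h : Admissible n P W) {r : ℝ} (hr : r ∈ Ico (0 : ℝ) 1) :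
    ContDiffOn ℝ 1 (profile n P W r) (Ioo 0 1) := by
  have := contDiffOn_succ_iff_deriv_of_isOpen (𝕜 := ℝ) (n := 0) (f := profile n P W r)
    (isOpen_Ioo (a := (0:ℝ)) (b := 1))
  rw [zero_add] at this
  refine this.2 ⟨fun ρ hρ => (h.hasDerivAt_profile hr hρ).differentiableAt.differentiableWithinAt,
    by simp, ?_⟩
  rw [contDiffOn_zero]
  exact (h.continuousOn_slope_max hr).neg.congr fun ρ hρ => (h.hasDerivAt_profile hr hρ).deriv

/-- No integrability is needed: if the integral diverges at `r = ρ = 0`, its value is `0` by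
convention. -/
theorem profile_nonneg (h : Admissible n P W) {r ρ : ℝ} (hr : r ∈ Ico (0 : ℝ) 1)
    (hρ : ρ ∈ Icc (0 : ℝ) 1) : 0 ≤ profile n P W r ρ := by
  rw [profile, intervalIntegral.integral_of_le hρ.2, integral_Ioc_eq_integral_Ioo]
  exact setIntegral_nonneg measurableSet_Ioo fun s hs =>
    (h.slope_pos (max_mem ⟨hρ.1.trans_lt hs.1, hs.2⟩ hr)).le

theorem profile_sub (h : Admissible n P W) {r ρ σ : ℝ} (hr : r ∈ Ico (0 : ℝ) 1)
    (hρ : 0 ≤ ρ) (hm : 0 < max ρ r) (hσ : ρ ≤ σ) (hσ1 : σ ≤ 1) :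
    profile n P W r ρ - profile n P W r σ = ∫ s in ρ..σ, slope n P W (max s r) := by
  have h1 := h.intervalIntegrable_slope_max hr hρ hm (hσ.trans hσ1)
  have h2 : IntervalIntegrable (fun s => slope n P W (max s r)) volume ρ σ :=
    h1.mono_set (by rw [uIcc_of_le hσ, uIcc_of_le (hσ.trans hσ1)]; exact Icc_subset_Icc_right hσ1)
  have h3 : IntervalIntegrable (fun s => slope n P W (max s r)) volume σ 1 :=
    h1.mono_set (by rw [uIcc_of_le hσ1, uIcc_of_le (hσ.trans hσ1)]; exact Icc_subset_Icc_left hσ)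
  rw [profile, profile, ← intervalIntegral.integral_add_adjacent_intervals h2 h3]
  ring

theorem profile_strictAnti (h : Admissible n P W) {r ρ σ : ℝ} (hr : r ∈ Ico (0 : ℝ) 1)
    (hρ : 0 ≤ ρ) (hm : 0 < max ρ r) (hσ : ρ < σ) (hσ1 : σ ≤ 1) :
    profile n P W r σ < profile n P W r ρ := by
  have h1 := h.profile_sub hr hρ hm hσ.le hσ1
  have h2 : 0 < ∫ s in ρ..σ, slope n P W (max s r) := by
    refine intervalIntegral.intervalIntegral_pos_of_pos_on ?_ (fun s hs => ?_) hσ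
    · refine (h.intervalIntegrable_slope_max hr hρ hm (hσ.le.trans hσ1)).mono_set ?_
      rw [uIcc_of_le hσ.le, uIcc_of_le (hσ.le.trans hσ1)]; exact Icc_subset_Icc_right hσ1
    · exact h.slope_pos (max_mem ⟨hρ.trans_lt hs.1, hs.2.trans_le hσ1⟩ hr)
  linarith

theorem profile_eq_of_le {r ρ : ℝ} (hr : 0 ≤ r) (hρ : r ≤ ρ) (hρ1 : ρ ≤ 1) :
    profile n P W r ρ = profile n P W 0 ρ := by
  refine intervalIntegral.integral_congr fun s hs => ?_
  rw [uIcc_of_le hρ1] at hs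
  rw [max_eq_left (hρ.trans hs.1), max_eq_left (hr.trans (hρ.trans hs.1))]

/-- Below `r` the integrand is the constant `slope r`, so the profile is affine there; the formula
displays `a_r` and `b_r`. -/
theorem profile_of_le (h : Admissible n P W) {r ρ : ℝ} (hr : r ∈ Ioo (0 : ℝ) 1) (hρ : 0 ≤ ρ)
    (hρr : ρ ≤ r) :
    profile n P W r ρ = profile n P W 0 r + r * slope n P W r - slope n P W r * ρ := by
  have h1 := h.profile_sub ⟨hr.1.le, hr.2⟩ hρ (lt_max_of_lt_right hr.1) hρr hr.2.le
  rw [profile_eq_of_le hr.1.le le_rfl hr.2.le] at h1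
  have h2 : ∫ s in ρ..r, slope n P W (max s r) = ∫ s in ρ..r, slope n P W r := by
    refine intervalIntegral.integral_congr fun s hs => ?_
    rw [uIcc_of_le hρr] at hs
    rw [max_eq_right hs.2]
  rw [h2, intervalIntegral.integral_const, smul_eq_mul] at h1
  linarith

end Admissible

/-! ### Radial functions on the ball and the constants of the modifications -/

theorem hasGradientAt_comp_norm {f : ℝ → ℝ} {f' : ℝ} {x : E n} (hx : x ≠ 0)
    (hf : HasDerivAt f f' ‖x‖) : HasGradientAt (fun y : E n => f ‖y‖) ((f' * ‖x‖⁻¹) • x) x := by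
  have hx0 : 0 < ‖x‖ := norm_pos_iff.2 hx
  have h1 : HasFDerivAt (fun y : E n => ‖y‖) (‖x‖⁻¹ • innerSL ℝ x) x := by
    have h2 := ((hasStrictFDerivAt_norm_sq x).hasFDerivAt).sqrt (by positivity)
    have h3 : (fun y : E n => √(‖y‖ ^ 2)) = fun y => ‖y‖ := by
      funext y
      exact Real.sqrt_sq (norm_nonneg y)
    rw [h3, Real.sqrt_sq hx0.le] at h2
    have h4 : (1 / (2 * ‖x‖)) • 2 • innerSL ℝ x = ‖x‖⁻¹ • innerSL ℝ x := by
      rw [← Nat.cast_smul_eq_nsmul ℝ, smul_smul]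
      congr 1
      push_cast
      field_simp
    rwa [h4] at h2
  rw [hasGradientAt_iff_hasFDerivAt]
  have h2 := hf.comp_hasFDerivAt x h1
  have h3 : f' • ‖x‖⁻¹ • innerSL ℝ x = InnerProductSpace.toDual ℝ (E n) ((f' * ‖x‖⁻¹) • x) := by
    refine ContinuousLinearMap.ext fun y => ?_
    simp only [smul_apply, innerSL_apply_apply, smul_eq_mul,
      InnerProductSpace.toDual_apply_apply, real_inner_smul_left, mul_assoc]
  rwa [h3] at h2

theorem norm_mem_Ioo {x : E n} (hx : x ∈ unitBall n) (h0 : x ≠ 0) : ‖x‖ ∈ Ioo (0 : ℝ) 1 :=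
  ⟨norm_pos_iff.2 h0, by simpa using hx⟩

theorem norm_mem_Ico {x : E n} (hx : x ∈ unitBall n) : ‖x‖ ∈ Ico (0 : ℝ) 1 :=
  ⟨norm_nonneg _, by simpa using hx⟩

theorem isOpen_punctured : IsOpen (unitBall n \ {0}) :=
  Metric.isOpen_ball.sdiff isClosed_singleton

/-- The fields are continuous only off the origin; measurability and almost everywhere statements
are transferred through this identity. -/
theorem ball_ae_eq_punctured [Nontrivial (E n)] (s : Set (E n)) :
    (s \ {0} : Set (E n)) =ᵐ[volume] s := by
  exact sdiff_null_ae_eq_self (by simp)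

namespace Admissible

theorem nontrivial (h : Admissible n P W) : Nontrivial (E n) := by
  have : Nonempty (Fin n) := ⟨⟨0, by have := h.two_le; omega⟩⟩
  infer_instance

theorem norm_radialField (h : Admissible n P W) {r : ℝ} (hr : r ∈ Ico (0 : ℝ) 1) {x : E n}
    (hx : x ∈ unitBall n) (h0 : x ≠ 0) : ‖radialField n P W r x‖ = slope n P W (max ‖x‖ r) := by
  have := norm_mem_Ioo hx h0
  rw [radialField, norm_smul, norm_mul, norm_neg, norm_inv, norm_norm,
    inv_mul_cancel_right₀ this.1.ne', Real.norm_of_nonneg (h.slope_pos (max_mem this hr)).le]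

theorem hasGradientAt_profile (h : Admissible n P W) {r : ℝ} (hr : r ∈ Ico (0 : ℝ) 1) {x : E n}
    (hx : x ∈ unitBall n) (h0 : x ≠ 0) :
    HasGradientAt (fun y : E n => profile n P W r ‖y‖) (radialField n P W r x) x :=
  hasGradientAt_comp_norm h0 (h.hasDerivAt_profile hr (norm_mem_Ioo hx h0))

theorem contDiffOn_profile_norm (h : Admissible n P W) {r : ℝ} (hr : r ∈ Ico (0 : ℝ) 1) :
    ContDiffOn ℝ 1 (fun y : E n => profile n P W r ‖y‖) (unitBall n \ {0}) :=
  (h.contDiffOn_profile hr).comp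
    (fun _ hx => (contDiffAt_norm ℝ hx.2).contDiffWithinAt) fun _ hx => norm_mem_Ioo hx.1 hx.2

theorem continuousOn_radialField (h : Admissible n P W) {r : ℝ} (hr : r ∈ Ico (0 : ℝ) 1) :
    ContinuousOn (radialField n P W r) (unitBall n \ {0}) := by
  have h1 : ContinuousOn (fun x : E n => slope n P W (max ‖x‖ r)) (unitBall n \ {0}) :=
    (h.continuousOn_slope_max hr).comp continuous_norm.continuousOn
      fun x hx => norm_mem_Ioo hx.1 hx.2
  have h2 : ContinuousOn (fun x : E n => ‖x‖⁻¹) (unitBall n \ {0}) :=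
    continuous_norm.continuousOn.inv₀ fun x hx => by simpa using hx.2
  exact (h1.neg.mul h2).smul continuousOn_id

theorem aestronglyMeasurable_radialField (h : Admissible n P W) {r : ℝ} (hr : r ∈ Ico (0 : ℝ) 1) :
    AEStronglyMeasurable (radialField n P W r) (volume.restrict (unitBall n)) := by
  have := h.nontrivial
  rw [← Measure.restrict_congr_set (ball_ae_eq_punctured (unitBall n))]
  exact (h.continuousOn_radialField hr).aestronglyMeasurable isOpen_punctured.measurableSet

theorem fundE_eq (h : Admissible n P W) {x : E n} (hx : x ∈ unitBall n) (h0 : x ≠ 0) :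
    fundE n P W x = ENNReal.ofReal (profile n P W 0 ‖x‖) := by
  have hx' := norm_mem_Ioo hx h0
  rw [profile, intervalIntegral.integral_of_le hx'.2.le, integral_Ioc_eq_integral_Ioo,
    ofReal_integral_eq_lintegral_ofReal (h.integrableOn_slope_max (by simp) hx'.1.le
      (lt_max_of_lt_left hx'.1))]
  · refine setLIntegral_congr_fun measurableSet_Ioo fun s hs => ?_
    rw [max_eq_left (hx'.1.le.trans hs.1.le), slope]
  · refine (ae_restrict_iff' measurableSet_Ioo).2 (ae_of_all _ fun s hs => ?_)
    exact (h.slope_pos (max_mem ⟨hx'.1.trans hs.1, hs.2⟩ (by simp))).le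

theorem fund_eq (h : Admissible n P W) {x : E n} (hx : x ∈ unitBall n) (h0 : x ≠ 0) :
    fund n P W x = profile n P W 0 ‖x‖ := by
  have hx' := norm_mem_Ioo hx h0
  rw [fund, h.fundE_eq hx h0,
    ENNReal.toReal_ofReal (h.profile_nonneg (by simp) ⟨hx'.1.le, hx'.2.le⟩)]

theorem fundE_ne_top (h : Admissible n P W) {x : E n} (hx : x ∈ unitBall n) (h0 : x ≠ 0) :
    fundE n P W x ≠ ⊤ := by
  rw [h.fundE_eq hx h0]
  exact ENNReal.ofReal_ne_top

theorem contDiffOn_fund (h : Admissible n P W) :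
    ContDiffOn ℝ 1 (fund n P W) (unitBall n \ {0}) :=
  (h.contDiffOn_profile_norm (by simp)).congr fun _ hx => h.fund_eq hx.1 hx.2

theorem gradient_fund (h : Admissible n P W) {x : E n} (hx : x ∈ unitBall n) (h0 : x ≠ 0) :
    gradient (fund n P W) x = radialField n P W 0 x := by
  refine HasGradientAt.gradient ?_
  rw [hasGradientAt_iff_hasFDerivAt]
  refine (hasGradientAt_iff_hasFDerivAt.1
    (h.hasGradientAt_profile (by simp) hx h0)).congr_of_eventuallyEq ?_
  filter_upwards [isOpen_punctured.mem_nhds ⟨hx, h0⟩] with y hy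
  exact h.fund_eq hy.1 hy.2

/-- In contrast to `fund_eq`, the origin is included, because the affine formula is valid there. -/
theorem capped_eq (h : Admissible n P W) {r : ℝ} (hr : r ∈ Ioo (0 : ℝ) 1) {x : E n}
    (hx : x ∈ unitBall n) :
    capped n P W r (profile n P W 0 r + r * slope n P W r) (slope n P W r) x =
      profile n P W r ‖x‖ := by
  rw [capped]
  split_ifs with hxr
  · rw [h.profile_of_le hr (norm_nonneg _) hxr]
  · rw [not_le] at hxr
    have h0 : x ≠ 0 := norm_pos_iff.1 (hr.1.trans hxr)
    rw [h.fund_eq hx h0, profile_eq_of_le hr.1.le hxr.le (norm_mem_Ioo hx h0).2.le]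

theorem contDiffOn_capped (h : Admissible n P W) {r : ℝ} (hr : r ∈ Ioo (0 : ℝ) 1) :
    ContDiffOn ℝ 1 (capped n P W r (profile n P W 0 r + r * slope n P W r) (slope n P W r))
      (unitBall n \ {0}) :=
  (h.contDiffOn_profile_norm ⟨hr.1.le, hr.2⟩).congr fun _ hx => h.capped_eq hr hx.1

/-- Restrict to a ray. At `t = r` the limit from the right fixes the value, while the left
derivative is `-b` and the right derivative is `-slope r`; differentiability equates them. -/
theorem capped_unique (h : Admissible n P W) {r a b : ℝ} (hr : r ∈ Ioo (0 : ℝ) 1)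
    (hc : ContDiffOn ℝ 1 (capped n P W r a b) (unitBall n \ {0})) :
    a = profile n P W 0 r + r * slope n P W r ∧ b = slope n P W r := by
  have := h.nontrivial
  obtain ⟨e, he⟩ := exists_norm_eq (E n) (zero_le_one (α := ℝ))
  have hnorm : ∀ t : ℝ, 0 < t → ‖t • e‖ = t := fun t ht => by
    rw [norm_smul, he, mul_one, Real.norm_of_nonneg ht.le]
  have hmem : ∀ t ∈ Ioo (0 : ℝ) 1, t • e ∈ unitBall n \ {0} := fun t ht => by
    refine ⟨by simpa [hnorm t ht.1] using ht.2, ?_⟩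
    rw [mem_singleton_iff, ← norm_eq_zero, hnorm t ht.1]
    exact ht.1.ne'
  set c : ℝ → ℝ := fun t => capped n P W r a b (t • e) with hcdef
  have hcd : DifferentiableAt ℝ c r := by
    have h1 : DifferentiableAt ℝ (capped n P W r a b) (r • e) :=
      ((hc.differentiableOn one_ne_zero) _ (hmem r hr)).differentiableAt
        (isOpen_punctured.mem_nhds (hmem r hr))
    exact h1.comp (f := fun t : ℝ => t • e) r (by fun_prop)
  have hleft : ∀ t ∈ Ioc (0 : ℝ) r, c t = a - b * t := fun t ht => by
    simp only [hcdef, capped, hnorm t ht.1, if_pos ht.2]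
  have hright : ∀ t ∈ Ioo r 1, c t = profile n P W 0 t := fun t ht => by
    have ht' : t ∈ Ioo (0 : ℝ) 1 := ⟨hr.1.trans ht.1, ht.2⟩
    simp only [hcdef, capped, hnorm t ht'.1, if_neg (not_le.2 ht.1)]
    rw [h.fund_eq (hmem t ht').1 (hmem t ht').2, hnorm t ht'.1]
  have hprof := h.hasDerivAt_profile (r := 0) (by simp) hr
  have hcr : c r = profile n P W 0 r := by
    have h1 : Tendsto c (𝓝[>] r) (𝓝 (c r)) := hcd.continuousAt.mono_left nhdsWithin_le_nhds
    have h2 : Tendsto c (𝓝[>] r) (𝓝 (profile n P W 0 r)) := by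
      refine (hprof.continuousAt.mono_left nhdsWithin_le_nhds).congr' ?_
      filter_upwards [Ioo_mem_nhdsGT hr.2] with t ht
      exact (hright t ht).symm
    exact tendsto_nhds_unique h1 h2
  have hb : deriv c r = -b := by
    have h1 : HasDerivWithinAt c (-b) (Iic r) r := by
      have h2 : HasDerivWithinAt (fun t => a - b * t) (-b) (Iic r) r := by
        have := ((hasDerivAt_id r).const_mul b).const_sub a
        simpa using this.hasDerivWithinAt
      refine h2.congr_of_eventuallyEq ?_ (hleft r ⟨hr.1, le_rfl⟩)
      filter_upwards [Ioc_mem_nhdsLE hr.1] with t ht using hleft t ht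
    exact (uniqueDiffWithinAt_Iic r).eq_deriv _ hcd.hasDerivAt.hasDerivWithinAt h1
  have hs : deriv c r = -slope n P W r := by
    have h1 : HasDerivWithinAt c (-slope n P W r) (Ici r) r := by
      rw [max_eq_left hr.1.le] at hprof
      refine hprof.hasDerivWithinAt.congr_of_eventuallyEq ?_ hcr
      filter_upwards [Ico_mem_nhdsGE hr.2] with t ht
      rcases eq_or_lt_of_le ht.1 with rfl | h3
      · exact hcr
      · exact hright t ⟨h3, ht.2⟩
    exact (uniqueDiffWithinAt_Ici r).eq_deriv _ hcd.hasDerivAt.hasDerivWithinAt h1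
  have hb' : b = slope n P W r := by linarith
  refine ⟨?_, hb'⟩
  rw [hleft r ⟨hr.1, le_rfl⟩, hb'] at hcr
  linarith

theorem gradient_capped (h : Admissible n P W) {r : ℝ} (hr : r ∈ Ioo (0 : ℝ) 1) {x : E n}
    (hx : x ∈ unitBall n) (h0 : x ≠ 0) :
    gradient (capped n P W r (profile n P W 0 r + r * slope n P W r) (slope n P W r)) x =
      radialField n P W r x := by
  refine HasGradientAt.gradient ?_
  rw [hasGradientAt_iff_hasFDerivAt]
  refine (hasGradientAt_iff_hasFDerivAt.1
    (h.hasGradientAt_profile ⟨hr.1.le, hr.2⟩ hx h0)).congr_of_eventuallyEq ?_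
  filter_upwards [isOpen_punctured.mem_nhds ⟨hx, h0⟩] with y hy
  exact h.capped_eq hr hy.1

end Admissible

/-! ### Integration along rays -/

theorem integrableOn_norm_rpow [Nontrivial (E n)] {α : ℝ} (hα : α < n) :
    IntegrableOn (fun x : E n => ‖x‖ ^ (-α)) (unitBall n) := by
  have hn : 0 < n := by
    have := Module.finrank_pos (R := ℝ) (M := E n)
    simpa using this
  refine (integrableOn_fun_norm_addHaar volume (f := fun y : ℝ => y ^ (-α))).2 ?_
  rw [finrank_euclideanSpace_fin]
  have h1 : IntegrableOn (fun y : ℝ => y ^ ((n : ℝ) - 1 - α)) (Ioo 0 1) :=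
    (intervalIntegral.integrableOn_Ioo_rpow_iff one_pos).2 (by linarith)
  refine h1.congr_fun (fun y hy => ?_) measurableSet_Ioo
  simp only [smul_eq_mul]
  rw [← Real.rpow_natCast, ← Real.rpow_add hy.1, Nat.cast_sub hn]
  congr 1
  push_cast
  ring

/-- Integration in polar coordinates. -/
theorem integral_polar [Nontrivial (E n)] {f : E n → ℝ} (hf : Integrable f) :
    ∫ x, f x = ∫ ω : Metric.sphere (0 : E n) 1, (∫ ρ in Ioi (0 : ℝ), ρ ^ (n - 1) * f (ρ • ω.1))
      ∂(volume : Measure (E n)).toSphere := by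
  have hmp := (volume : Measure (E n)).measurePreserving_homeomorphUnitSphereProd
  rw [finrank_euclideanSpace_fin] at hmp
  set g : Metric.sphere (0 : E n) 1 × Ioi (0 : ℝ) → ℝ := fun z => f (z.2.1 • z.1.1) with hg
  have hgf : ∀ x : ({0}ᶜ : Set (E n)), g (homeomorphUnitSphereProd (E n) x) = f x.1 := by
    intro x
    have := (homeomorphUnitSphereProd (E n)).symm_apply_apply x
    conv_rhs => rw [← this]
    rfl
  have hemb := (homeomorphUnitSphereProd (E n)).measurableEmbedding
  have hgi : Integrable g ((volume : Measure (E n)).toSphere.prod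
      (Measure.volumeIoiPow (n - 1))) := by
    rw [← hmp.integrable_comp_emb hemb]
    have h1 : IntegrableOn f ({0}ᶜ : Set (E n)) := hf.integrableOn
    rw [integrableOn_iff_comap_subtypeVal (measurableSet_singleton _).compl] at h1
    exact h1.congr (ae_of_all _ fun x => (hgf x).symm)
  calc ∫ x, f x = ∫ x : ({0}ᶜ : Set (E n)), f x.1 ∂(Measure.comap Subtype.val volume) := by
        rw [integral_subtype_comap (measurableSet_singleton _).compl, restrict_compl_singleton]
    _ = ∫ z, g z ∂((volume : Measure (E n)).toSphere.prod (Measure.volumeIoiPow (n - 1))) := by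
        rw [← hmp.integral_comp hemb]
        exact integral_congr_ae (ae_of_all _ fun x => (hgf x).symm)
    _ = _ := by
        rw [integral_prod _ hgi]
        refine integral_congr_ae (ae_of_all _ fun ω => ?_)
        simp only [Measure.volumeIoiPow, ENNReal.ofReal]
        rw [integral_withDensity_eq_integral_smul
          (measurable_subtype_coe.pow_const _).real_toNNReal]
        rw [integral_subtype_comap measurableSet_Ioi
          fun a : ℝ => Real.toNNReal (a ^ (n - 1)) • f (a • ω.1)]
        refine setIntegral_congr_fun measurableSet_Ioi fun x hx => ?_
        beta_reduce
        rw [NNReal.smul_def, Real.coe_toNNReal _ (pow_nonneg (le_of_lt hx) _), smul_eq_mul]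

/-- The weak equations are radial enough to hold on each ray separately, so the divergence theorem
is replaced by the fundamental theorem of calculus. -/
theorem integral_eq_of_rays [Nontrivial (E n)] {f g : E n → ℝ} (hf : Integrable f)
    (hg : Integrable g)
    (H : ∀ ω : E n, ‖ω‖ = 1 → ∫ ρ in Ioi (0 : ℝ), ρ ^ (n - 1) * f (ρ • ω) =
      ∫ ρ in Ioi (0 : ℝ), ρ ^ (n - 1) * g (ρ • ω)) : ∫ x, f x = ∫ x, g x := by
  rw [integral_polar hf, integral_polar hg]
  exact integral_congr_ae (ae_of_all _ fun ω => H ω.1 (by simp))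

theorem integral_of_rays_const [Nontrivial (E n)] {f : E n → ℝ} (hf : Integrable f) {c : ℝ}
    (H : ∀ ω : E n, ‖ω‖ = 1 → ∫ ρ in Ioi (0 : ℝ), ρ ^ (n - 1) * f (ρ • ω) = c) :
    ∫ x, f x = (volume : Measure (E n)).toSphere.real univ * c := by
  rw [integral_polar hf, ← smul_eq_mul, ← integral_const]
  exact integral_congr_ae (ae_of_all _ fun ω => H ω.1 (by simp))

theorem toSphere_real_univ_pos [Nontrivial (E n)] :
    0 < (volume : Measure (E n)).toSphere.real univ := by
  rw [measureReal_def]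
  exact ENNReal.toReal_pos (Measure.measure_univ_ne_zero.2 (Measure.toSphere_ne_zero _))
    (measure_ne_top _ _)

/-! ### The flux and the equations for `u` and `v_r` -/

/-- `ρ^{n-1}` times the norm of the flux of the function with profile `profile r`. -/
def fluxProfile (n : ℕ) (P W : ℝ → ℝ) (r ρ : ℝ) : ℝ :=
  ρ ^ (n - 1) * (W ρ * slope n P W (max ρ r) ^ (P ρ - 1))

/-- The profile of `cappedData` inside the ball. -/
def dataProfile (n : ℕ) (P W : ℝ → ℝ) (b ρ : ℝ) : ℝ :=
  b ^ (P ρ - 1) * (W ρ * (((n : ℝ) - 1) / ρ + deriv P ρ * Real.log b) + deriv W ρ)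

namespace Admissible

/-- This normalization is what the exponent `-1/(p-1)` in the definition of `u` achieves. -/
theorem fluxProfile_of_le (h : Admissible n P W) {r ρ : ℝ} (hρ : ρ ∈ Ioo (0 : ℝ) 1)
    (hr : r ≤ ρ) : fluxProfile n P W r ρ = 1 := by
  rw [fluxProfile, max_eq_left hr, h.slope_rpow hρ]
  have h1 := h.weight_pos ⟨hρ.1.le, hρ.2⟩
  have h2 : 0 < ρ ^ (n - 1) := pow_pos hρ.1 _
  field_simp

theorem fluxProfile_pos (h : Admissible n P W) {r ρ : ℝ} (hr : r ∈ Ico (0 : ℝ) 1)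
    (hρ : ρ ∈ Ioo (0 : ℝ) 1) : 0 < fluxProfile n P W r ρ := by
  have h1 := h.weight_pos ⟨hρ.1.le, hρ.2⟩
  have h2 : 0 < ρ ^ (n - 1) := pow_pos hρ.1 _
  have h3 := Real.rpow_pos_of_pos (h.slope_pos (max_mem hρ hr)) (P ρ - 1)
  unfold fluxProfile
  positivity

theorem rpow_exp_le (h : Admissible n P W) (b : ℝ) (hb : 0 < b) :
    ∃ C, 0 ≤ C ∧ ∀ ρ ∈ Ico (0 : ℝ) 1, b ^ (P ρ - 1) ≤ C := by
  obtain ⟨p₁, p₂, hp₁, hp⟩ := h.exp_bounds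
  refine ⟨(max b 1) ^ (p₂ - 1), by positivity, fun ρ hρ => ?_⟩
  have := hp ρ hρ
  calc b ^ (P ρ - 1) ≤ (max b 1) ^ (P ρ - 1) :=
        Real.rpow_le_rpow hb.le (le_max_left _ _) (by linarith)
    _ ≤ _ := Real.rpow_le_rpow_of_exponent_le (le_max_right _ _) (by linarith)

theorem fluxProfile_le (h : Admissible n P W) {r : ℝ} (hr : r ∈ Ioo (0 : ℝ) 1) :
    ∃ C, 1 ≤ C ∧ ∀ ρ ∈ Ioo (0 : ℝ) 1, fluxProfile n P W r ρ ≤ C ∧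
      (ρ < r → fluxProfile n P W r ρ ≤ C * ρ ^ (n - 1)) := by
  obtain ⟨C₁, hC₁, hb⟩ := h.rpow_exp_le _ (h.slope_pos hr)
  obtain ⟨C, hC⟩ := h.weight_bounds
  have hC0 : 1 ≤ C := (hC 0 (by simp)).1.trans (hC 0 (by simp)).2
  have hin : ∀ ρ ∈ Ioo (0 : ℝ) 1, ρ < r →
      fluxProfile n P W r ρ ≤ (C * C₁ + 1) * ρ ^ (n - 1) := by
    intro ρ hρ hlt
    have h1 := hC ρ ⟨hρ.1.le, hρ.2⟩
    have h2 := hb ρ ⟨hρ.1.le, hρ.2⟩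
    have h3 := h.weight_pos ⟨hρ.1.le, hρ.2⟩
    rw [fluxProfile, max_eq_right hlt.le, mul_comm]
    refine mul_le_mul_of_nonneg_right ?_ (pow_nonneg hρ.1.le _)
    have : W ρ * slope n P W r ^ (P ρ - 1) ≤ C * C₁ :=
      mul_le_mul h1.2 h2 (Real.rpow_nonneg (h.slope_pos hr).le _) (by linarith)
    linarith
  have h0 : 0 ≤ C * C₁ := by positivity
  refine ⟨C * C₁ + 1, by linarith, fun ρ hρ => ⟨?_, hin ρ hρ⟩⟩
  rcases lt_or_ge ρ r with hlt | hge
  · refine (hin ρ hρ hlt).trans ?_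
    have := pow_le_one₀ (n := n - 1) hρ.1.le hρ.2.le
    exact mul_le_of_le_one_right (by linarith) this
  · rw [h.fluxProfile_of_le hρ hge]
    linarith

theorem continuousOn_fluxProfile (h : Admissible n P W) {r : ℝ} (hr : r ∈ Ico (0 : ℝ) 1) :
    ContinuousOn (fluxProfile n P W r) (Ioo 0 1) := by
  refine ContinuousOn.mul (by fun_prop) (h.contDiffOn_weight.continuousOn.mul ?_)
  refine (h.continuousOn_slope_max hr).rpow (h.contDiffOn_exp.continuousOn.sub continuousOn_const)
    fun ρ hρ => Or.inl (h.slope_pos (max_mem hρ hr)).ne'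

/-- Combined with `fluxProfile_of_le`, this gives the Newtonian field `-x|x|^{-n}` outside `B(0,r)`.
The field `G` is prescribed only off the origin, because there `gradient` takes a default value. -/
theorem flux_eq (h : Admissible n P W) {r : ℝ} (hr : r ∈ Ico (0 : ℝ) 1) {G : E n → E n} {x : E n}
    (hx : x ∈ unitBall n) (h0 : x ≠ 0) (hG : G x = radialField n P W r x) :
    flux (radial n W) (radial n P) G x =
      (-(fluxProfile n P W r ‖x‖ * (‖x‖ ^ (n - 1))⁻¹ * ‖x‖⁻¹)) • x := by
  have hx' := norm_mem_Ioo hx h0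
  have hs := h.slope_pos (max_mem hx' hr)
  rw [flux, hG, h.norm_radialField hr hx h0, radialField, smul_smul, radial, radial, fluxProfile]
  congr 1
  have h1 : slope n P W (max ‖x‖ r) ^ (P ‖x‖ - 1) =
      slope n P W (max ‖x‖ r) ^ (P ‖x‖ - 2) * slope n P W (max ‖x‖ r) := by
    rw [← Real.rpow_add_one hs.ne']
    congr 1
    ring
  have h2 : 0 < ‖x‖ ^ (n - 1) := pow_pos hx'.1 _
  rw [h1]
  field_simp

theorem norm_flux_le (h : Admissible n P W) {r : ℝ} (hr : r ∈ Ico (0 : ℝ) 1) :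
    ∃ C, ∀ (G : E n → E n) (x : E n), x ∈ unitBall n → x ≠ 0 → G x = radialField n P W r x →
      ‖flux (radial n W) (radial n P) G x‖ ≤ C * ‖x‖ ^ (-((n : ℝ) - 1)) := by
  have hb : ∃ C, ∀ ρ ∈ Ioo (0 : ℝ) 1, fluxProfile n P W r ρ ≤ C := by
    rcases hr.1.eq_or_lt with rfl | h0
    · exact ⟨1, fun ρ hρ => (h.fluxProfile_of_le hρ hρ.1.le).le⟩
    · obtain ⟨C, -, hC⟩ := h.fluxProfile_le ⟨h0, hr.2⟩
      exact ⟨C, fun ρ hρ => (hC ρ hρ).1⟩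
  obtain ⟨C, hC⟩ := hb
  refine ⟨C, fun G x hx h0 hG => ?_⟩
  have hx' := norm_mem_Ioo hx h0
  have h2 : 0 < ‖x‖ ^ (n - 1) := pow_pos hx'.1 _
  have h3 := h.fluxProfile_pos hr hx'
  have h4 := hC _ hx'
  rw [h.flux_eq hr hx h0 hG, norm_smul, norm_neg, Real.norm_of_nonneg (by positivity),
    inv_mul_cancel_right₀ hx'.1.ne', Real.rpow_neg hx'.1.le]
  have h5 : ‖x‖ ^ ((n : ℝ) - 1) = ‖x‖ ^ (n - 1) := by
    rw [← Real.rpow_natCast, Nat.cast_sub (by have := h.two_le; omega), Nat.cast_one]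
  rw [h5]
  gcongr

theorem ae_eq_of_punctured (h : Admissible n P W) {β : Type*} {f g : E n → β}
    (hfg : ∀ x ∈ unitBall n, x ≠ 0 → f x = g x) : f =ᵐ[volume.restrict (unitBall n)] g := by
  have := h.nontrivial
  rw [← Measure.restrict_congr_set (ball_ae_eq_punctured (unitBall n))]
  exact (ae_restrict_iff' isOpen_punctured.measurableSet).2 (ae_of_all _ fun x hx =>
    hfg x hx.1 hx.2)

theorem ae_punctured (h : Admissible n P W) {p : E n → Prop}
    (hp : ∀ x ∈ unitBall n, x ≠ 0 → p x) : ∀ᵐ x ∂(volume.restrict (unitBall n)), p x := by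
  have := h.nontrivial
  rw [← Measure.restrict_congr_set (ball_ae_eq_punctured (unitBall n))]
  exact (ae_restrict_iff' isOpen_punctured.measurableSet).2 (ae_of_all _ fun x hx =>
    hp x hx.1 hx.2)

theorem integrableOn_flux (h : Admissible n P W) {r : ℝ} (hr : r ∈ Ico (0 : ℝ) 1) {G : E n → E n}
    (hG : ∀ x ∈ unitBall n, x ≠ 0 → G x = radialField n P W r x) :
    IntegrableOn (flux (radial n W) (radial n P) G) (unitBall n) := by
  have := h.nontrivial
  obtain ⟨C, hC⟩ := h.norm_flux_le hr
  have hint : IntegrableOn (fun x : E n => C * ‖x‖ ^ (-((n : ℝ) - 1))) (unitBall n) :=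
    (integrableOn_norm_rpow (by linarith)).const_mul C
  refine Integrable.mono' hint ?_ (h.ae_punctured fun x hx h0 => hC G x hx h0 (hG x hx h0))
  refine AEStronglyMeasurable.congr ?_
    (h.ae_eq_of_punctured fun x hx h0 => (h.flux_eq hr hx h0 (hG x hx h0)).symm)
  rw [← Measure.restrict_congr_set (ball_ae_eq_punctured (unitBall n))]
  refine ContinuousOn.aestronglyMeasurable ?_ isOpen_punctured.measurableSet
  have h1 : ContinuousOn (fun x : E n => fluxProfile n P W r ‖x‖) (unitBall n \ {0}) :=
    (h.continuousOn_fluxProfile hr).comp continuous_norm.continuousOn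
      fun x hx => norm_mem_Ioo hx.1 hx.2
  have h2 : ContinuousOn (fun x : E n => ‖x‖⁻¹) (unitBall n \ {0}) :=
    continuous_norm.continuousOn.inv₀ fun x hx => by simpa using hx.2
  have h3 : ContinuousOn (fun x : E n => (‖x‖ ^ (n - 1))⁻¹) (unitBall n \ {0}) :=
    (continuous_norm.pow _).continuousOn.inv₀ fun x hx => pow_ne_zero _ (by simpa using hx.2)
  exact ((h1.mul h3).mul h2).neg.smul continuousOn_id

end Admissible

theorem IsTest.differentiable {U : Set (E n)} {φ : E n → ℝ} (hφ : IsTest U φ) :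
    Differentiable ℝ φ := hφ.1.differentiable (by simp)

theorem gradient_eq_toDual (φ : E n → ℝ) :
    gradient φ = fun x => (InnerProductSpace.toDual ℝ (E n)).symm (fderiv ℝ φ x) := rfl

theorem inner_gradient (φ : E n → ℝ) (x v : E n) :
    inner ℝ v (gradient φ x) = fderiv ℝ φ x v := by
  rw [real_inner_comm, gradient_eq_toDual, InnerProductSpace.toDual_symm_apply]

theorem IsTest.continuous_gradient {U : Set (E n)} {φ : E n → ℝ} (hφ : IsTest U φ) :
    Continuous (gradient φ) := by
  rw [gradient_eq_toDual]
  exact (LinearIsometryEquiv.continuous _).comp (hφ.1.continuous_fderiv (by simp))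

theorem gradient_eq_zero_of_notMem {φ : E n → ℝ} {x : E n} (hx : x ∉ tsupport φ) :
    gradient φ x = 0 := by
  have : fderiv ℝ φ x = 0 := by
    by_contra hne
    exact hx (support_fderiv_subset ℝ hne)
  rw [gradient, this, map_zero]

theorem IsTest.hasCompactSupport_gradient {U : Set (E n)} {φ : E n → ℝ} (hφ : IsTest U φ) :
    HasCompactSupport (gradient φ) :=
  HasCompactSupport.intro' hφ.2.1 (isClosed_tsupport φ) fun _ hx => gradient_eq_zero_of_notMem hx

theorem IsTest.exists_bound_gradient {U : Set (E n)} {φ : E n → ℝ} (hφ : IsTest U φ) :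
    ∃ C, ∀ x, ‖gradient φ x‖ ≤ C :=
  hφ.hasCompactSupport_gradient.exists_bound_of_continuous hφ.continuous_gradient

theorem IsTest.exists_bound {U : Set (E n)} {φ : E n → ℝ} (hφ : IsTest U φ) :
    ∃ C, ∀ x, ‖φ x‖ ≤ C :=
  hφ.2.1.exists_bound_of_continuous hφ.1.continuous

theorem IsTest.eq_zero_of_notMem {U : Set (E n)} {φ : E n → ℝ} (hφ : IsTest U φ) {x : E n}
    (hx : x ∉ U) : φ x = 0 :=
  image_eq_zero_of_notMem_tsupport fun hx' => hx (hφ.2.2 hx')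

theorem IsTest.hasDerivAt_ray {U : Set (E n)} {φ : E n → ℝ} (hφ : IsTest U φ) (ω : E n) (ρ : ℝ) :
    HasDerivAt (fun t : ℝ => φ (t • ω)) (fderiv ℝ φ (ρ • ω) ω) ρ := by
  have h1 : HasDerivAt (fun t : ℝ => t • ω) ω ρ := by
    simpa using (hasDerivAt_id ρ).smul_const ω
  exact (hφ.differentiable _).hasFDerivAt.comp_hasDerivAt ρ h1

theorem IsTest.continuous_ray_deriv {U : Set (E n)} {φ : E n → ℝ} (hφ : IsTest U φ) (ω : E n) :
    Continuous (fun ρ : ℝ => fderiv ℝ φ (ρ • ω) ω) := by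
  have h1 : Continuous (fun ρ : ℝ => fderiv ℝ φ (ρ • ω)) :=
    (hφ.1.continuous_fderiv (by simp)).comp (by fun_prop)
  exact h1.clm_apply continuous_const

theorem integrableOn_inner_gradient {U : Set (E n)} {φ : E n → ℝ} (hφ : IsTest U φ)
    {F : E n → E n} (hF : IntegrableOn F U) :
    IntegrableOn (fun x => inner ℝ (F x) (gradient φ x)) U := by
  obtain ⟨C, hC⟩ := hφ.exists_bound_gradient
  refine Integrable.mono' (hF.norm.mul_const C) ?_ (ae_of_all _ fun x => ?_)
  · exact hF.aestronglyMeasurable.inner hφ.continuous_gradient.aestronglyMeasurable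
  · exact (norm_inner_le_norm _ _).trans (by gcongr; exact hC x)

theorem integral_Ioi_eq_Ioo {f : ℝ → ℝ} (hf : ∀ ρ, 1 ≤ ρ → f ρ = 0) :
    ∫ ρ in Ioi (0 : ℝ), f ρ = ∫ ρ in Ioo (0 : ℝ) 1, f ρ := by
  refine (setIntegral_eq_of_subset_of_forall_sdiff_eq_zero measurableSet_Ioi
    Ioo_subset_Ioi_self fun ρ hρ => hf ρ ?_)
  by_contra hlt
  exact hρ.2 ⟨hρ.1, not_le.1 hlt⟩

theorem norm_ray {ω : E n} (hω : ‖ω‖ = 1) {ρ : ℝ} (hρ : 0 ≤ ρ) : ‖ρ • ω‖ = ρ := by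
  rw [norm_smul, hω, mul_one, Real.norm_of_nonneg hρ]

theorem ray_notMem {ω : E n} (hω : ‖ω‖ = 1) {ρ : ℝ} (hρ : 1 ≤ ρ) : ρ • ω ∉ unitBall n := by
  simp [norm_ray hω (zero_le_one.trans hρ), hρ]

theorem ray_mem {ω : E n} (hω : ‖ω‖ = 1) {ρ : ℝ} (hρ : ρ ∈ Ioo (0 : ℝ) 1) :
    ρ • ω ∈ unitBall n ∧ ρ • ω ≠ 0 := by
  refine ⟨by simp [norm_ray hω hρ.1.le, hρ.2], ?_⟩
  rw [← norm_ne_zero_iff, norm_ray hω hρ.1.le]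
  exact hρ.1.ne'

namespace Admissible

/-- The polar Jacobian `ρ^{n-1}` cancels the decay of the flux, and only the radial derivative of
`φ` survives. -/
theorem integral_flux_ray (h : Admissible n P W) {r : ℝ} (hr : r ∈ Ico (0 : ℝ) 1) {G : E n → E n}
    (hG : ∀ x ∈ unitBall n, x ≠ 0 → G x = radialField n P W r x) (φ : E n → ℝ)
    {ω : E n} (hω : ‖ω‖ = 1) :
    ∫ ρ in Ioi (0 : ℝ), ρ ^ (n - 1) * (unitBall n).indicator
      (fun x => inner ℝ (flux (radial n W) (radial n P) G x) (gradient φ x)) (ρ • ω) =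
      -∫ ρ in Ioo (0 : ℝ) 1, fluxProfile n P W r ρ * fderiv ℝ φ (ρ • ω) ω := by
  rw [integral_Ioi_eq_Ioo fun ρ hρ => by rw [indicator_of_notMem (ray_notMem hω hρ), mul_zero],
    ← integral_neg]
  refine setIntegral_congr_fun measurableSet_Ioo fun ρ hρ => ?_
  beta_reduce
  have hm := ray_mem hω hρ
  rw [indicator_of_mem hm.1, h.flux_eq hr hm.1 hm.2 (hG _ hm.1 hm.2), inner_gradient,
    norm_ray hω hρ.1.le, map_smul, map_smul, smul_eq_mul, smul_eq_mul]
  have h1 : 0 < ρ ^ (n - 1) := pow_pos hρ.1 _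
  have h2 := hρ.1
  field_simp

/-- On every ray the flux profile is `1`, so the ray integral is `-(φ(ω) - φ(0)) = φ(0)`,
independently of the direction. -/
theorem satisfiesEq_dirac (h : Admissible n P W) {G : E n → E n}
    (hG : ∀ x ∈ unitBall n, x ≠ 0 → G x = radialField n P W 0 x) :
    SatisfiesEq (radial n W) (radial n P) (unitBall n) G (fun φ => ∫ x, φ x ∂(ENNReal.ofReal
      ((volume : Measure (E n)).toSphere.real univ) • Measure.dirac 0)) := by
  have := h.nontrivial
  have hfl := h.integrableOn_flux (r := 0) (by simp) hG
  refine ⟨hfl.locallyIntegrableOn, fun φ hφ => ?_⟩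
  beta_reduce
  rw [integral_smul_measure, integral_dirac, ENNReal.toReal_ofReal measureReal_nonneg,
    ← integral_indicator measurableSet_ball, smul_eq_mul]
  refine integral_of_rays_const ?_ fun ω hω => ?_
  · rw [integrable_indicator_iff measurableSet_ball]
    exact integrableOn_inner_gradient hφ hfl
  · rw [h.integral_flux_ray (by simp) hG φ hω]
    have h1 : ∫ ρ in Ioo (0 : ℝ) 1, fluxProfile n P W 0 ρ * fderiv ℝ φ (ρ • ω) ω =
        ∫ ρ in (0 : ℝ)..1, fderiv ℝ φ (ρ • ω) ω := by
      rw [intervalIntegral.integral_of_le zero_le_one, integral_Ioc_eq_integral_Ioo]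
      refine setIntegral_congr_fun measurableSet_Ioo fun ρ hρ => ?_
      beta_reduce
      rw [h.fluxProfile_of_le hρ hρ.1.le, one_mul]
    rw [h1, intervalIntegral.integral_eq_sub_of_hasDerivAt (fun ρ _ => hφ.hasDerivAt_ray ω ρ)
      ((hφ.continuous_ray_deriv ω).intervalIntegrable _ _), hφ.eq_zero_of_notMem
      (ray_notMem hω le_rfl), zero_smul]
    ring

/-- The source of the formula for `f_r`: the derivative of the radial flux once the slope is frozen
at `b`. -/
theorem hasDerivAt_fluxProfile (h : Admissible n P W) {b ρ : ℝ} (hb : 0 < b)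
    (hρ : ρ ∈ Ioo (0 : ℝ) 1) :
    HasDerivAt (fun s => s ^ (n - 1) * (W s * b ^ (P s - 1)))
      (ρ ^ (n - 1) * dataProfile n P W b ρ) ρ := by
  have hP : HasDerivAt P (deriv P ρ) ρ :=
    ((h.contDiffOn_exp.differentiableOn one_ne_zero).differentiableAt
      (isOpen_Ioo.mem_nhds hρ)).hasDerivAt
  have hW : HasDerivAt W (deriv W ρ) ρ :=
    ((h.contDiffOn_weight.differentiableOn one_ne_zero).differentiableAt
      (isOpen_Ioo.mem_nhds hρ)).hasDerivAt
  have h1 := (hasDerivAt_pow (n - 1) ρ).mul (hW.mul ((hP.sub_const 1).const_rpow hb))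
  refine h1.congr_deriv ?_
  have h2 := hρ.1
  have h3 : ((n - 1 : ℕ) : ℝ) = n - 1 := by
    rw [Nat.cast_sub (by have := h.two_le; omega), Nat.cast_one]
  -- The subtraction is truncated; `2 ≤ n` is needed for the exponents to match.
  have h4 : ρ ^ (n - 1) = ρ ^ (n - 1 - 1) * ρ := by
    rw [← pow_succ]
    congr 1
    have := h.two_le
    omega
  simp only [Pi.mul_apply]
  rw [h4, h3, dataProfile]
  field_simp
  ring

/-- The derivatives of `P` and `W` are bounded away from radius `1`, so `(n-1)/ρ` is the only
singular term. It is integrable on the ball because `1 < n`. -/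
theorem abs_dataProfile_le (h : Admissible n P W) {r b : ℝ} (hr : r < 1) (hb : 0 < b) :
    ∃ C, ∀ ρ ∈ Ioo (0 : ℝ) r, |dataProfile n P W b ρ| ≤ C * ρ⁻¹ := by
  obtain ⟨C₁, hC₁, h₁⟩ := h.rpow_exp_le b hb
  obtain ⟨C₂, h₂⟩ := h.weight_bounds
  obtain ⟨C₃, h₃⟩ := h.deriv_bounds r hr
  have hn : (2 : ℝ) ≤ n := by exact_mod_cast h.two_le
  refine ⟨C₁ * (C₂ * ((n - 1) + C₃ * |Real.log b|) + C₃), fun ρ hρ => ?_⟩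
  have hρ1 : ρ < 1 := hρ.2.trans hr
  have hρ' : ρ ∈ Ico (0 : ℝ) 1 := ⟨hρ.1.le, hρ1⟩
  have hd := h₃ ρ hρ
  have hC3 : 0 ≤ C₃ := (abs_nonneg _).trans hd.1
  have hw := h₂ ρ hρ'
  have hW0 := h.weight_pos hρ'
  have hinv : 1 ≤ ρ⁻¹ := (one_le_inv₀ hρ.1).2 hρ1.le
  rw [dataProfile, abs_mul, abs_of_pos (Real.rpow_pos_of_pos hb _), mul_assoc]
  refine mul_le_mul (h₁ ρ hρ') ?_ (abs_nonneg _) hC₁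
  have e1 : |((n : ℝ) - 1) / ρ + deriv P ρ * Real.log b| ≤
      ((n - 1) + C₃ * |Real.log b|) * ρ⁻¹ := by
    refine (abs_add_le _ _).trans ?_
    rw [add_mul, abs_of_nonneg (div_nonneg (by linarith) hρ.1.le), div_eq_mul_inv, abs_mul]
    refine add_le_add le_rfl ?_
    calc |deriv P ρ| * |Real.log b| ≤ C₃ * |Real.log b| := by gcongr; exact hd.1
      _ ≤ C₃ * |Real.log b| * ρ⁻¹ := le_mul_of_one_le_right (by positivity) hinv
  refine (abs_add_le _ _).trans ?_
  rw [add_mul, abs_mul, abs_of_pos hW0, mul_assoc C₂]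
  refine add_le_add (mul_le_mul hw.2 e1 (abs_nonneg _) (by linarith)) ?_
  exact hd.2.trans (le_mul_of_one_le_right hC3 hinv)

theorem continuousOn_dataProfile (h : Admissible n P W) {b : ℝ} (hb : 0 < b) :
    ContinuousOn (dataProfile n P W b) (Ioo 0 1) := by
  have hdP := h.contDiffOn_exp.continuousOn_deriv_of_isOpen isOpen_Ioo le_rfl
  have hdW := h.contDiffOn_weight.continuousOn_deriv_of_isOpen isOpen_Ioo le_rfl
  refine ContinuousOn.mul ?_ (((h.contDiffOn_weight.continuousOn).mul (ContinuousOn.add ?_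
    (hdP.mul continuousOn_const))).add hdW)
  · exact continuousOn_const.rpow (h.contDiffOn_exp.continuousOn.sub continuousOn_const)
      fun _ _ => Or.inl hb.ne'
  · exact continuousOn_const.div continuousOn_id fun ρ hρ => hρ.1.ne'

theorem cappedData_eq (r b : ℝ) (x : E n) : cappedData n P W r b x =
    (Metric.ball (0 : E n) r).indicator (fun y => dataProfile n P W b ‖y‖) x := by
  by_cases hx : ‖x‖ < r
  · rw [cappedData, if_pos hx, indicator_of_mem (by simpa using hx)]
    rfl
  · rw [cappedData, if_neg hx, indicator_of_notMem (by simpa using hx)]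

theorem integrableOn_cappedData (h : Admissible n P W) {r b : ℝ} (hr : r < 1) (hb : 0 < b) :
    IntegrableOn (cappedData n P W r b) (unitBall n) := by
  have := h.nontrivial
  obtain ⟨C, hC⟩ := h.abs_dataProfile_le hr hb
  have hn : (2 : ℝ) ≤ n := by exact_mod_cast h.two_le
  have hsub : Metric.ball (0 : E n) r ⊆ unitBall n := Metric.ball_subset_ball hr.le
  rw [funext (cappedData_eq r b), IntegrableOn, integrable_indicator_iff measurableSet_ball,
    IntegrableOn, Measure.restrict_restrict measurableSet_ball, inter_eq_left.2 hsub]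
  have hint : IntegrableOn (fun x : E n => C * ‖x‖ ^ (-(1 : ℝ))) (Metric.ball 0 r) :=
    IntegrableOn.mono_set (Integrable.const_mul (integrableOn_norm_rpow (by linarith)) C) hsub
  rw [← Measure.restrict_congr_set (ball_ae_eq_punctured (Metric.ball (0 : E n) r))]
  have hmeas : MeasurableSet (Metric.ball (0 : E n) r \ {0}) :=
    measurableSet_ball.diff (measurableSet_singleton 0)
  refine Integrable.mono' (hint.mono_set sdiff_subset) ?_ ?_
  · refine ContinuousOn.aestronglyMeasurable ?_ hmeas
    exact (h.continuousOn_dataProfile hb).comp continuous_norm.continuousOn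
      fun x hx => norm_mem_Ioo (hsub hx.1) hx.2
  · refine (ae_restrict_iff' hmeas).2 (ae_of_all _ fun x hx => ?_)
    rw [Real.norm_eq_abs, Real.rpow_neg_one]
    exact hC _ ⟨norm_pos_iff.2 hx.2, by simpa using hx.1⟩

/-- On a ray, integrate `(Λ φ)'` over `(0,r)` and `φ'` over `(r,1)`. The boundary terms at `r`
cancel because `Λ(r) = 1`, which is the matching of slopes. The one at `0` vanishes because `Λ(0) =
0`, so no point mass remains at the origin. -/
theorem satisfiesEq_capped (h : Admissible n P W) {r : ℝ} (hr : r ∈ Ioo (0 : ℝ) 1) {G : E n → E n}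
    (hG : ∀ x ∈ unitBall n, x ≠ 0 → G x = radialField n P W r x) :
    SatisfiesEq (radial n W) (radial n P) (unitBall n) G
      (fun φ => ∫ x in unitBall n, φ x * cappedData n P W r (slope n P W r) x) := by
  have := h.nontrivial
  have hr' : r ∈ Ico (0 : ℝ) 1 := ⟨hr.1.le, hr.2⟩
  have hfl := h.integrableOn_flux hr' hG
  have hb := h.slope_pos hr
  refine ⟨hfl.locallyIntegrableOn, fun φ hφ => ?_⟩
  set b := slope n P W r with hbdef
  obtain ⟨M, hM⟩ := hφ.exists_bound
  beta_reduce
  rw [← integral_indicator measurableSet_ball, ← integral_indicator measurableSet_ball]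
  refine integral_eq_of_rays ?_ ?_ fun ω hω => ?_
  · rw [integrable_indicator_iff measurableSet_ball]
    exact integrableOn_inner_gradient hφ hfl
  · rw [integrable_indicator_iff measurableSet_ball]
    exact (h.integrableOn_cappedData hr.2 hb).bdd_mul hφ.1.continuous.aestronglyMeasurable
      (ae_of_all _ hM)
  rw [h.integral_flux_ray hr' hG φ hω]
  have hsplit : Ioo (0 : ℝ) 1 = Ioo 0 r ∪ Ico r 1 := (Ioo_union_Ico_eq_Ioo hr.1 hr.2.le).symm
  have hdisj : Disjoint (Ioo 0 r) (Ico r 1) :=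
    Set.disjoint_left.2 fun x hx hx' => not_lt.2 hx'.1 hx.2
  have hsub0 : Ioo (0 : ℝ) r ⊆ Ioo 0 1 := Ioo_subset_Ioo_right hr.2.le
  -- the profiles on `(0, r)`
  set Λ : ℝ → ℝ := fun s => s ^ (n - 1) * (W s * b ^ (P s - 1)) with hΛ
  have hΛc : ContinuousOn Λ (Icc 0 r) := by
    have hs : Icc 0 r ⊆ Ico (0 : ℝ) 1 := fun s hs => ⟨hs.1, hs.2.trans_lt hr.2⟩
    refine ContinuousOn.mul (by fun_prop) ((h.continuousOn_weight.mono hs).mul ?_)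
    exact continuousOn_const.rpow ((h.continuousOn_exp.mono hs).sub continuousOn_const)
      fun _ _ => Or.inl hb.ne'
  have hφc : Continuous fun ρ : ℝ => φ (ρ • ω) := hφ.1.continuous.comp (by fun_prop)
  have hi1 : IntegrableOn (fun ρ => Λ ρ * fderiv ℝ φ (ρ • ω) ω) (Ioo 0 r) :=
    ((hΛc.mul (hφ.continuous_ray_deriv ω).continuousOn).integrableOn_Icc).mono_set
      Ioo_subset_Icc_self
  have hi2 : IntegrableOn (fun ρ => ρ ^ (n - 1) * dataProfile n P W b ρ * φ (ρ • ω))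
      (Ioo 0 r) := by
    obtain ⟨C, hC⟩ := h.abs_dataProfile_le hr.2 hb
    refine IntegrableOn.of_bound (C := C * M) (by simp) ?_ ?_
    · refine ContinuousOn.aestronglyMeasurable ?_ measurableSet_Ioo
      exact (ContinuousOn.mul (by fun_prop) ((h.continuousOn_dataProfile hb).mono hsub0)).mul
        hφc.continuousOn
    · refine (ae_restrict_iff' measurableSet_Ioo).2 (ae_of_all _ fun ρ hρ => ?_)
      have h1 := hC ρ hρ
      have hρ0 := hρ.1
      have hC0 : 0 ≤ C := by
        have := (abs_nonneg _).trans h1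
        exact nonneg_of_mul_nonneg_left this (inv_pos.2 hρ0)
      rw [norm_mul, norm_mul, norm_pow, Real.norm_of_nonneg hρ0.le, Real.norm_eq_abs]
      refine mul_le_mul ?_ (hM _) (norm_nonneg _) hC0
      have h4 : ρ ^ (n - 1) = ρ ^ (n - 1 - 1) * ρ := by
        rw [← pow_succ]
        congr 1
        have := h.two_le
        omega
      calc ρ ^ (n - 1) * |dataProfile n P W b ρ| ≤ ρ ^ (n - 1) * (C * ρ⁻¹) := by gcongr
        _ = C * ρ ^ (n - 1 - 1) := by rw [h4]; field_simp
        _ ≤ C * 1 := by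
            gcongr
            exact pow_le_one₀ hρ0.le (hρ.2.trans hr.2).le
        _ = C := mul_one C
  have hFTC : ∫ ρ in Ioo 0 r, (ρ ^ (n - 1) * dataProfile n P W b ρ * φ (ρ • ω) +
      Λ ρ * fderiv ℝ φ (ρ • ω) ω) = φ (r • ω) := by
    rw [← integral_Ioc_eq_integral_Ioo, ← intervalIntegral.integral_of_le hr.1.le]
    rw [intervalIntegral.integral_eq_sub_of_hasDerivAt_of_le (f := fun ρ => Λ ρ * φ (ρ • ω))
      hr.1.le (hΛc.mul hφc.continuousOn)]
    · have h1 : Λ r = 1 := by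
        have := h.fluxProfile_of_le hr le_rfl
        rwa [fluxProfile, max_self] at this
      have h0 : Λ 0 = 0 := by
        simp only [hΛ]
        rw [zero_pow (by have := h.two_le; omega), zero_mul]
      rw [h1, h0]
      ring
    · intro ρ hρ
      exact (h.hasDerivAt_fluxProfile hb (hsub0 hρ)).mul (hφ.hasDerivAt_ray ω ρ)
    · rw [intervalIntegrable_iff_integrableOn_Ioo_of_le hr.1.le]
      exact hi2.add hi1
  rw [integral_add hi2 hi1] at hFTC
  have hL1 : ∫ ρ in Ioo 0 r, fluxProfile n P W r ρ * fderiv ℝ φ (ρ • ω) ω =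
      ∫ ρ in Ioo 0 r, Λ ρ * fderiv ℝ φ (ρ • ω) ω := by
    refine setIntegral_congr_fun measurableSet_Ioo fun ρ hρ => ?_
    simp only [fluxProfile, hΛ]
    rw [max_eq_right hρ.2.le]
  have hL2 : ∫ ρ in Ico r 1, fluxProfile n P W r ρ * fderiv ℝ φ (ρ • ω) ω = -φ (r • ω) := by
    have h1 : ∫ ρ in Ico r 1, fluxProfile n P W r ρ * fderiv ℝ φ (ρ • ω) ω =
        ∫ ρ in r..1, fderiv ℝ φ (ρ • ω) ω := by
      rw [intervalIntegral.integral_of_le hr.2.le, integral_Ioc_eq_integral_Ioo,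
        ← integral_Ico_eq_integral_Ioo]
      refine setIntegral_congr_fun measurableSet_Ico fun ρ hρ => ?_
      beta_reduce
      rw [h.fluxProfile_of_le ⟨hr.1.trans_le hρ.1, hρ.2⟩ hρ.1, one_mul]
    rw [h1, intervalIntegral.integral_eq_sub_of_hasDerivAt (fun ρ _ => hφ.hasDerivAt_ray ω ρ)
      ((hφ.continuous_ray_deriv ω).intervalIntegrable _ _), hφ.eq_zero_of_notMem
      (ray_notMem hω le_rfl), zero_sub]
  have hLi1 : IntegrableOn (fun ρ => fluxProfile n P W r ρ * fderiv ℝ φ (ρ • ω) ω) (Ioo 0 r) := by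
    refine hi1.congr_fun (fun ρ hρ => ?_) measurableSet_Ioo
    simp only [fluxProfile, hΛ]
    rw [max_eq_right hρ.2.le]
  have hLi2 : IntegrableOn (fun ρ => fluxProfile n P W r ρ * fderiv ℝ φ (ρ • ω) ω) (Ico r 1) := by
    refine (((hφ.continuous_ray_deriv ω).continuousOn (s := Icc r 1)).integrableOn_Icc.mono_set
      Ico_subset_Icc_self).congr_fun (fun ρ hρ => ?_) measurableSet_Ico
    beta_reduce
    rw [h.fluxProfile_of_le ⟨hr.1.trans_le hρ.1, hρ.2⟩ hρ.1, one_mul]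
  rw [hsplit, setIntegral_union hdisj measurableSet_Ico hLi1 hLi2, hL1, hL2]
  have hR : ∫ ρ in Ioi (0 : ℝ), ρ ^ (n - 1) * (unitBall n).indicator
      (fun x => φ x * cappedData n P W r b x) (ρ • ω) =
      ∫ ρ in Ioo 0 r, ρ ^ (n - 1) * dataProfile n P W b ρ * φ (ρ • ω) := by
    rw [setIntegral_eq_of_subset_of_forall_sdiff_eq_zero measurableSet_Ioi
      (fun ρ hρ => hρ.1 : Ioo (0 : ℝ) r ⊆ Ioi 0)]
    · refine setIntegral_congr_fun measurableSet_Ioo fun ρ hρ => ?_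
      beta_reduce
      rw [indicator_of_mem (ray_mem hω (hsub0 hρ)).1, cappedData, norm_ray hω hρ.1.le,
        if_pos hρ.2, dataProfile]
      ring
    · intro ρ hρ
      have hge : r ≤ ρ := by
        by_contra hlt
        exact hρ.2 ⟨hρ.1, not_le.1 hlt⟩
      have h0 : (unitBall n).indicator (fun x => φ x * cappedData n P W r b x) (ρ • ω) = 0 := by
        refine indicator_apply_eq_zero.2 fun _ => ?_
        rw [cappedData, norm_ray hω (le_of_lt hρ.1), if_neg (not_lt.2 hge), mul_zero]
      rw [h0, mul_zero]
  rw [hR]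
  linarith

end Admissible

/-! ### Small radii: positivity, monotonicity and mass of the data -/

namespace Admissible

theorem abs_log_slope_le (h : Admissible n P W) : ∃ c, ∀ r ∈ Ioo (0 : ℝ) 1,
    |Real.log (slope n P W r)| ≤ c + growth n P * |Real.log r| := by
  obtain ⟨c, hc, hb⟩ := h.slope_bounds
  refine ⟨Real.log c, fun r hr => ?_⟩
  have hc0 : 0 < c := by linarith
  have ht : 0 < r ^ (-growth n P) := Real.rpow_pos_of_pos hr.1 _
  have h1 := Real.log_le_log (by positivity) (hb r hr).1
  have h2 := Real.log_le_log (h.slope_pos hr) (hb r hr).2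
  rw [Real.log_mul (by positivity) ht.ne', Real.log_inv, Real.log_rpow hr.1] at h1
  rw [Real.log_mul (by positivity) ht.ne', Real.log_rpow hr.1] at h2
  have h3 : Real.log r ≤ 0 := Real.log_nonpos hr.1.le hr.2.le
  have h4 : 0 ≤ growth n P * -Real.log r := mul_nonneg h.growth_pos.le (by linarith)
  rw [abs_of_nonpos h3, abs_le]
  constructor <;> nlinarith [Real.log_nonneg hc]

/-- Radii for which the data of the modifications are positive. -/
def IsSmallRadius (n : ℕ) (P W : ℝ → ℝ) (r₀ : ℝ) : Prop :=
  r₀ ∈ Ioo (0 : ℝ) 1 ∧ ∀ r ∈ Ioo (0 : ℝ) r₀, ∀ ρ ∈ Ioo (0 : ℝ) r,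
    0 < dataProfile n P W (slope n P W r) ρ

/-- For `ρ < r` the good term is at least `1/r`, while the bad terms are bounded by a multiple of `1
+ |log r|` because `log b_r` grows logarithmically. -/
theorem exists_isSmallRadius (h : Admissible n P W) : ∃ r₀, IsSmallRadius n P W r₀ := by
  obtain ⟨c, hc⟩ := h.abs_log_slope_le
  obtain ⟨C, hC⟩ := h.deriv_bounds (1 / 2) (by norm_num)
  obtain ⟨D, hD⟩ := h.weight_bounds
  have hn : (2 : ℝ) ≤ n := by exact_mod_cast h.two_le
  have hC0 : 0 ≤ C := (abs_nonneg _).trans (hC (1 / 4) (by norm_num)).1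
  -- This is `r` times the bound for the bad terms; once it is below `1`, they are dominated by
  -- `1/r`.
  have hlim : Tendsto (fun r : ℝ => C * (c * r + growth n P * |Real.log r * r|) + C * r)
      (𝓝[>] 0) (𝓝 0) := by
    have h1 : Tendsto (fun r : ℝ => |Real.log r * r|) (𝓝[>] 0) (𝓝 0) := by
      have := (tendsto_log_mul_rpow_nhdsGT_zero one_pos).abs
      simpa using this
    have h2 : Tendsto (fun r : ℝ => r) (𝓝[>] 0) (𝓝 0) := tendsto_id.mono_left nhdsWithin_le_nhds
    have := (((h2.const_mul c).add (h1.const_mul (growth n P))).const_mul C).add (h2.const_mul C)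
    simpa using this
  have hev := hlim.eventually (gt_mem_nhds one_pos)
  obtain ⟨r₁, hr₁, hsub⟩ := mem_nhdsGT_iff_exists_Ioo_subset.1 hev
  refine ⟨min r₁ (1 / 2), ⟨lt_min hr₁ (by norm_num), (min_le_right _ _).trans_lt (by norm_num)⟩,
    fun r hr ρ hρ => ?_⟩
  have hr2 : r < 1 / 2 := hr.2.trans_le (min_le_right _ _)
  have hr1 : r ∈ Ioo (0 : ℝ) 1 := ⟨hr.1, by linarith⟩
  have hlt := hsub ⟨hr.1, hr.2.trans_le (min_le_left _ _)⟩
  rw [mem_ofPred_eq] at hlt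
  have hd := hC ρ ⟨hρ.1, hρ.2.trans hr2⟩
  have hw := (hD ρ ⟨hρ.1.le, by linarith [hρ.2]⟩).1
  have hlog := hc r hr1
  have hb := h.slope_pos hr1
  refine mul_pos (Real.rpow_pos_of_pos hb _) ?_
  have h1 : 1 / r ≤ ((n : ℝ) - 1) / ρ := by
    exact div_le_div₀ (by linarith) (by linarith) hρ.1 hρ.2.le
  have h2 : C * |Real.log (slope n P W r)| + C < 1 / r := by
    rw [lt_div_iff₀ hr.1]
    rw [abs_mul, abs_of_pos hr.1] at hlt
    have : C * |Real.log (slope n P W r)| ≤ C * (c + growth n P * |Real.log r|) := by gcongr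
    nlinarith [hr.1]
  have h3 : -(C * |Real.log (slope n P W r)|) ≤ deriv P ρ * Real.log (slope n P W r) := by
    refine (neg_le_neg ?_).trans (neg_abs_le _)
    rw [abs_mul]
    gcongr
    exact hd.1
  have h4 := (abs_le.1 hd.2).1
  have h5 : C < ((n : ℝ) - 1) / ρ + deriv P ρ * Real.log (slope n P W r) := by linarith
  -- Since `W ≥ 1` and `W' ≥ -C`, a bracket larger than `C` absorbs `W'`.
  nlinarith

/-- The exponent varies, so slopes are compared through fluxes. With the slope frozen at `b_r`, the
flux increases on `(0,r)` by positivity of the data and equals `1` at `r`. At `s` it is therefore at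
most `1`, which is the flux there for the slope `b_s`. -/
theorem slope_antitone (h : Admissible n P W) {r₀ : ℝ} (h₀ : IsSmallRadius n P W r₀) {s r : ℝ}
    (hs : 0 < s) (hsr : s ≤ r) (hr : r < r₀) : slope n P W r ≤ slope n P W s := by
  have hr1 : r ∈ Ioo (0 : ℝ) 1 := ⟨hs.trans_le hsr, hr.trans h₀.1.2⟩
  have hs1 : s ∈ Ioo (0 : ℝ) 1 := ⟨hs, hsr.trans_lt hr1.2⟩
  have hb := h.slope_pos hr1
  have hmono : MonotoneOn (fun t => t ^ (n - 1) * (W t * slope n P W r ^ (P t - 1)))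
      (Icc s r) := by
    have hd : ∀ t ∈ Icc s r, HasDerivAt (fun t => t ^ (n - 1) * (W t * slope n P W r ^ (P t - 1)))
        (t ^ (n - 1) * dataProfile n P W (slope n P W r) t) t := fun t ht =>
      h.hasDerivAt_fluxProfile hb ⟨hs.trans_le ht.1, ht.2.trans_lt hr1.2⟩
    refine monotoneOn_of_deriv_nonneg (convex_Icc s r)
      (fun t ht => (hd t ht).continuousAt.continuousWithinAt)
      (fun t ht => (hd t (interior_subset ht)).differentiableAt.differentiableWithinAt)
      fun t ht => ?_
    rw [(hd t (interior_subset ht)).deriv]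
    rw [interior_Icc] at ht
    have ht0 := hs.trans ht.1
    exact mul_nonneg (pow_nonneg ht0.le _) (h₀.2 r ⟨hr1.1, hr⟩ t ⟨ht0, ht.2⟩).le
  have h1 := hmono ⟨le_rfl, hsr⟩ ⟨hsr, le_rfl⟩ hsr
  have h2 := h.fluxProfile_of_le hr1 le_rfl
  have h3 := h.fluxProfile_of_le hs1 le_rfl
  rw [fluxProfile, max_self] at h2 h3
  beta_reduce at h1
  replace h1 := (h1.trans_eq h2).trans_eq h3.symm
  have h4 : 0 < s ^ (n - 1) := pow_pos hs _
  have h5 := h.weight_pos ⟨hs.le, hs1.2⟩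
  have h6 := le_of_mul_le_mul_left (le_of_mul_le_mul_left h1 h4) h5
  exact (Real.rpow_le_rpow_iff hb.le (h.slope_pos hs1).le
    (by linarith [h.exp_gt_one ⟨hs.le, hs1.2⟩])).1 h6

theorem profile_le_profile (h : Admissible n P W) {r₀ : ℝ} (h₀ : IsSmallRadius n P W r₀)
    {s r ρ : ℝ} (hs : 0 < s) (hsr : s ≤ r) (hr : r < r₀) (hρ : ρ ∈ Ico (0 : ℝ) 1) :
    profile n P W r ρ ≤ profile n P W s ρ := by
  have hr1 : r ∈ Ico (0 : ℝ) 1 := ⟨hs.le.trans hsr, hr.trans h₀.1.2⟩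
  have hs1 : s ∈ Ico (0 : ℝ) 1 := ⟨hs.le, hsr.trans_lt hr1.2⟩
  rw [profile, profile, intervalIntegral.integral_of_le hρ.2.le,
    intervalIntegral.integral_of_le hρ.2.le, integral_Ioc_eq_integral_Ioo,
    integral_Ioc_eq_integral_Ioo]
  refine setIntegral_mono_on
    (h.integrableOn_slope_max hr1 hρ.1 (lt_max_of_lt_right (hs.trans_le hsr)))
    (h.integrableOn_slope_max hs1 hρ.1 (lt_max_of_lt_right hs)) measurableSet_Ioo fun σ hσ => ?_
  rcases le_total r σ with hle | hle
  · rw [max_eq_left hle, max_eq_left (hsr.trans hle)]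
  · rw [max_eq_right hle]
    exact h.slope_antitone h₀ (lt_max_of_lt_right hs) (max_le hle hsr) hr

theorem radialField_eq_of_le {r : ℝ} {x : E n} (hr : 0 ≤ r) (hx : r ≤ ‖x‖) :
    radialField n P W r x = radialField n P W 0 x := by
  rw [radialField, radialField, max_eq_left hx, max_eq_left (hr.trans hx)]

theorem exists_isTest_eq_one {r₀ : ℝ} (hr₀ : r₀ ∈ Ioo (0 : ℝ) 1) :
    ∃ φ : E n → ℝ, IsTest (unitBall n) φ ∧ ∀ x, ‖x‖ < r₀ → φ x = 1 := by
  have h1 : r₀ < (1 + r₀) / 2 := by linarith [hr₀.2]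
  let f : ContDiffBump (0 : E n) := ⟨r₀, (1 + r₀) / 2, hr₀.1, h1⟩
  refine ⟨f, ⟨f.contDiff, f.hasCompactSupport, ?_⟩, fun x hx => ?_⟩
  · rw [f.tsupport_eq]
    exact Metric.closedBall_subset_ball (by change (1 + r₀) / 2 < 1; linarith [hr₀.2])
  · exact f.one_of_mem_closedBall (by simpa using hx.le)

/-- Test the equations of `u` and `v_r` with a function equal to `1` on `B(0,r₀)`. Its gradient
vanishes there, and outside the two fluxes coincide, so the masses of `f_r` and of the Dirac measure
agree. -/
theorem integral_abs_cappedData (h : Admissible n P W) {r₀ : ℝ} (h₀ : IsSmallRadius n P W r₀)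
    {r : ℝ} (hr : r ∈ Ioo (0 : ℝ) r₀) :
    ∫ x in unitBall n, |cappedData n P W r (slope n P W r) x| =
      (volume : Measure (E n)).toSphere.real univ := by
  have hr1 : r ∈ Ioo (0 : ℝ) 1 := ⟨hr.1, hr.2.trans h₀.1.2⟩
  obtain ⟨φ, hφ, hφ1⟩ := exists_isTest_eq_one (n := n) h₀.1
  have e1 := (h.satisfiesEq_capped hr1 (G := radialField n P W r) fun _ _ _ => rfl).2 φ hφ
  have e0 := (h.satisfiesEq_dirac (G := radialField n P W 0) fun _ _ _ => rfl).2 φ hφ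
  beta_reduce at e0 e1
  rw [integral_smul_measure, integral_dirac, ENNReal.toReal_ofReal measureReal_nonneg,
    hφ1 0 (by simpa using h₀.1.1), smul_eq_mul, mul_one] at e0
  rw [← e0]
  have e2 : ∫ x in unitBall n, |cappedData n P W r (slope n P W r) x| =
      ∫ x in unitBall n, φ x * cappedData n P W r (slope n P W r) x := by
    refine integral_congr_ae (h.ae_eq_of_punctured fun x hx hx0 => ?_)
    by_cases hlt : ‖x‖ < r
    · rw [hφ1 x (hlt.trans hr.2), one_mul, cappedData_eq, indicator_of_mem (by simpa using hlt)]
      exact abs_of_pos (h₀.2 r hr _ ⟨norm_pos_iff.2 hx0, hlt⟩)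
    · rw [cappedData, if_neg hlt, abs_zero, mul_zero]
  rw [e2, ← e1]
  refine integral_congr_ae (h.ae_eq_of_punctured fun x hx hx0 => ?_)
  by_cases hlt : ‖x‖ < r₀
  · have hg : gradient φ x = 0 := by
      have : φ =ᶠ[𝓝 x] fun _ => 1 := by
        filter_upwards [Metric.isOpen_ball.mem_nhds (show x ∈ Metric.ball (0 : E n) r₀ by
          simpa using hlt)] with y hy
        exact hφ1 y (by simpa using hy)
      rw [gradient, this.fderiv_eq]
      simp
    rw [hg, inner_zero_right, inner_zero_right]
  · have hle : r ≤ ‖x‖ := hr.2.le.trans (not_lt.1 hlt)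
    rw [flux, flux, radialField_eq_of_le hr.1.le hle]

end Admissible

/-! ### Weak norms and powers of `|x|` -/

/-- The only form in which log-Hölder continuity is used: powers `R^{q(x)}` and `R^{q(0)}` are
comparable for `|x| < R`. -/
theorem IsLogHolder.abs_sub_mul_log_le {q : E n → ℝ} (hq : IsLogHolder (unitBall n) q) :
    ∃ κ, 0 ≤ κ ∧ ∀ R ∈ Ioc (0 : ℝ) 1, ∀ x : E n, ‖x‖ < R → |(q x - q 0) * Real.log R| ≤ κ := by
  obtain ⟨⟨c, hc⟩, -⟩ := hq
  -- At `x = y = 0` the quotient `1/0` is `0`, so the denominator is `log e = 1` and the condition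
  -- reads `0 ≤ c`.
  have hc0 : 0 ≤ c := by
    have := (abs_nonneg _).trans (hc 0 (by simp) 0 (by simp))
    simpa using this
  refine ⟨c, hc0, fun R hR x hx => ?_⟩
  rcases eq_or_ne x 0 with rfl | h0
  · simpa using hc0
  have hx0 : 0 < ‖x‖ := norm_pos_iff.2 h0
  have h1 := hc x (by simpa using hx.trans_le hR.2) 0 (by simp)
  rw [sub_zero] at h1
  have h2 : |Real.log R| ≤ Real.log (Real.exp 1 + 1 / ‖x‖) := by
    rw [abs_of_nonpos (Real.log_nonpos hR.1.le hR.2), ← Real.log_inv]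
    refine Real.log_le_log (inv_pos.2 hR.1) ?_
    rw [← one_div]
    have h3 : 1 / R ≤ 1 / ‖x‖ := one_div_le_one_div_of_le hx0 hx.le
    linarith [Real.exp_pos 1]
  have h4 : 0 < Real.log (Real.exp 1 + 1 / ‖x‖) := by
    refine Real.log_pos ?_
    have := Real.add_one_le_exp 1
    have : 0 < 1 / ‖x‖ := by positivity
    linarith
  rw [abs_mul]
  calc |q x - q 0| * |Real.log R|
      ≤ c / Real.log (Real.exp 1 + 1 / ‖x‖) * Real.log (Real.exp 1 + 1 / ‖x‖) := by gcongr
    _ = c := div_mul_cancel₀ _ h4.ne'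

/-- Raised to the power `-q(x)`, the scale `R^{n/q(0)}` is comparable to the inverse volume of
`B(0,R)`. Hence it is the size of the Luxemburg norm of the indicator of that ball. -/
theorem IsLogHolder.rpow_bounds {q : E n → ℝ} (hq : IsLogHolder (unitBall n) q) (hq0 : 0 < q 0) :
    ∃ Q, 1 ≤ Q ∧ ∀ R ∈ Ioc (0 : ℝ) 1, ∀ x : E n, ‖x‖ < R →
      Q⁻¹ * (R ^ n)⁻¹ ≤ (R ^ (n / q 0)) ^ (-q x) ∧ (R ^ (n / q 0)) ^ (-q x) ≤ Q * (R ^ n)⁻¹ := by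
  obtain ⟨κ, hκ, hb⟩ := hq.abs_sub_mul_log_le
  refine ⟨Real.exp (n / q 0 * κ), Real.one_le_exp (by positivity), fun R hR x hx => ?_⟩
  have h1 := abs_le.1 (hb R hR x hx)
  have hR0 := hR.1
  have e : (R ^ (n / q 0)) ^ (-q x) = Real.exp (-(n / q 0 * ((q x - q 0) * Real.log R))) *
      (R ^ n)⁻¹ := by
    rw [← Real.rpow_mul hR0.le, ← Real.rpow_natCast, ← Real.rpow_neg hR0.le,
      Real.rpow_def_of_pos hR0, Real.rpow_def_of_pos hR0, ← Real.exp_add]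
    congr 1
    field_simp
    ring
  have h2 : 0 ≤ n / q 0 := by positivity
  rw [e, ← Real.exp_neg]
  constructor
  · gcongr
    exact h1.2
  · gcongr
    rw [← mul_neg]
    gcongr
    linarith [h1.1]

theorem luxNorm_indicator_le {q : E n → ℝ} (he : IsExponent (unitBall n) q)
    (hq : IsLogHolder (unitBall n) q) :
    ∃ C, 0 < C ∧ ∀ R ∈ Ioc (0 : ℝ) 1, ∀ S : Set (E n), S ∩ unitBall n ⊆ Metric.ball 0 R →
      luxNorm q (unitBall n) (S.indicator fun _ => (1 : ℝ)) ≤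
        ENNReal.ofReal (C * R ^ (n / q 0)) := by
  obtain ⟨hm, hpos, a, b, ha, hab⟩ := he
  have hq0 : 0 < q 0 := hpos 0 (by simp)
  obtain ⟨Q, hQ, hb⟩ := hq.rpow_bounds hq0
  set V := (volume : Measure (E n)).real (Metric.ball 0 1)
  have hV : 0 ≤ V := measureReal_nonneg
  set D : ℝ := max 1 (Q * V) with hD
  have hD1 : 1 ≤ D := le_max_left _ _
  -- Since `D ≥ 1` and `q ≥ a`, the power `-q(x)` of this constant is at most `D⁻¹`, which
  -- compensates `Q` times the volume.
  refine ⟨D ^ a⁻¹, by positivity, fun R hR S hS => ?_⟩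
  have hR0 := hR.1
  have hC1 : 1 ≤ D ^ a⁻¹ := Real.one_le_rpow hD1 (by positivity)
  have hs : 0 < D ^ a⁻¹ * R ^ (n / q 0) := by positivity
  refine iInf_le_of_le _ (iInf_le_of_le hs (iInf_le_of_le ?_ le_rfl))
  have hle : ∀ᵐ x ∂(volume.restrict (unitBall n)),
      ENNReal.ofReal (|S.indicator (fun _ => (1 : ℝ)) x / (D ^ a⁻¹ * R ^ (n / q 0))| ^ q x) ≤
      (Metric.ball (0 : E n) R).indicator (fun _ => ENNReal.ofReal (D⁻¹ * Q * (R ^ n)⁻¹)) x := by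
    filter_upwards [hab, ae_restrict_mem measurableSet_ball] with x hx hxB
    by_cases hxS : x ∈ S
    · have hxR := hS ⟨hxS, hxB⟩
      rw [indicator_of_mem hxS, indicator_of_mem hxR]
      refine ENNReal.ofReal_le_ofReal ?_
      have h1 := (hb R hR x (by simpa using hxR)).2
      rw [abs_of_pos (by positivity), one_div, Real.inv_rpow hs.le, ← Real.rpow_neg hs.le,
        Real.mul_rpow (by positivity) (by positivity), mul_assoc]
      refine mul_le_mul ?_ h1 (by positivity) (by positivity)
      rw [← Real.rpow_neg_one D, ← Real.rpow_mul (by positivity)]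
      refine Real.rpow_le_rpow_of_exponent_le hD1 ?_
      have : a⁻¹ * a ≤ a⁻¹ * q x := by gcongr; exact hx.1
      rw [inv_mul_cancel₀ ha.ne'] at this
      linarith
    · rw [indicator_of_notMem hxS, zero_div, abs_zero,
        Real.zero_rpow (hpos x hxB).ne', ENNReal.ofReal_zero]
      exact zero_le
  refine (lintegral_mono_ae hle).trans ?_
  rw [lintegral_indicator measurableSet_ball, lintegral_const,
    Measure.restrict_restrict measurableSet_ball, Measure.restrict_apply_univ]
  have hvol : (volume : Measure (E n)) (Metric.ball 0 R ∩ unitBall n) ≤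
      ENNReal.ofReal (R ^ n * V) := by
    refine (measure_mono inter_subset_left).trans ?_
    rw [Measure.addHaar_ball_of_pos _ _ hR0, finrank_euclideanSpace_fin,
      ENNReal.ofReal_mul (by positivity), ofReal_measureReal]
  refine (mul_le_mul_right hvol _).trans ?_
  rw [← ENNReal.ofReal_mul (by positivity)]
  refine ENNReal.ofReal_le_one.2 ?_
  have : D⁻¹ * Q * (R ^ n)⁻¹ * (R ^ n * V) = D⁻¹ * (Q * V) := by field_simp
  rw [this]
  calc D⁻¹ * (Q * V) ≤ D⁻¹ * D := by gcongr; exact le_max_right _ _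
    _ = 1 := inv_mul_cancel₀ (by positivity)

/-- Only the punctured ball is required to lie in `S`, since the functions to be tested are known
off the origin only. -/
theorem le_luxNorm_indicator [Nontrivial (E n)] {q : E n → ℝ} (he : IsExponent (unitBall n) q)
    (hq : IsLogHolder (unitBall n) q) :
    ∃ C, 0 < C ∧ ∀ R ∈ Ioc (0 : ℝ) 1, ∀ S : Set (E n), (∀ x : E n, x ≠ 0 → ‖x‖ < R → x ∈ S) →
      ENNReal.ofReal (C * R ^ (n / q 0)) ≤
        luxNorm q (unitBall n) (S.indicator fun _ => (1 : ℝ)) := by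
  obtain ⟨hm, hpos, a, b, ha, hab⟩ := he
  have hq0 : 0 < q 0 := hpos 0 (by simp)
  obtain ⟨Q, hQ, hb⟩ := hq.rpow_bounds hq0
  set V := (volume : Measure (E n)).real (Metric.ball 0 1) with hVdef
  have hV : 0 < V := by
    rw [hVdef, measureReal_def]
    exact ENNReal.toReal_pos (Metric.measure_ball_pos _ _ one_pos).ne' measure_ball_lt_top.ne
  -- Now `D ≤ 1`, so the power `-q(x)` of `D ^ a⁻¹` is at least `D⁻¹`. The factor `1/2` makes the
  -- modular strictly larger than `1`, hence the contradiction.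
  set D : ℝ := min 1 (Q⁻¹ * V / 2) with hD
  have hD0 : 0 < D := lt_min one_pos (by positivity)
  have hD1 : D ≤ 1 := min_le_left _ _
  refine ⟨D ^ a⁻¹, by positivity, fun R hR S hS => ?_⟩
  have hR0 := hR.1
  have hs : 0 < D ^ a⁻¹ * R ^ (n / q 0) := by positivity
  refine le_iInf fun t => le_iInf fun ht => le_iInf fun hmod => ENNReal.ofReal_le_ofReal ?_
  by_contra hlt
  rw [not_le] at hlt
  have hsub : Metric.ball (0 : E n) R ⊆ unitBall n := Metric.ball_subset_ball hR.2
  have hle : ∀ᵐ x ∂(volume.restrict (unitBall n)),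
      (Metric.ball (0 : E n) R).indicator (fun _ => ENNReal.ofReal (D⁻¹ * Q⁻¹ * (R ^ n)⁻¹)) x ≤
      ENNReal.ofReal (|S.indicator (fun _ => (1 : ℝ)) x / t| ^ q x) := by
    have hne : ∀ᵐ x ∂(volume.restrict (unitBall n)), x ≠ 0 :=
      ae_restrict_of_ae (Measure.ae_ne volume 0)
    filter_upwards [hab, hne] with x hx hx0
    by_cases hxR : x ∈ Metric.ball (0 : E n) R
    · have hxR' : ‖x‖ < R := by simpa using hxR
      rw [indicator_of_mem hxR, indicator_of_mem (hS x hx0 hxR')]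
      refine ENNReal.ofReal_le_ofReal ?_
      have h1 := (hb R hR x hxR').1
      have hqx : 0 < q x := ha.trans_le hx.1
      rw [abs_of_pos (by positivity), one_div]
      calc D⁻¹ * Q⁻¹ * (R ^ n)⁻¹ = D⁻¹ * (Q⁻¹ * (R ^ n)⁻¹) := by ring
        _ ≤ (D ^ a⁻¹) ^ (-q x) * (R ^ (n / q 0)) ^ (-q x) := by
            refine mul_le_mul ?_ h1 (by positivity) (by positivity)
            rw [← Real.rpow_neg_one D, ← Real.rpow_mul hD0.le]
            refine Real.rpow_le_rpow_of_exponent_ge hD0 hD1 ?_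
            have : a⁻¹ * a ≤ a⁻¹ * q x := by gcongr; exact hx.1
            rw [inv_mul_cancel₀ ha.ne'] at this
            linarith
        _ = (D ^ a⁻¹ * R ^ (n / q 0)) ^ (-q x) :=
            (Real.mul_rpow (by positivity) (by positivity)).symm
        _ = ((D ^ a⁻¹ * R ^ (n / q 0))⁻¹) ^ q x := by
            rw [Real.inv_rpow hs.le, Real.rpow_neg hs.le]
        _ ≤ (t⁻¹) ^ q x := by gcongr
    · rw [indicator_of_notMem hxR]
      exact zero_le
  have h2 := (lintegral_mono_ae hle).trans hmod
  rw [lintegral_indicator measurableSet_ball, lintegral_const,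
    Measure.restrict_restrict measurableSet_ball, Measure.restrict_apply_univ,
    inter_eq_left.2 hsub, Measure.addHaar_ball_of_pos _ _ hR0, finrank_euclideanSpace_fin,
    ← ofReal_measureReal (μ := (volume : Measure (E n))) (s := Metric.ball 0 1),
    ← ENNReal.ofReal_mul (by positivity), ← ENNReal.ofReal_mul (by positivity),
    ENNReal.ofReal_le_one] at h2
  have h3 : D⁻¹ * Q⁻¹ * (R ^ n)⁻¹ * (R ^ n * V) = D⁻¹ * (Q⁻¹ * V) := by field_simp
  rw [h3] at h2
  have h4 : D ≤ Q⁻¹ * V / 2 := min_le_right _ _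
  have h5 : Q⁻¹ * V ≤ D := by
    rwa [inv_mul_le_iff₀ hD0, mul_one] at h2
  have : 0 < Q⁻¹ * V := by positivity
  linarith

/-- The set where `|f| > t` lies in the ball of radius `(M/t)^{1/α}`, and `t R^{n/q(0)} ≤ M` because
`α ≤ n/q(0)`. The bound `N` precedes `f`, which gives uniformity over families. -/
theorem weakNorm_le {q : E n → ℝ} (he : IsExponent (unitBall n) q)
    (hq : IsLogHolder (unitBall n) q) {α M : ℝ} (hα : 0 < α) (hM : 0 < M) (hqα : q 0 ≤ n / α) :
    ∃ N : ℝ, ∀ f : E n → ℝ, (∀ x ∈ unitBall n, x ≠ 0 → |f x| ≤ M * ‖x‖ ^ (-α)) →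
      weakNorm q (unitBall n) f ≤ ENNReal.ofReal N := by
  obtain ⟨C, hC, hlux⟩ := luxNorm_indicator_le he hq
  have hq0 : 0 < q 0 := he.2.1 0 (by simp)
  refine ⟨C * M, fun f hf => iSup_le fun t => iSup_le fun ht => ?_⟩
  -- The indicator estimates concern radii at most `1`.
  set R : ℝ := min 1 ((M / t) ^ α⁻¹) with hRdef
  have hR : R ∈ Ioc (0 : ℝ) 1 := ⟨lt_min one_pos (by positivity), min_le_left _ _⟩
  have h1 := hlux R hR {x | t < |f x|} (by
    rintro x ⟨hx, hxB⟩
    rcases eq_or_ne x 0 with rfl | h0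
    · simpa using hR.1
    have hx' := norm_mem_Ioo hxB h0
    rw [mem_ball_zero_iff]
    refine lt_min hx'.2 ?_
    have h2 : t < M * ‖x‖ ^ (-α) := lt_of_lt_of_le hx (hf x hxB h0)
    rw [Real.lt_rpow_inv_iff_of_pos hx'.1.le (by positivity) hα, lt_div_iff₀ ht]
    rw [Real.rpow_neg hx'.1.le, ← div_eq_mul_inv,
      lt_div_iff₀ (Real.rpow_pos_of_pos hx'.1 _)] at h2
    linarith)
  refine (mul_le_mul_right h1 _).trans ?_
  rw [← ENNReal.ofReal_mul ht.le]
  refine ENNReal.ofReal_le_ofReal ?_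
  have h2 : R ^ (n / q 0) ≤ M / t := by
    calc R ^ (n / q 0) ≤ R ^ α := by
          refine Real.rpow_le_rpow_of_exponent_ge hR.1 hR.2 ?_
          rw [le_div_iff₀ hα] at hqα
          rw [le_div_iff₀ hq0]
          linarith
      _ ≤ ((M / t) ^ α⁻¹) ^ α := Real.rpow_le_rpow hR.1.le (min_le_right _ _) hα.le
      _ = M / t := Real.rpow_inv_rpow (by positivity) hα.ne'
  calc t * (C * R ^ (n / q 0)) ≤ t * (C * (M / t)) := by gcongr
    _ = C * M := by field_simp

/-- The superlevel set contains a punctured ball of radius `(m/t)^{1/α}`, so the quantity in the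
weak norm is at least a multiple of `t^{1-γ}` with `γ = n/(α q(0)) < 1`. The index may depend on
`t`, because each single `v_r` is bounded and only the family blows up. -/
theorem weakNorm_unbounded [Nontrivial (E n)] {ι : Type*} {q : E n → ℝ}
    (he : IsExponent (unitBall n) q) (hq : IsLogHolder (unitBall n) q) {α m t₀ : ℝ} (hα : 0 < α)
    (hm : 0 < m) (hqα : n / α < q 0) {F : ι → E n → ℝ}
    (hF : ∀ t, t₀ ≤ t → ∃ i, ∀ x : E n, x ≠ 0 → ‖x‖ < (m / t) ^ α⁻¹ → t < |F i x|)
    {B : ℝ≥0∞} (hB : ∀ i, weakNorm q (unitBall n) (F i) ≤ B) : B = ⊤ := by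
  obtain ⟨C, hC, hlux⟩ := le_luxNorm_indicator he hq
  have hq0 : 0 < q 0 := he.2.1 0 (by simp)
  set γ : ℝ := α⁻¹ * (n / q 0) with hγ
  have hγ1 : 0 < 1 - γ := by
    have : γ < 1 := by
      rw [hγ, inv_mul_lt_iff₀ hα, mul_one, div_lt_iff₀ hq0]
      rwa [div_lt_iff₀ hα, mul_comm] at hqα
    linarith
  have hbound : ∀ t : ℝ, max t₀ m ≤ t → ENNReal.ofReal (C * m ^ γ * t ^ (1 - γ)) ≤ B := by
    intro t ht
    have ht0 : 0 < t := hm.trans_le ((le_max_right _ _).trans ht)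
    obtain ⟨i, hi⟩ := hF t ((le_max_left _ _).trans ht)
    have hR : (m / t) ^ α⁻¹ ∈ Ioc (0 : ℝ) 1 := by
      refine ⟨by positivity, Real.rpow_le_one (by positivity) ?_ (by positivity)⟩
      rw [div_le_one ht0]
      exact (le_max_right _ _).trans ht
    have h1 := hlux _ hR {x | t < |F i x|} hi
    refine le_trans ?_ (hB i)
    refine le_trans ?_ (le_iSup₂_of_le t ht0 le_rfl)
    refine le_trans ?_ (mul_le_mul_right h1 _)
    rw [← ENNReal.ofReal_mul ht0.le]
    refine ENNReal.ofReal_le_ofReal (le_of_eq ?_)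
    rw [← Real.rpow_mul (by positivity), ← hγ, Real.div_rpow hm.le ht0.le,
      Real.rpow_sub ht0, Real.rpow_one]
    ring
  by_contra hne
  have hlim : Tendsto (fun t : ℝ => C * m ^ γ * t ^ (1 - γ)) atTop atTop :=
    (tendsto_rpow_atTop hγ1).const_mul_atTop (by positivity)
  obtain ⟨t, ht1, ht2⟩ := ((hlim.eventually (eventually_gt_atTop B.toReal)).and
    (eventually_ge_atTop (max t₀ m))).exists
  have h2 := hbound t ht2
  rw [ENNReal.ofReal_le_iff_le_toReal hne] at h2
  linarith

/-! ### Membership of `u`, `v_r` and their gradients in the weak spaces -/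

namespace Admissible

/-- The exponent `γ` may exceed the true growth, so the logarithmic and bounded cases need no
separate treatment when only integrability is wanted. -/
theorem profile_le (h : Admissible n P W) {γ : ℝ} (hγ : 1 < γ) (hβ : growth n P ≤ γ) :
    ∃ M, 0 < M ∧ ∀ r ∈ Ico (0 : ℝ) 1, ∀ ρ ∈ Ioo (0 : ℝ) 1,
      profile n P W r ρ ≤ M * ρ ^ (-(γ - 1)) := by
  obtain ⟨c, hc, hb⟩ := h.slope_max_le
  have hγ' : 0 < γ - 1 := by linarith
  refine ⟨c / (γ - 1), by positivity, fun r hr ρ hρ => ?_⟩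
  have h0 : (0 : ℝ) ∉ uIcc ρ 1 := by
    rw [uIcc_of_le hρ.2.le]
    exact fun h' => not_lt.2 h'.1 hρ.1
  have h1 : profile n P W r ρ ≤ ∫ s in ρ..1, c * s ^ (-γ) := by
    rw [profile, intervalIntegral.integral_of_le hρ.2.le, intervalIntegral.integral_of_le hρ.2.le,
      integral_Ioc_eq_integral_Ioo, integral_Ioc_eq_integral_Ioo]
    refine setIntegral_mono_on
      (h.integrableOn_slope_max hr hρ.1.le (lt_max_of_lt_left hρ.1)) ?_ measurableSet_Ioo
      fun s hs => ?_
    · refine Integrable.const_mul ?_ c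
      have := intervalIntegral.intervalIntegrable_rpow (μ := volume) (r := -γ) (Or.inr h0)
      exact (intervalIntegrable_iff_integrableOn_Ioo_of_le hρ.2.le).1 this
    · have hs' : s ∈ Ioo (0 : ℝ) 1 := ⟨hρ.1.trans hs.1, hs.2⟩
      refine (hb r hr s hs').2.trans ?_
      gcongr ?_ * ?_
      exact Real.rpow_le_rpow_of_exponent_ge hs'.1 hs'.2.le (by linarith)
  refine h1.trans ?_
  rw [intervalIntegral.integral_const_mul, integral_rpow (Or.inr ⟨by linarith, h0⟩), Real.one_rpow]
  have h2 : (1 - ρ ^ (-γ + 1)) / (-γ + 1) = (ρ ^ (-(γ - 1)) - 1) / (γ - 1) := by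
    rw [show -γ + 1 = -(γ - 1) by ring, div_neg, ← neg_div]
    congr 1
    ring
  rw [h2, div_mul_eq_mul_div, ← mul_div_assoc]
  gcongr
  linarith

theorem lt_profile (h : Admissible n P W) (hβ : 1 < growth n P) :
    ∃ m t₀, 0 < m ∧ m ≤ t₀ ∧ ∀ t, t₀ ≤ t → ∀ ρ, 0 < ρ → ρ < (m / t) ^ (growth n P - 1)⁻¹ →
      t < profile n P W 0 ρ := by
  obtain ⟨c, hc, hb⟩ := h.slope_bounds
  set α := growth n P - 1 with hα
  have hα0 : 0 < α := by linarith
  have hc0 : 0 < c := by linarith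
  -- The factor `2` pays for the `-1` in `(ρ^{-α} - 1)/α`: the choice `t ≥ 2m` ensures `ρ^{-α} ≥ 2`.
  set m : ℝ := c⁻¹ / (2 * α) with hm
  have hm0 : 0 < m := by positivity
  refine ⟨m, 2 * m, hm0, by linarith, fun t ht ρ hρ0 hρ => ?_⟩
  have ht0 : 0 < t := by linarith
  have h1 : t / m < ρ ^ (-α) := by
    rw [Real.lt_rpow_inv_iff_of_pos hρ0.le (by positivity) hα0] at hρ
    rw [Real.rpow_neg hρ0.le, lt_inv_comm₀ (by positivity) (Real.rpow_pos_of_pos hρ0 _), inv_div]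
    exact hρ
  have hρ1 : ρ < 1 := by
    refine hρ.trans_le (Real.rpow_le_one (by positivity) ?_ (by positivity))
    rw [div_le_one ht0]
    linarith
  have h2 : 2 ≤ ρ ^ (-α) := by
    refine le_trans ?_ h1.le
    rwa [le_div_iff₀ hm0]
  have h0 : (0 : ℝ) ∉ uIcc ρ 1 := by
    rw [uIcc_of_le hρ1.le]
    exact fun h' => not_lt.2 h'.1 hρ0
  have h3 : ∫ s in ρ..1, c⁻¹ * s ^ (-growth n P) ≤ profile n P W 0 ρ := by
    rw [profile, intervalIntegral.integral_of_le hρ1.le, intervalIntegral.integral_of_le hρ1.le,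
      integral_Ioc_eq_integral_Ioo, integral_Ioc_eq_integral_Ioo]
    refine setIntegral_mono_on ?_ (h.integrableOn_slope_max (by simp) hρ0.le
      (lt_max_of_lt_left hρ0)) measurableSet_Ioo fun s hs => ?_
    · refine Integrable.const_mul ?_ _
      have := intervalIntegral.intervalIntegrable_rpow (μ := volume) (r := -growth n P)
        (Or.inr h0)
      exact (intervalIntegrable_iff_integrableOn_Ioo_of_le hρ1.le).1 this
    · have hs' : s ∈ Ioo (0 : ℝ) 1 := ⟨hρ0.trans hs.1, hs.2⟩
      rw [max_eq_left hs'.1.le]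
      exact (hb s hs').1
  refine lt_of_lt_of_le ?_ h3
  rw [intervalIntegral.integral_const_mul, integral_rpow (Or.inr ⟨by linarith, h0⟩), Real.one_rpow]
  have h4 : (1 - ρ ^ (-growth n P + 1)) / (-growth n P + 1) = (ρ ^ (-α) - 1) / α := by
    rw [show -growth n P + 1 = -α by rw [hα]; ring, div_neg, ← neg_div]
    congr 1
    ring
  rw [h4]
  rw [div_lt_iff₀ hm0] at h1
  calc t < ρ ^ (-α) * m := h1
    _ = c⁻¹ * ((ρ ^ (-α) / 2) / α) := by rw [hm]; field_simp
    _ ≤ c⁻¹ * ((ρ ^ (-α) - 1) / α) := by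
        gcongr
        linarith

theorem profile_max_le (h : Admissible n P W) {r ρ : ℝ} (hr : r ∈ Ico (0 : ℝ) 1)
    (hρ : ρ ∈ Ioo (0 : ℝ) 1) : profile n P W 0 (max ρ r) ≤ profile n P W r ρ := by
  rw [← profile_eq_of_le hr.1 (le_max_right ρ r) (max_lt hρ.2 hr.2).le]
  rcases (le_max_left ρ r).eq_or_lt with he | hlt
  · rw [← he]
  · exact (h.profile_strictAnti hr hρ.1.le (lt_max_of_lt_left hρ.1) hlt
      (max_lt hρ.2 hr.2).le).le

/-- The set `I` is `{0}` for `u` and `(0, r₀)` for the modifications, so one statement serves both.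
-/
theorem iSup_weakNorm_profile_lt_top_iff (h : Admissible n P W) {q : E n → ℝ}
    (he : IsExponent (unitBall n) q) (hq : IsLogHolder (unitBall n) q) (hP : P 0 < n)
    {I : Set ℝ} (hI : I ⊆ Ico 0 1) (hI0 : ∀ δ > 0, ∃ r ∈ I, r < δ) {V : ℝ → E n → ℝ}
    (hV : ∀ r ∈ I, ∀ x ∈ unitBall n, x ≠ 0 → V r x = profile n P W r ‖x‖) :
    (⨆ r ∈ I, weakNorm q (unitBall n) (V r)) < ⊤ ↔ q 0 ≤ n * (P 0 - 1) / (n - P 0) := by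
  have := h.nontrivial
  have hP0 : 1 < P 0 := h.exp_gt_one (by simp)
  have hg : growth n P - 1 = (n - P 0) / (P 0 - 1) := by
    rw [growth]
    have : P 0 - 1 ≠ 0 := by linarith
    field_simp
    ring
  have hα : 0 < growth n P - 1 := by
    rw [hg]
    exact div_pos (by linarith) (by linarith)
  have hn : (n : ℝ) * (P 0 - 1) / (n - P 0) = n / (growth n P - 1) := by
    rw [hg, div_div_eq_mul_div]
  rw [hn]
  constructor
  · intro hlt
    by_contra hgt
    rw [not_le] at hgt
    obtain ⟨m, t₀, hm, hmt, hu⟩ := h.lt_profile (by linarith)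
    refine hlt.ne (weakNorm_unbounded (ι := I) he hq hα hm hgt (t₀ := t₀) (F := fun r => V r)
      ?_ fun r => le_iSup₂_of_le r.1 r.2 le_rfl)
    intro t ht
    have ht0 : 0 < t := by linarith
    -- Below the critical radius, `max ‖x‖ r` is still inside the ball where `u > t`, and `v_r(x)`
    -- is at least the value of `u` at that radius.
    obtain ⟨r, hrI, hr⟩ := hI0 ((m / t) ^ (growth n P - 1)⁻¹) (by positivity)
    refine ⟨⟨r, hrI⟩, fun x hx0 hx => ?_⟩
    have hx1 : ‖x‖ < 1 := by
      refine hx.trans_le (Real.rpow_le_one (by positivity) ?_ (by positivity))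
      rw [div_le_one ht0]
      linarith
    have hxB : x ∈ unitBall n := by simpa using hx1
    have hx' := norm_mem_Ioo hxB hx0
    rw [hV r hrI x hxB hx0]
    refine lt_of_lt_of_le ?_ (le_abs_self _)
    exact (hu t ht _ (lt_max_of_lt_left hx'.1) (max_lt hx hr)).trans_le
      (h.profile_max_le (hI hrI) hx')
  · intro hle
    obtain ⟨M, hM, hb⟩ := h.profile_le (γ := growth n P) (by linarith) le_rfl
    obtain ⟨N, hN⟩ := weakNorm_le he hq hα hM hle
    refine lt_of_le_of_lt (iSup₂_le fun r hr => hN (V r) fun x hx hx0 => ?_)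
      (ENNReal.ofReal_lt_top (r := N))
    have hx' := norm_mem_Ioo hx hx0
    rw [hV r hr x hx hx0, abs_of_nonneg (h.profile_nonneg (hI hr) ⟨hx'.1.le, hx'.2.le⟩)]
    exact hb r (hI hr) _ hx'

theorem iSup_weakNorm_slope_lt_top_iff (h : Admissible n P W) {q : E n → ℝ}
    (he : IsExponent (unitBall n) q) (hq : IsLogHolder (unitBall n) q)
    {I : Set ℝ} (hI : I ⊆ Ico 0 1) (hI0 : ∀ δ > 0, ∃ r ∈ I, r < δ) {V : ℝ → E n → ℝ}
    (hV : ∀ r ∈ I, ∀ x ∈ unitBall n, x ≠ 0 → V r x = slope n P W (max ‖x‖ r)) :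
    (⨆ r ∈ I, weakNorm q (unitBall n) (V r)) < ⊤ ↔ q 0 ≤ n * (P 0 - 1) / (n - 1) := by
  have := h.nontrivial
  have hα := h.growth_pos
  have hn : (n : ℝ) * (P 0 - 1) / (n - 1) = n / growth n P := by
    rw [growth, div_div_eq_mul_div]
  rw [hn]
  constructor
  · intro hlt
    by_contra hgt
    rw [not_le] at hgt
    obtain ⟨c, hc, hb⟩ := h.slope_bounds
    have hc0 : 0 < c := by linarith
    refine hlt.ne (weakNorm_unbounded (ι := I) he hq hα (m := c⁻¹) (by positivity) hgt (t₀ := 1)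
      (F := fun r => V r) ?_ fun r => le_iSup₂_of_le r.1 r.2 le_rfl)
    intro t ht
    have ht0 : 0 < t := by linarith
    obtain ⟨r, hrI, hr⟩ := hI0 ((c⁻¹ / t) ^ (growth n P)⁻¹) (by positivity)
    refine ⟨⟨r, hrI⟩, fun x hx0 hx => ?_⟩
    have hx1 : ‖x‖ < 1 := by
      refine hx.trans_le (Real.rpow_le_one (by positivity) ?_ (by positivity))
      rw [div_le_one ht0]
      exact (inv_le_one_of_one_le₀ hc).trans ht
    have hxB : x ∈ unitBall n := by simpa using hx1
    have hx' := norm_mem_Ioo hxB hx0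
    have hmax := max_mem hx' (hI hrI)
    rw [hV r hrI x hxB hx0]
    refine lt_of_lt_of_le ?_ (le_abs_self _)
    refine lt_of_lt_of_le ?_ (hb _ hmax).1
    have h2 := max_lt hx hr
    rw [Real.lt_rpow_inv_iff_of_pos hmax.1.le (by positivity) hα, lt_div_iff₀ ht0] at h2
    rw [Real.rpow_neg hmax.1.le, ← div_eq_mul_inv, lt_div_iff₀ (Real.rpow_pos_of_pos hmax.1 _)]
    linarith
  · intro hle
    obtain ⟨M, hM, hb⟩ := h.slope_max_le
    obtain ⟨N, hN⟩ := weakNorm_le he hq hα (M := M) (by linarith) hle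
    refine lt_of_le_of_lt (iSup₂_le fun r hr => hN (V r) fun x hx hx0 => ?_)
      (ENNReal.ofReal_lt_top (r := N))
    have hx' := norm_mem_Ioo hx hx0
    rw [hV r hr x hx hx0, abs_of_pos (h.slope_pos (max_mem hx' (hI hr)))]
    exact (hb r (hI hr) _ hx').2

theorem aemeasurable_of_continuousOn (h : Admissible n P W) {f g : E n → ℝ}
    (hfg : ∀ x ∈ unitBall n, x ≠ 0 → f x = g x) (hg : ContinuousOn g (unitBall n \ {0})) :
    AEMeasurable f (volume.restrict (unitBall n)) := by
  have := h.nontrivial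
  refine AEMeasurable.congr ?_ (h.ae_eq_of_punctured fun x hx h0 => (hfg x hx h0).symm)
  rw [← Measure.restrict_congr_set (ball_ae_eq_punctured (unitBall n))]
  exact hg.aemeasurable isOpen_punctured.measurableSet

theorem memWeakL_fund_iff (h : Admissible n P W) {q : E n → ℝ}
    (he : IsExponent (unitBall n) q) (hq : IsLogHolder (unitBall n) q) (hP : P 0 < n) :
    MemWeakL q (unitBall n) (fund n P W) ↔ q 0 ≤ n * (P 0 - 1) / (n - P 0) := by
  rw [← h.iSup_weakNorm_profile_lt_top_iff he hq hP (I := {0}) (V := fun _ => fund n P W)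
    (by simp) (fun δ hδ => ⟨0, rfl, hδ⟩) (by
      rintro _ rfl x hx h0
      exact h.fund_eq hx h0), iSup_singleton]
  exact and_iff_right (h.aemeasurable_of_continuousOn (fun _ _ _ => rfl)
    h.contDiffOn_fund.continuousOn)

theorem memWeakL_gradient_fund_iff (h : Admissible n P W) {q : E n → ℝ}
    (he : IsExponent (unitBall n) q) (hq : IsLogHolder (unitBall n) q) :
    MemWeakL q (unitBall n) (fun x => ‖gradient (fund n P W) x‖) ↔
      q 0 ≤ n * (P 0 - 1) / (n - 1) := by
  have hr : (0 : ℝ) ∈ Ico (0 : ℝ) 1 := by simp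
  rw [← h.iSup_weakNorm_slope_lt_top_iff he hq (I := {0})
    (V := fun _ x => ‖gradient (fund n P W) x‖)
    (by simp) (fun δ hδ => ⟨0, rfl, hδ⟩) (by
      rintro _ rfl x hx h0
      rw [h.gradient_fund hx h0, h.norm_radialField hr hx h0]), iSup_singleton]
  exact and_iff_right (h.aemeasurable_of_continuousOn
    (fun x hx h0 => by rw [h.gradient_fund hx h0]) (h.continuousOn_radialField hr).norm)

end Admissible

/-! ### Distributional gradients of `u` and `v_r` -/

theorem IsTest.integrableOn_smul {U : Set (E n)} (hU : IsOpen U) {φ : E n → ℝ} (hφ : IsTest U φ)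
    {G : E n → E n} (hG : LocallyIntegrableOn G U) : IntegrableOn (fun x => φ x • G x) U := by
  obtain ⟨C, hC⟩ := hφ.exists_bound
  have h1 : IntegrableOn G (tsupport φ) := hG.integrableOn_compact_subset hφ.2.2 hφ.2.1
  have h2 : IntegrableOn (fun x => φ x • G x) (tsupport φ) :=
    Integrable.bdd_smul h1 C hφ.1.continuous.aestronglyMeasurable (ae_of_all _ hC)
  refine h2.of_forall_sdiff_eq_zero hU.measurableSet fun x hx => ?_
  rw [image_eq_zero_of_notMem_tsupport hx.2, zero_smul]

theorem IsTest.integrableOn_smul_gradient {U : Set (E n)} (hU : IsOpen U) {φ : E n → ℝ}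
    (hφ : IsTest U φ) {f : E n → ℝ} (hf : LocallyIntegrableOn f U) :
    IntegrableOn (fun x => f x • gradient φ x) U := by
  obtain ⟨C, hC⟩ := hφ.exists_bound_gradient
  have h1 : IntegrableOn f (tsupport φ) := hf.integrableOn_compact_subset hφ.2.2 hφ.2.1
  have h2 : IntegrableOn (fun x => f x • gradient φ x) (tsupport φ) :=
    Integrable.smul_bdd h1 C hφ.continuous_gradient.aestronglyMeasurable (ae_of_all _ hC)
  refine h2.of_forall_sdiff_eq_zero hU.measurableSet fun x hx => ?_
  rw [gradient_eq_zero_of_notMem hx.2, smul_zero]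

/-- A Lipschitz function has its almost everywhere gradient as distributional gradient. -/
theorem hasWeakGradient_of_lipschitz {U : Set (E n)} (hU : IsOpen U) {f g : E n → ℝ}
    {G : E n → E n} {C : NNReal} (hg : LipschitzWith C g) (hfg : ∀ x ∈ U, f x = g x)
    (hG : LocallyIntegrableOn G U)
    (hfG : ∀ᵐ x ∂(volume.restrict U), HasGradientAt f (G x) x) : HasWeakGradient U f G := by
  have hf : LocallyIntegrableOn f U := by
    refine (locallyIntegrableOn_iff hU.isLocallyClosed).2 fun K hKU hK => ?_
    exact (hg.continuous.continuousOn.integrableOn_compact hK).congr_fun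
      (fun x hx => (hfg x (hKU hx)).symm) hK.measurableSet
  refine ⟨hf, hG, fun φ hφ => ?_⟩
  obtain ⟨D, hD⟩ := ContDiff.lipschitzWith_of_hasCompactSupport hφ.2.1 hφ.1 (by simp)
  refine ext_inner_left ℝ fun v => ?_
  rw [inner_neg_right, ← integral_inner (hφ.integrableOn_smul_gradient hU hf),
    ← integral_inner (hφ.integrableOn_smul hU hG)]
  -- Integration by parts for Lipschitz functions; its sign is carried by the direction `-v`.
  have key := hg.integral_lineDeriv_mul_eq (μ := volume) hD hφ.2.1 v
  have h1 : ∫ x in U, inner ℝ v (f x • gradient φ x) = -∫ x, lineDeriv ℝ φ x (-v) * g x := by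
    rw [← setIntegral_eq_integral_of_forall_compl_eq_zero (s := U)
      (f := fun x => lineDeriv ℝ φ x (-v) * g x), ← integral_neg]
    · refine setIntegral_congr_fun hU.measurableSet fun x hx => ?_
      beta_reduce
      rw [inner_smul_right, inner_gradient, (hφ.differentiable x).lineDeriv_eq_fderiv, map_neg,
        hfg x hx]
      ring
    · intro x hx
      have hx' : x ∉ tsupport φ := fun h' => hx (hφ.2.2 h')
      rw [(hφ.differentiable x).lineDeriv_eq_fderiv, ← inner_gradient,
        gradient_eq_zero_of_notMem hx', inner_zero_right, zero_mul]
  have h2 : ∫ x in U, inner ℝ v (φ x • G x) = ∫ x, lineDeriv ℝ g x v * φ x := by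
    rw [← setIntegral_eq_integral_of_forall_compl_eq_zero (s := U)
      (f := fun x => lineDeriv ℝ g x v * φ x)]
    · refine integral_congr_ae ?_
      filter_upwards [hfG, ae_restrict_mem hU.measurableSet] with x hx hxU
      have h3 : HasFDerivAt g (InnerProductSpace.toDual ℝ (E n) (G x)) x := by
        refine (hasGradientAt_iff_hasFDerivAt.1 hx).congr_of_eventuallyEq ?_
        filter_upwards [hU.mem_nhds hxU] with y hy
        exact (hfg y hy).symm
      rw [(h3.hasLineDerivAt v).lineDeriv, inner_smul_right, InnerProductSpace.toDual_apply_apply,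
        real_inner_comm, mul_comm]
    · intro x hx
      rw [hφ.eq_zero_of_notMem hx, mul_zero]
  rw [h1, h2, key]

theorem HasWeakGradient.congr {U : Set (E n)} {f f' : E n → ℝ} {G G' : E n → E n}
    (h : HasWeakGradient U f G) (hf : f =ᵐ[volume.restrict U] f')
    (hG : G =ᵐ[volume.restrict U] G') : HasWeakGradient U f' G' := by
  refine ⟨?_, ?_, fun φ hφ => ?_⟩
  · intro x hx
    obtain ⟨s, hs, hsi⟩ := h.1 x hx
    refine ⟨s ∩ U, inter_mem hs self_mem_nhdsWithin, (hsi.mono_set inter_subset_left).congr ?_⟩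
    exact ae_restrict_of_ae_restrict_of_subset inter_subset_right hf
  · intro x hx
    obtain ⟨s, hs, hsi⟩ := h.2.1 x hx
    refine ⟨s ∩ U, inter_mem hs self_mem_nhdsWithin, (hsi.mono_set inter_subset_left).congr ?_⟩
    exact ae_restrict_of_ae_restrict_of_subset inter_subset_right hG
  · have h1 : ∫ x in U, f' x • gradient φ x = ∫ x in U, f x • gradient φ x := by
      refine integral_congr_ae ?_
      filter_upwards [hf] with x hx
      rw [hx]
    have h2 : ∫ x in U, φ x • G' x = ∫ x in U, φ x • G x := by
      refine integral_congr_ae ?_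
      filter_upwards [hG] with x hx
      rw [hx]
    rw [h1, h2]
    exact h.2.2 φ hφ

/-- Dominated limits of functions with distributional gradients. -/
theorem HasWeakGradient.of_tendsto {U : Set (E n)} (hU : IsOpen U) {l : Filter ℝ} [l.NeBot]
    [l.IsCountablyGenerated] {F : ℝ → E n → ℝ} {G : ℝ → E n → E n} {f : E n → ℝ} {g : E n → E n}
    {bf bg : E n → ℝ} (hFG : ∀ᶠ r in l, HasWeakGradient U (F r) (G r))
    (hf : IntegrableOn f U) (hg : IntegrableOn g U) (hbf : IntegrableOn bf U)
    (hbg : IntegrableOn bg U) (hFb : ∀ᶠ r in l, ∀ᵐ x ∂(volume.restrict U), ‖F r x‖ ≤ bf x)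
    (hGb : ∀ᶠ r in l, ∀ᵐ x ∂(volume.restrict U), ‖G r x‖ ≤ bg x)
    (hFf : ∀ᵐ x ∂(volume.restrict U), Tendsto (fun r => F r x) l (𝓝 (f x)))
    (hGg : ∀ᵐ x ∂(volume.restrict U), Tendsto (fun r => G r x) l (𝓝 (g x))) :
    HasWeakGradient U f g := by
  refine ⟨hf.locallyIntegrableOn, hg.locallyIntegrableOn, fun φ hφ => ?_⟩
  obtain ⟨C, hC⟩ := hφ.exists_bound
  obtain ⟨D, hD⟩ := hφ.exists_bound_gradient
  have h1 : Tendsto (fun r => ∫ x in U, F r x • gradient φ x) l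
      (𝓝 (∫ x in U, f x • gradient φ x)) := by
    refine tendsto_integral_filter_of_dominated_convergence (fun x => bf x * D) ?_ ?_
      (hbf.mul_const D) ?_
    · filter_upwards [hFG] with r hr
      exact (hφ.integrableOn_smul_gradient hU hr.1).aestronglyMeasurable
    · filter_upwards [hFb] with r hr
      filter_upwards [hr] with x hx
      rw [norm_smul]
      exact mul_le_mul hx (hD x) (norm_nonneg _) ((norm_nonneg _).trans hx)
    · filter_upwards [hFf] with x hx
      exact hx.smul_const _
  have h2 : Tendsto (fun r => ∫ x in U, φ x • G r x) l (𝓝 (∫ x in U, φ x • g x)) := by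
    refine tendsto_integral_filter_of_dominated_convergence (fun x => C * bg x) ?_ ?_
      (hbg.const_mul C) ?_
    · filter_upwards [hFG] with r hr
      exact (hφ.integrableOn_smul hU hr.2.1).aestronglyMeasurable
    · filter_upwards [hGb] with r hr
      filter_upwards [hr] with x hx
      rw [norm_smul]
      exact mul_le_mul (hC x) hx (norm_nonneg _) ((norm_nonneg _).trans (hC x))
    · filter_upwards [hGg] with x hx
      exact hx.const_smul _
  refine tendsto_nhds_unique h1 (h2.neg.congr' ?_)
  filter_upwards [hFG] with r hr
  exact (hr.2.2 φ hφ).symm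

/-- The gradient of the truncation at level `k` of the function with profile `profile r`. -/
def truncField (n : ℕ) (P W : ℝ → ℝ) (r k : ℝ) : E n → E n :=
  indicator ({x | profile n P W r ‖x‖ < k} ∩ (unitBall n \ {0})) (radialField n P W r)

theorem truncField_of_lt {r k : ℝ} {x : E n} (hx : x ∈ unitBall n) (h0 : x ≠ 0)
    (hk : profile n P W r ‖x‖ < k) : truncField n P W r k x = radialField n P W r x := by
  have : x ∈ {x | profile n P W r ‖x‖ < k} ∩ (unitBall n \ {0}) := ⟨hk, hx, h0⟩
  exact indicator_of_mem this _

theorem truncField_of_le {r k : ℝ} {x : E n} (hk : k ≤ profile n P W r ‖x‖) :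
    truncField n P W r k x = 0 :=
  indicator_of_notMem (fun h' => not_lt.2 hk h'.1) _

namespace Admissible

theorem lipschitzOnWith_profile (h : Admissible n P W) {r : ℝ} (hr : r ∈ Ioo (0 : ℝ) 1) :
    ∃ C : NNReal, LipschitzOnWith C (profile n P W r) (Icc 0 1) := by
  obtain ⟨c, hc, hb⟩ := h.slope_max_le
  have hr' : r ∈ Ico (0 : ℝ) 1 := ⟨hr.1.le, hr.2⟩
  have hpos : 0 ≤ c * r ^ (-growth n P) := mul_nonneg (by linarith) (Real.rpow_nonneg hr.1.le _)
  have key : ∀ ρ ∈ Icc (0 : ℝ) 1, ∀ σ ∈ Icc (0 : ℝ) 1, ρ ≤ σ →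
      |profile n P W r ρ - profile n P W r σ| ≤ c * r ^ (-growth n P) * |ρ - σ| := by
    intro ρ hρ σ hσ hle
    rw [h.profile_sub hr' hρ.1 (lt_max_of_lt_right hr.1) hle hσ.2, abs_sub_comm ρ σ,
      ← Real.norm_eq_abs, intervalIntegral.integral_of_le hle, integral_Ioc_eq_integral_Ioo]
    have := norm_setIntegral_le_of_norm_le_const (μ := volume) (s := Ioo ρ σ)
      (f := fun s => slope n P W (max s r)) (C := c * r ^ (-growth n P)) (by simp) fun s hs => by
        have hs' : s ∈ Ioo (0 : ℝ) 1 := ⟨hρ.1.trans_lt hs.1, hs.2.trans_le hσ.2⟩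
        rw [Real.norm_of_nonneg (h.slope_pos (max_mem hs' hr')).le]
        refine (hb r hr' s hs').1.trans ?_
        gcongr ?_ * ?_
        exact Real.rpow_le_rpow_of_nonpos hr.1 (le_max_right _ _) (by linarith [h.growth_pos])
    rwa [Real.volume_real_Ioo_of_le hle, ← abs_of_nonneg (sub_nonneg.2 hle)] at this
  refine ⟨⟨_, hpos⟩, LipschitzOnWith.of_dist_le_mul fun ρ hρ σ hσ => ?_⟩
  rw [Real.dist_eq, Real.dist_eq]
  rcases le_total ρ σ with hle | hle
  · exact key ρ hρ σ hσ hle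
  · rw [abs_sub_comm, abs_sub_comm ρ]
    exact key σ hσ ρ hρ hle

theorem integrableOn_radialField (h : Admissible n P W) {r : ℝ} (hr : r ∈ Ico (0 : ℝ) 1)
    (hβ : growth n P < n) : IntegrableOn (radialField n P W r) (unitBall n) := by
  have := h.nontrivial
  obtain ⟨c, hc, hb⟩ := h.slope_max_le
  refine Integrable.mono' ((integrableOn_norm_rpow hβ).const_mul c)
    (h.aestronglyMeasurable_radialField hr) (h.ae_punctured fun x hx h0 => ?_)
  rw [h.norm_radialField hr hx h0]
  exact (hb r hr _ (norm_mem_Ioo hx h0)).2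

theorem slope_max_le_const (h : Admissible n P W) {r : ℝ} (hr : r ∈ Ioo (0 : ℝ) 1) :
    ∃ C, ∀ ρ ∈ Ioo (0 : ℝ) 1, slope n P W (max ρ r) ≤ C := by
  obtain ⟨c, hc, hb⟩ := h.slope_max_le
  refine ⟨c * r ^ (-growth n P), fun ρ hρ => (hb r ⟨hr.1.le, hr.2⟩ ρ hρ).1.trans ?_⟩
  gcongr ?_ * ?_
  exact Real.rpow_le_rpow_of_nonpos hr.1 (le_max_right _ _) (by linarith [h.growth_pos])

theorem integrableOn_radialField_of_pos (h : Admissible n P W) {r : ℝ} (hr : r ∈ Ioo (0 : ℝ) 1) :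
    IntegrableOn (radialField n P W r) (unitBall n) := by
  have hr' : r ∈ Ico (0 : ℝ) 1 := ⟨hr.1.le, hr.2⟩
  obtain ⟨C, hC⟩ := h.slope_max_le_const hr
  refine IntegrableOn.of_bound (C := C) measure_ball_lt_top (h.aestronglyMeasurable_radialField hr')
    (h.ae_punctured fun x hx h0 => ?_)
  rw [h.norm_radialField hr' hx h0]
  exact hC _ (norm_mem_Ioo hx h0)

theorem measurableSet_sublevel (h : Admissible n P W) {r : ℝ} (hr : r ∈ Ico (0 : ℝ) 1) (k : ℝ) :
    MeasurableSet ({x | profile n P W r ‖x‖ < k} ∩ (unitBall n \ {0})) := by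
  have h1 := (h.contDiffOn_profile_norm (n := n) hr).continuousOn
  have := h1.isOpen_inter_preimage isOpen_punctured (isOpen_Iio (a := k))
  rw [inter_comm]
  exact this.measurableSet

theorem truncField_eq_of_le {r k : ℝ} {x : E n} (hx : x ∈ unitBall n) (h0 : x ≠ 0) (hr : 0 ≤ r)
    (hrx : r ≤ ‖x‖) : truncField n P W r k x = truncField n P W 0 k x := by
  have he := profile_eq_of_le (n := n) (P := P) (W := W) hr hrx (norm_mem_Ioo hx h0).2.le
  rcases lt_or_ge (profile n P W 0 ‖x‖) k with hk | hk
  · rw [truncField_of_lt hx h0 hk, truncField_of_lt hx h0 (he ▸ hk), radialField_eq_of_le hr hrx]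
  · rw [truncField_of_le hk, truncField_of_le (he ▸ hk)]

/-- For `r > 0` the truncation is Lipschitz. By strict monotonicity its level set `k` lies in a
single sphere, up to the origin, hence is null. Off it, the minimum is locally one of its two
arguments. -/
theorem hasWeakGradient_min_profile (h : Admissible n P W) {r : ℝ} (hr : r ∈ Ioo (0 : ℝ) 1)
    (k : ℝ) : HasWeakGradient (unitBall n) (fun x => min (profile n P W r ‖x‖) k)
      (truncField n P W r k) := by
  have := h.nontrivial
  have hr' : r ∈ Ico (0 : ℝ) 1 := ⟨hr.1.le, hr.2⟩
  obtain ⟨C, hC⟩ := h.lipschitzOnWith_profile hr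
  -- Composing with `min ‖x‖ 1` extends the function to a Lipschitz function on the whole space.
  have hg : LipschitzWith C (fun x : E n => min (profile n P W r (min ‖x‖ 1)) k) := by
    have h1 : LipschitzWith 1 (fun x : E n => min ‖x‖ 1) := lipschitzWith_one_norm.min_const 1
    have h2 : LipschitzWith (C * 1) (fun x : E n => profile n P W r (min ‖x‖ 1)) := by
      refine lipschitzOnWith_univ.1 (LipschitzOnWith.comp (t := Icc 0 1) hC h1.lipschitzOnWith ?_)
      exact fun x _ => ⟨le_min (norm_nonneg _) zero_le_one, min_le_right _ _⟩
    rw [mul_one] at h2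
    exact h2.min_const k
  refine hasWeakGradient_of_lipschitz Metric.isOpen_ball hg (fun x hx => ?_) ?_ ?_
  · rw [min_eq_left (norm_mem_Ico hx).2.le]
  · exact ((h.integrableOn_radialField_of_pos hr).indicator
      (h.measurableSet_sublevel hr' k)).locallyIntegrableOn
  · have hne : ∀ᵐ x ∂(volume.restrict (unitBall n)), profile n P W r ‖x‖ ≠ k := by
      by_cases hex : ∃ ρ ∈ Ioo (0 : ℝ) 1, profile n P W r ρ = k
      · obtain ⟨ρ, hρ, hk⟩ := hex
        have hs : (volume : Measure (E n)) (Metric.sphere 0 ρ) = 0 :=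
          Measure.addHaar_sphere _ _ _
        have h1 : ∀ᵐ x : E n, x ∉ Metric.sphere (0 : E n) ρ := measure_eq_zero_iff_ae_notMem.1 hs
        filter_upwards [ae_restrict_of_ae h1, h.ae_punctured (p := fun x => ‖x‖ ∈ Ioo (0 : ℝ) 1)
          fun x hx h0 => norm_mem_Ioo hx h0] with x hx hx1 he
        rw [mem_sphere_zero_iff_norm] at hx
        rcases lt_or_gt_of_ne hx with hlt | hlt
        · have := h.profile_strictAnti hr' hx1.1.le (lt_max_of_lt_left hx1.1) hlt hρ.2.le
          linarith
        · have := h.profile_strictAnti hr' hρ.1.le (lt_max_of_lt_left hρ.1) hlt hx1.2.le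
          linarith
      · refine h.ae_punctured fun x hx h0 he => hex ⟨_, norm_mem_Ioo hx h0, he⟩
    have hB : ∀ᵐ x ∂(volume.restrict (unitBall n)), x ∈ unitBall n \ {0} :=
      h.ae_punctured fun x hx h0 => ⟨hx, h0⟩
    filter_upwards [hne, hB] with x hx hxB
    have hgrad := h.hasGradientAt_profile hr' hxB.1 hxB.2
    have hcont : ContinuousAt (fun y : E n => profile n P W r ‖y‖) x :=
      (hasGradientAt_iff_hasFDerivAt.1 hgrad).continuousAt
    rcases lt_or_gt_of_ne hx with hlt | hlt
    · rw [truncField_of_lt hxB.1 hxB.2 hlt, hasGradientAt_iff_hasFDerivAt]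
      refine (hasGradientAt_iff_hasFDerivAt.1 hgrad).congr_of_eventuallyEq ?_
      filter_upwards [hcont.eventually (gt_mem_nhds hlt)] with y hy
      exact min_eq_left hy.le
    · rw [truncField_of_le hlt.le, hasGradientAt_iff_hasFDerivAt, map_zero]
      refine (hasFDerivAt_const k x).congr_of_eventuallyEq ?_
      filter_upwards [hcont.eventually (lt_mem_nhds hlt)] with y hy
      exact min_eq_right hy.le

/-- Truncation at the maximum, attained at the origin, changes nothing. -/
theorem hasWeakGradient_profile (h : Admissible n P W) {r : ℝ} (hr : r ∈ Ioo (0 : ℝ) 1) :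
    HasWeakGradient (unitBall n) (fun x => profile n P W r ‖x‖) (radialField n P W r) := by
  have hlt : ∀ x ∈ unitBall n, x ≠ 0 → profile n P W r ‖x‖ < profile n P W r 0 := fun x hx h0 =>
    h.profile_strictAnti ⟨hr.1.le, hr.2⟩ le_rfl (lt_max_of_lt_right hr.1) (norm_pos_iff.2 h0)
      (norm_mem_Ioo hx h0).2.le
  refine (h.hasWeakGradient_min_profile hr (profile n P W r 0)).congr
    (h.ae_eq_of_punctured fun x hx h0 => min_eq_left (hlt x hx h0).le)
    (h.ae_eq_of_punctured fun x hx h0 => truncField_of_lt hx h0 (hlt x hx h0))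

/-- For growth at least `1` the slope is at least `c⁻¹/s`, whose integral diverges, so `u` is
unbounded at the origin. -/
theorem exists_lt_profile (h : Admissible n P W) (hβ : 1 ≤ growth n P) (k : ℝ) :
    ∃ r ∈ Ioo (0 : ℝ) 1, k < profile n P W 0 r := by
  obtain ⟨c, hc, hb⟩ := h.slope_bounds
  have hc0 : 0 < c := by linarith
  -- With this radius the lower bound `c⁻¹ log(1/r)` is exactly `|k| + 1`.
  set r := Real.exp (-(c * (|k| + 1))) with hr
  have hr1 : r ∈ Ioo (0 : ℝ) 1 := ⟨Real.exp_pos _, by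
    rw [hr, Real.exp_lt_one_iff, neg_lt_zero]
    positivity⟩
  refine ⟨r, hr1, ?_⟩
  have h0 : (0 : ℝ) ∉ uIcc r 1 := by
    rw [uIcc_of_le hr1.2.le]
    exact fun h' => not_lt.2 h'.1 hr1.1
  have h3 : ∫ s in r..1, c⁻¹ * s⁻¹ ≤ profile n P W 0 r := by
    rw [profile, intervalIntegral.integral_of_le hr1.2.le,
      intervalIntegral.integral_of_le hr1.2.le,
      integral_Ioc_eq_integral_Ioo, integral_Ioc_eq_integral_Ioo]
    refine setIntegral_mono_on ?_ (h.integrableOn_slope_max (by simp) hr1.1.le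
      (lt_max_of_lt_left hr1.1)) measurableSet_Ioo fun s hs => ?_
    · refine Integrable.const_mul ?_ _
      have : IntervalIntegrable (fun s : ℝ => s⁻¹) volume r 1 :=
        intervalIntegral.intervalIntegrable_inv (fun x hx => fun hx0 => h0 (hx0 ▸ hx))
          continuousOn_id
      exact (intervalIntegrable_iff_integrableOn_Ioo_of_le hr1.2.le).1 this
    · have hs' : s ∈ Ioo (0 : ℝ) 1 := ⟨hr1.1.trans hs.1, hs.2⟩
      rw [max_eq_left hs'.1.le]
      refine le_trans ?_ (hb s hs').1
      gcongr
      rw [← Real.rpow_neg_one]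
      exact Real.rpow_le_rpow_of_exponent_ge hs'.1 hs'.2.le (by linarith)
  refine lt_of_lt_of_le ?_ h3
  rw [intervalIntegral.integral_const_mul, integral_inv h0, one_div, Real.log_inv, hr,
    Real.log_exp, neg_neg, inv_mul_cancel_left₀ hc0.ne']
  linarith [le_abs_self k]

theorem abs_min_profile_le (h : Admissible n P W) {r ρ k : ℝ} (hr : r ∈ Ico (0 : ℝ) 1)
    (hρ : ρ ∈ Icc (0 : ℝ) 1) : |min (profile n P W r ρ) k| ≤ |k| := by
  have h1 := h.profile_nonneg hr hρ
  rw [abs_le]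
  refine ⟨le_min ((neg_nonpos.2 (abs_nonneg k)).trans h1) (neg_abs_le k),
    (min_le_right _ _).trans (le_abs_self k)⟩

theorem aestronglyMeasurable_profile (h : Admissible n P W) {r : ℝ} (hr : r ∈ Ico (0 : ℝ) 1) :
    AEStronglyMeasurable (fun x : E n => profile n P W r ‖x‖) (volume.restrict (unitBall n)) := by
  have := h.nontrivial
  rw [← Measure.restrict_congr_set (ball_ae_eq_punctured (unitBall n))]
  exact (h.contDiffOn_profile_norm hr).continuousOn.aestronglyMeasurable
    isOpen_punctured.measurableSet

theorem eventually_lt_norm {x : E n} (h0 : x ≠ 0) : ∀ᶠ r in 𝓝[>] (0 : ℝ), r ∈ Ioo 0 ‖x‖ :=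
  Ioo_mem_nhdsGT (norm_pos_iff.2 h0)

theorem eventually_mem_Ioo : ∀ᶠ r in 𝓝[>] (0 : ℝ), r ∈ Ioo (0 : ℝ) 1 := Ioo_mem_nhdsGT one_pos

/-- If the growth is at least `1`, then `u > k` near the origin, and for a suitable `r` the
truncations of `u` and `v_r` coincide. Otherwise the slope is integrable on the ball and `r → 0` is
a dominated limit. The split is needed because `∇u` itself need not be integrable. -/
theorem hasWeakGradient_min_profile_zero (h : Admissible n P W) (k : ℝ) :
    HasWeakGradient (unitBall n) (fun x => min (profile n P W 0 ‖x‖) k)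
      (truncField n P W 0 k) := by
  have := h.nontrivial
  have hn : (2 : ℝ) ≤ n := by exact_mod_cast h.two_le
  have h00 : (0 : ℝ) ∈ Ico (0 : ℝ) 1 := by simp
  rcases le_or_gt 1 (growth n P) with hβ | hβ
  · obtain ⟨r, hr, hk⟩ := h.exists_lt_profile hβ k
    have hr' : r ∈ Ico (0 : ℝ) 1 := ⟨hr.1.le, hr.2⟩
    have hsmall : ∀ x ∈ unitBall n, x ≠ 0 → ‖x‖ < r →
        k < profile n P W r ‖x‖ ∧ k < profile n P W 0 ‖x‖ := by
      intro x hx h0 hlt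
      have hx' := norm_mem_Ioo hx h0
      have h1 := h.profile_max_le hr' hx'
      rw [max_eq_right hlt.le] at h1
      exact ⟨hk.trans_le h1, hk.trans (h.profile_strictAnti h00 hx'.1.le (lt_max_of_lt_left hx'.1)
        hlt hr.2.le)⟩
    refine (h.hasWeakGradient_min_profile hr k).congr (h.ae_eq_of_punctured fun x hx h0 => ?_)
      (h.ae_eq_of_punctured fun x hx h0 => ?_)
    · rcases lt_or_ge ‖x‖ r with hlt | hge
      · have := hsmall x hx h0 hlt
        rw [min_eq_right this.1.le, min_eq_right this.2.le]
      · rw [profile_eq_of_le hr.1.le hge (norm_mem_Ioo hx h0).2.le]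
    · rcases lt_or_ge ‖x‖ r with hlt | hge
      · have := hsmall x hx h0 hlt
        rw [truncField_of_le this.1.le, truncField_of_le this.2.le]
      · exact truncField_eq_of_le hx h0 hr.1.le hge
  · obtain ⟨c, hc, hb⟩ := h.slope_max_le
    refine HasWeakGradient.of_tendsto Metric.isOpen_ball (l := 𝓝[>] 0)
      (F := fun r x => min (profile n P W r ‖x‖) k)
      (G := fun r => truncField n P W r k)
      (bf := fun _ => |k|) (bg := fun x => c * ‖x‖ ^ (-growth n P)) ?_ ?_ ?_ ?_ ?_ ?_ ?_ ?_ ?_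
    · filter_upwards [eventually_mem_Ioo] with r hr using h.hasWeakGradient_min_profile hr k
    · refine IntegrableOn.of_bound (C := |k|) measure_ball_lt_top
        ((h.aestronglyMeasurable_profile h00).inf aestronglyMeasurable_const)
        (h.ae_punctured fun x hx h0 => h.abs_min_profile_le h00 ?_)
      exact Ioo_subset_Icc_self (norm_mem_Ioo hx h0)
    · exact (h.integrableOn_radialField h00 (by linarith)).indicator
        (h.measurableSet_sublevel h00 k)
    · exact integrableOn_const (by simp [measure_ball_lt_top.ne])
    · exact (integrableOn_norm_rpow (by linarith)).const_mul c
    · filter_upwards [eventually_mem_Ioo] with r hr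
      refine h.ae_punctured fun x hx h0 => h.abs_min_profile_le ⟨hr.1.le, hr.2⟩ ?_
      exact Ioo_subset_Icc_self (norm_mem_Ioo hx h0)
    · filter_upwards [eventually_mem_Ioo] with r hr
      refine h.ae_punctured fun x hx h0 => ?_
      refine (norm_indicator_le_norm_self _ _).trans ?_
      have hr' : r ∈ Ico (0 : ℝ) 1 := ⟨hr.1.le, hr.2⟩
      rw [h.norm_radialField hr' hx h0]
      exact (hb r hr' _ (norm_mem_Ioo hx h0)).2
    · refine h.ae_punctured fun x hx h0 => tendsto_const_nhds.congr' ?_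
      filter_upwards [eventually_lt_norm h0] with r hr
      rw [profile_eq_of_le hr.1.le hr.2.le (norm_mem_Ioo hx h0).2.le]
    · refine h.ae_punctured fun x hx h0 => tendsto_const_nhds.congr' ?_
      filter_upwards [eventually_lt_norm h0] with r hr
      exact (truncField_eq_of_le hx h0 hr.1.le hr.2.le).symm

theorem hasTruncGradient_fund (h : Admissible n P W) :
    HasTruncGradient (unitBall n) (fund n P W) (gradient (fund n P W)) := by
  intro k
  refine (h.hasWeakGradient_min_profile_zero k).congr
    (h.ae_eq_of_punctured fun x hx h0 => by rw [h.fund_eq hx h0])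
    (h.ae_eq_of_punctured fun x hx h0 => ?_)
  rcases lt_or_ge (profile n P W 0 ‖x‖) k with hk | hk
  · rw [truncField_of_lt hx h0 hk, indicator_of_mem (by rwa [mem_ofPred_eq, h.fund_eq hx h0]),
      h.gradient_fund hx h0]
  · rw [truncField_of_le hk,
      indicator_of_notMem fun h' => not_lt.2 hk (by rwa [mem_ofPred_eq, h.fund_eq hx h0] at h')]

/-- The condition `p(0) ≥ 2` says that the growth is at most `n - 1 < n`, so `∇u` is integrable and
`r → 0` is a dominated limit. -/
theorem hasWeakGradient_fund (h : Admissible n P W) (hP : 2 ≤ P 0) :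
    HasWeakGradient (unitBall n) (fund n P W) (gradient (fund n P W)) := by
  have := h.nontrivial
  have hn : (2 : ℝ) ≤ n := by exact_mod_cast h.two_le
  have h00 : (0 : ℝ) ∈ Ico (0 : ℝ) 1 := by simp
  have hβ : growth n P ≤ n - 1 := by
    rw [growth]
    exact div_le_self (by linarith) (by linarith)
  obtain ⟨c, hc, hb⟩ := h.slope_max_le
  -- Any exponent with `γ > 1` and `n - 1 ≤ γ < n + 1` would do.
  obtain ⟨M, hM, hu⟩ := h.profile_le (γ := n - 1 / 2) (by linarith) (by linarith)
  have hbound : ∀ r ∈ Ico (0 : ℝ) 1, ∀ᵐ x ∂(volume.restrict (unitBall n)),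
      ‖profile n P W r ‖x‖‖ ≤ M * ‖x‖ ^ (-((n : ℝ) - 1 / 2 - 1)) := fun r hr =>
    h.ae_punctured fun x hx h0 => by
      have hx' := norm_mem_Ioo hx h0
      rw [Real.norm_of_nonneg (h.profile_nonneg hr (Ioo_subset_Icc_self hx'))]
      exact hu r hr _ hx'
  have hint : IntegrableOn (fun x : E n => M * ‖x‖ ^ (-((n : ℝ) - 1 / 2 - 1))) (unitBall n) :=
    (integrableOn_norm_rpow (by linarith)).const_mul M
  have key : HasWeakGradient (unitBall n) (fun x => profile n P W 0 ‖x‖)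
      (radialField n P W 0) := by
    refine HasWeakGradient.of_tendsto Metric.isOpen_ball (l := 𝓝[>] 0)
      (F := fun r x => profile n P W r ‖x‖) (G := fun r => radialField n P W r)
      (bf := fun x => M * ‖x‖ ^ (-((n : ℝ) - 1 / 2 - 1)))
      (bg := fun x => c * ‖x‖ ^ (-growth n P)) ?_ ?_
      (h.integrableOn_radialField h00 (by linarith)) hint
      ((integrableOn_norm_rpow (by linarith)).const_mul c) ?_ ?_ ?_ ?_
    · filter_upwards [eventually_mem_Ioo] with r hr using h.hasWeakGradient_profile hr
    · exact Integrable.mono' hint (h.aestronglyMeasurable_profile h00) (hbound 0 h00)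
    · filter_upwards [eventually_mem_Ioo] with r hr using hbound r ⟨hr.1.le, hr.2⟩
    · filter_upwards [eventually_mem_Ioo] with r hr
      refine h.ae_punctured fun x hx h0 => ?_
      have hr' : r ∈ Ico (0 : ℝ) 1 := ⟨hr.1.le, hr.2⟩
      rw [h.norm_radialField hr' hx h0]
      exact (hb r hr' _ (norm_mem_Ioo hx h0)).2
    · refine h.ae_punctured fun x hx h0 => tendsto_const_nhds.congr' ?_
      filter_upwards [eventually_lt_norm h0] with r hr
      rw [profile_eq_of_le hr.1.le hr.2.le (norm_mem_Ioo hx h0).2.le]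
    · refine h.ae_punctured fun x hx h0 => tendsto_const_nhds.congr' ?_
      filter_upwards [eventually_lt_norm h0] with r hr
      rw [radialField_eq_of_le hr.1.le hr.2.le]
  exact key.congr (h.ae_eq_of_punctured fun x hx h0 => (h.fund_eq hx h0).symm)
    (h.ae_eq_of_punctured fun x hx h0 => (h.gradient_fund hx h0).symm)

theorem modular_lt_top_of_bounded (h : Admissible n P W) {K : Set (E n)} (hK : K ⊆ unitBall n)
    {f : E n → ℝ} {C : ℝ} (hf : ∀ᵐ x ∂(volume.restrict (unitBall n)), |f x| ≤ C) :
    modular (radial n P) K f < ⊤ := by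
  obtain ⟨p₁, p₂, hp₁, hp⟩ := h.exp_bounds
  refine lt_of_le_of_lt (lintegral_mono_set hK) ?_
  have hle : ∀ᵐ x ∂(volume.restrict (unitBall n)),
      ENNReal.ofReal (|f x| ^ radial n P x) ≤ ENNReal.ofReal ((max C 1) ^ p₂) := by
    filter_upwards [hf, ae_restrict_mem measurableSet_ball] with x hx hxB
    refine ENNReal.ofReal_le_ofReal ?_
    have := hp _ (norm_mem_Ico hxB)
    calc |f x| ^ radial n P x ≤ (max C 1) ^ radial n P x :=
          Real.rpow_le_rpow (abs_nonneg _) (hx.trans (le_max_left _ _)) (by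
            rw [radial]; linarith)
      _ ≤ _ := Real.rpow_le_rpow_of_exponent_le (le_max_right _ _) this.2
  refine lt_of_le_of_lt (lintegral_mono_ae hle) ?_
  rw [lintegral_const, Measure.restrict_apply_univ]
  exact ENNReal.mul_lt_top ENNReal.ofReal_lt_top measure_ball_lt_top

theorem memSobolevLoc_profile (h : Admissible n P W) {r : ℝ} (hr : r ∈ Ioo (0 : ℝ) 1)
    {f : E n → ℝ} {G : E n → E n} (hf : ∀ x ∈ unitBall n, f x = profile n P W r ‖x‖)
    (hG : ∀ x ∈ unitBall n, x ≠ 0 → G x = radialField n P W r x) :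
    MemSobolevLoc (radial n P) (unitBall n) f G := by
  have hr' : r ∈ Ico (0 : ℝ) 1 := ⟨hr.1.le, hr.2⟩
  obtain ⟨C, hC⟩ := h.slope_max_le_const hr
  refine ⟨(h.hasWeakGradient_profile hr).congr
    (h.ae_eq_of_punctured fun x hx _ => (hf x hx).symm)
    (h.ae_eq_of_punctured fun x hx h0 => (hG x hx h0).symm), fun K _ hKB => ⟨?_, ?_⟩⟩
  · refine h.modular_lt_top_of_bounded hKB (C := profile n P W r 0)
      (h.ae_punctured fun x hx h0 => ?_)
    have hx' := norm_mem_Ioo hx h0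
    rw [hf x hx, abs_of_nonneg (h.profile_nonneg hr' (Ioo_subset_Icc_self hx'))]
    exact (h.profile_strictAnti hr' le_rfl (lt_max_of_lt_right hr.1) hx'.1 hx'.2.le).le
  · refine h.modular_lt_top_of_bounded hKB (C := C) (h.ae_punctured fun x hx h0 => ?_)
    rw [abs_norm, hG x hx h0, h.norm_radialField hr' hx h0]
    exact hC _ (norm_mem_Ioo hx h0)

end Admissible

/-! ### Mollification and the chain rule for weak gradients -/

open scoped Convolution

theorem HasWeakGradient.integral_mul_fderiv {U : Set (E n)} (hU : IsOpen U) {f : E n → ℝ}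
    {G : E n → E n} (h : HasWeakGradient U f G) {φ : E n → ℝ} (hφ : IsTest U φ) (v : E n) :
    ∫ x in U, f x * fderiv ℝ φ x v = -∫ x in U, φ x * inner ℝ v (G x) := by
  have h1 := congrArg (inner ℝ v) (h.2.2 φ hφ)
  rw [inner_neg_right, ← integral_inner (hφ.integrableOn_smul_gradient hU h.1),
    ← integral_inner (hφ.integrableOn_smul hU h.2.1)] at h1
  simpa only [inner_smul_right, inner_gradient] using h1

theorem hasWeakGradient_of_integral_mul_fderiv {U : Set (E n)} (hU : IsOpen U) {f : E n → ℝ}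
    {G : E n → E n} (hf : LocallyIntegrableOn f U) (hG : LocallyIntegrableOn G U)
    (h : ∀ φ : E n → ℝ, IsTest U φ → ∀ v : E n,
      ∫ x in U, f x * fderiv ℝ φ x v = -∫ x in U, φ x * inner ℝ v (G x)) :
    HasWeakGradient U f G := by
  refine ⟨hf, hG, fun φ hφ => ext_inner_left ℝ fun v => ?_⟩
  rw [inner_neg_right, ← integral_inner (hφ.integrableOn_smul_gradient hU hf),
    ← integral_inner (hφ.integrableOn_smul hU hG)]
  simpa only [inner_smul_right, inner_gradient] using h φ hφ v

theorem exists_isTest_eq_one_nhds {U K : Set (E n)} (hU : IsOpen U) (hK : IsCompact K)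
    (hKU : K ⊆ U) : ∃ χ : E n → ℝ, IsTest U χ ∧ ∃ V, IsOpen V ∧ K ⊆ V ∧ V ⊆ U ∧
      ∀ x ∈ V, χ x = 1 := by
  obtain ⟨δ, hδ, hδU⟩ := hK.exists_cthickening_subset_open hU hKU
  obtain ⟨χ, hχ, -, hs, h1⟩ := exists_contMDiff_support_eq_eq_one_iff
    (modelWithCornersSelf ℝ (E n)) (n := (⊤ : ℕ∞)) (Metric.isOpen_thickening (δ := δ) (E := K))
    (Metric.isClosed_cthickening (δ := δ / 2) (E := K))
    (Metric.cthickening_subset_thickening' hδ (by linarith) K)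
  have hts : tsupport χ ⊆ Metric.cthickening δ K := by
    rw [tsupport, hs]
    exact Metric.closure_thickening_subset_cthickening δ K
  refine ⟨χ, ⟨contMDiff_iff_contDiff.1 hχ, ?_, hts.trans hδU⟩, Metric.thickening (δ / 2) K,
    Metric.isOpen_thickening, Metric.self_subset_thickening (by linarith) K,
    ((Metric.thickening_subset_cthickening _ _).trans
      (Metric.cthickening_mono (by linarith) K)).trans hδU, fun x hx =>
    (h1 x).1 (Metric.thickening_subset_cthickening _ _ hx)⟩
  exact hK.cthickening.of_isClosed_subset (isClosed_tsupport χ) hts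

/-- Convolution with a normalized bump function. -/
def mollify (ρ : ContDiffBump (0 : E n)) (f : E n → ℝ) : E n → ℝ :=
  ρ.normed volume ⋆[ContinuousLinearMap.lsmul ℝ ℝ, volume] f

theorem contDiff_mollify (ρ : ContDiffBump (0 : E n)) {f : E n → ℝ} (hf : Continuous f) :
    ContDiff ℝ ((⊤ : ℕ∞) : WithTop ℕ∞) (mollify ρ f) :=
  ρ.hasCompactSupport_normed.contDiff_convolution_left _ ρ.contDiff_normed hf.locallyIntegrable

theorem abs_mollify_le (ρ : ContDiffBump (0 : E n)) {f : E n → ℝ} (hf : Continuous f) {M : ℝ}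
    (hM : ∀ x, |f x| ≤ M) (x : E n) : |mollify ρ f x| ≤ M := by
  have := dist_convolution_le (μ := (volume : Measure (E n))) (f := ρ.normed volume) (g := f)
    (x₀ := x) (R := ρ.rOut) (ε := M) (z₀ := 0) ((abs_nonneg _).trans (hM 0))
    (ρ.support_normed_eq (μ := volume)).subset ρ.nonneg_normed (ρ.integral_normed)
    hf.aestronglyMeasurable (fun y _ => by simpa using hM y)
  rwa [Real.dist_eq, sub_zero] at this

theorem mollify_eq_zero (ρ : ContDiffBump (0 : E n)) {f : E n → ℝ} {x : E n}
    (hf : ∀ y ∈ Metric.ball x ρ.rOut, f y = 0) : mollify ρ f x = 0 := by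
  have hx := hf x (Metric.mem_ball_self ρ.rOut_pos)
  rw [mollify, ρ.normed_convolution_eq_right fun y hy => by rw [hf y hy, hx], hx]

theorem mollify_apply (ρ : ContDiffBump (0 : E n)) (f : E n → ℝ) (x : E n) :
    mollify ρ f x = ∫ t, ρ.normed volume t * f (x - t) := rfl

/-- Convolution with an even kernel is symmetric; this is Fubini and the substitution `t ↦ -t`. -/
theorem integral_mul_mollify (ρ : ContDiffBump (0 : E n)) {f g : E n → ℝ} (hf : Continuous f)
    (hg : Continuous g) (hgs : HasCompactSupport g) :
    ∫ x, g x * mollify ρ f x = ∫ x, mollify ρ g x * f x := by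
  have hρ : Continuous (ρ.normed (volume : Measure (E n))) := ρ.continuous_normed
  have hρs := ρ.hasCompactSupport_normed (μ := (volume : Measure (E n)))
  have hK : IsCompact (tsupport (ρ.normed (volume : Measure (E n)))) := hρs
  calc ∫ x, g x * mollify ρ f x
      = ∫ x, ∫ t, g x * (ρ.normed volume t * f (x - t)) := by
        refine integral_congr_ae (ae_of_all _ fun x => ?_)
        beta_reduce
        rw [mollify_apply, integral_const_mul]
    _ = ∫ t, ∫ x, g x * (ρ.normed volume t * f (x - t)) := by
        refine integral_integral_swap_of_hasCompactSupport (by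
          simp only [Function.uncurry_def]
          fun_prop) ?_
        refine HasCompactSupport.intro (IsCompact.prod hgs hK) fun z hz => ?_
        simp only [Function.uncurry_def]
        rw [mem_prod, not_and_or] at hz
        rcases hz with hz | hz
        · rw [image_eq_zero_of_notMem_tsupport hz, zero_mul]
        · rw [image_eq_zero_of_notMem_tsupport hz, zero_mul, mul_zero]
    _ = ∫ t, ∫ x, g (x + t) * (ρ.normed volume t * f x) := by
        refine integral_congr_ae (ae_of_all _ fun t => ?_)
        beta_reduce
        rw [← integral_add_right_eq_self _ t]
        simp only [add_sub_cancel_right]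
    _ = ∫ t, ∫ x, g (x - t) * (ρ.normed volume t * f x) := by
        rw [← integral_neg_eq_self]
        simp only [ρ.normed_neg, sub_eq_add_neg]
    _ = ∫ x, ∫ t, g (x - t) * (ρ.normed volume t * f x) := by
        refine integral_integral_swap_of_hasCompactSupport (by
          simp only [Function.uncurry_def]
          fun_prop) ?_
        refine HasCompactSupport.intro (IsCompact.prod hK (IsCompact.add hgs hK)) fun z hz => ?_
        simp only [Function.uncurry_def]
        by_cases h1 : z.1 ∈ tsupport (ρ.normed (volume : Measure (E n)))
        · by_cases h2 : z.2 - z.1 ∈ tsupport g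
          · exact absurd ⟨h1, ⟨_, h2, _, h1, sub_add_cancel _ _⟩⟩ hz
          · rw [image_eq_zero_of_notMem_tsupport h2, zero_mul]
        · rw [image_eq_zero_of_notMem_tsupport h1, zero_mul, mul_zero]
    _ = ∫ x, mollify ρ g x * f x := by
        refine integral_congr_ae (ae_of_all _ fun x => ?_)
        beta_reduce
        rw [mollify_apply, ← integral_mul_const]
        refine integral_congr_ae (ae_of_all _ fun t => ?_)
        beta_reduce
        ring

theorem fderiv_mollify (ρ : ContDiffBump (0 : E n)) {g : E n → ℝ} (hg : ContDiff ℝ 1 g)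
    (hgs : HasCompactSupport g) (x v : E n) :
    fderiv ℝ (mollify ρ g) x v = mollify ρ (fun y => fderiv ℝ g y v) x := by
  have hρ : LocallyIntegrable (ρ.normed (volume : Measure (E n))) volume :=
    ρ.continuous_normed.locallyIntegrable
  have h1 := hgs.hasFDerivAt_convolution_right (ContinuousLinearMap.lsmul ℝ ℝ) hρ hg x
  rw [mollify, h1.fderiv, convolution_precompR_apply _ hρ (hgs.fderiv ℝ)
    (hg.continuous_fderiv one_ne_zero)]
  rfl

theorem tendsto_mollify {ρ : ℕ → ContDiffBump (0 : E n)}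
    (hρ : Tendsto (fun m => (ρ m).rOut) atTop (𝓝 0)) {f : E n → ℝ} (hf : Continuous f) (x : E n) :
    Tendsto (fun z : ℕ × E n => mollify (ρ z.1) f z.2) (atTop ×ˢ 𝓝 x) (𝓝 (f x)) := by
  refine ContDiffBump.convolution_tendsto_right (φ := fun z : ℕ × E n => ρ z.1)
    (g := fun _ => f) (hρ.comp tendsto_fst) (Eventually.of_forall fun _ => hf.aestronglyMeasurable)
    ?_ tendsto_snd
  exact (hf.tendsto x).comp tendsto_snd

theorem integral_mul_fderiv_of_hasCompactSupport {f g : E n → ℝ} (hf : ContDiff ℝ 1 f)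
    (hg : ContDiff ℝ 1 g) (hgs : HasCompactSupport g) (v : E n) :
    ∫ x, f x * fderiv ℝ g x v = -∫ x, fderiv ℝ f x v * g x := by
  have hcf : Continuous (fun x => fderiv ℝ f x v) :=
    (hf.continuous_fderiv one_ne_zero).clm_apply continuous_const
  have hcg : Continuous (fun x => fderiv ℝ g x v) :=
    (hg.continuous_fderiv one_ne_zero).clm_apply continuous_const
  have hgv : HasCompactSupport (fun x => fderiv ℝ g x v) := hgs.fderiv_apply ℝ v
  refine integral_mul_fderiv_eq_neg_fderiv_mul_of_integrable ?_ ?_ ?_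
    (fun x _ => hf.differentiable one_ne_zero x) (fun x _ => hg.differentiable one_ne_zero x)
  · exact (hcf.mul hg.continuous).integrable_of_hasCompactSupport hgs.mul_left
  · exact (hf.continuous.mul hcg).integrable_of_hasCompactSupport hgv.mul_left
  · exact (hf.continuous.mul hg.continuous).integrable_of_hasCompactSupport hgs.mul_left

/-- Classical integration by parts for the smooth function `ψ(F_ρ)`, followed by symmetry of the
mollifier, moves every derivative onto a smooth compactly supported function. Only the
distributional derivative of `F` is then needed. -/
theorem integral_comp_mollify_mul_fderiv (ρ : ContDiffBump (0 : E n)) {F : E n → ℝ}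
    (hF : Continuous F) {ψ : ℝ → ℝ} (hψ : ContDiff ℝ ((⊤ : ℕ∞) : WithTop ℕ∞) ψ)
    {U : Set (E n)} {η : E n → ℝ} (hη : IsTest U η) (v : E n) :
    ∫ x, ψ (mollify ρ F x) * fderiv ℝ η x v =
      ∫ x, F x * fderiv ℝ (mollify ρ fun y => η y * deriv ψ (mollify ρ F y)) x v := by
  have hψ1 : ContDiff ℝ 1 ψ := hψ.of_le (by exact_mod_cast le_top)
  have hψ' : ContDiff ℝ ((⊤ : ℕ∞) : WithTop ℕ∞) (deriv ψ) :=
    ((contDiff_infty_iff_deriv (f := ψ)).1 hψ).2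
  have hη1 : ContDiff ℝ 1 η := hη.1.of_le (by exact_mod_cast le_top)
  have hfs := contDiff_mollify ρ hF
  set f : E n → ℝ := mollify ρ F with hf
  have hf1 : ContDiff ℝ 1 f := hfs.of_le (by exact_mod_cast le_top)
  set a : E n → ℝ := fun x => η x * deriv ψ (f x) with ha
  have ha1 : ContDiff ℝ 1 a := (hη.1.mul (hψ'.comp hfs)).of_le (by exact_mod_cast le_top)
  have hacs : HasCompactSupport a :=
    hη.2.1.of_isClosed_subset (isClosed_tsupport _) tsupport_mul_subset_left
  have hca : Continuous (fun x => fderiv ℝ a x v) :=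
    (ha1.continuous_fderiv one_ne_zero).clm_apply continuous_const
  have h1 : ∀ x, fderiv ℝ (fun y => ψ (f y)) x v = deriv ψ (f x) * fderiv ℝ f x v := by
    intro x
    have h2 : HasFDerivAt (fun y => ψ (f y)) (deriv ψ (f x) • fderiv ℝ f x) x :=
      ((hψ1.differentiable one_ne_zero).differentiableAt.hasDerivAt).comp_hasFDerivAt x
        ((hf1.differentiable one_ne_zero) x).hasFDerivAt
    rw [h2.fderiv]
    rfl
  calc ∫ x, ψ (f x) * fderiv ℝ η x v
      = -∫ x, fderiv ℝ (fun y => ψ (f y)) x v * η x :=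
        integral_mul_fderiv_of_hasCompactSupport (hψ1.comp hf1) hη1 hη.2.1 v
    _ = -∫ x, fderiv ℝ f x v * a x := by
        congr 1
        refine integral_congr_ae (ae_of_all _ fun x => ?_)
        simp only [ha, h1]
        ring
    _ = ∫ x, f x * fderiv ℝ a x v :=
        (integral_mul_fderiv_of_hasCompactSupport hf1 ha1 hacs v).symm
    _ = ∫ x, fderiv ℝ a x v * mollify ρ F x := by simp only [mul_comm, hf]
    _ = ∫ x, mollify ρ (fun y => fderiv ℝ a y v) x * F x :=
        integral_mul_mollify ρ hF hca (hacs.fderiv_apply ℝ v)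
    _ = ∫ x, F x * fderiv ℝ (mollify ρ a) x v := by
        refine integral_congr_ae (ae_of_all _ fun x => ?_)
        beta_reduce
        rw [← fderiv_mollify ρ ha1 hacs, mul_comm]

theorem exists_bump_seq {δ : ℝ} (hδ : 0 < δ) : ∃ ρ : ℕ → ContDiffBump (0 : E n),
    Tendsto (fun m => (ρ m).rOut) atTop (𝓝 0) ∧ ∀ m, (ρ m).rOut ≤ δ := by
  refine ⟨fun m => ⟨δ / (m + 2) / 2, δ / (m + 2), by positivity, half_lt_self (by positivity)⟩,
    ?_, fun m => ?_⟩
  · exact tendsto_const_nhds.div_atTop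
      (tendsto_atTop_add_const_right _ _ tendsto_natCast_atTop_atTop)
  · change δ / (m + 2) ≤ δ
    exact div_le_self hδ.le (by
      have : (0 : ℝ) ≤ m := Nat.cast_nonneg m
      linarith)

/-- Passage to the limit in the integral identity defining distributional derivatives. -/
theorem integral_mul_fderiv_of_tendsto {U K : Set (E n)} (hU : IsOpen U) (hKU : K ⊆ U)
    {G : E n → E n} (hGK : IntegrableOn G K) {η : E n → ℝ} (hη : IsTest U η) (v : E n)
    {g b : ℕ → E n → ℝ} {g₀ b₀ : E n → ℝ} {C D : ℝ} (hg : ∀ m, Continuous (g m))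
    (hgC : ∀ m x, |g m x| ≤ C) (hg₀ : ∀ x, Tendsto (fun m => g m x) atTop (𝓝 (g₀ x)))
    (hb : ∀ m, Continuous (b m)) (hbD : ∀ m x, |b m x| ≤ D)
    (hb₀ : ∀ x, Tendsto (fun m => b m x) atTop (𝓝 (b₀ x))) (hbK : ∀ m x, x ∉ K → b m x = 0)
    (hid : ∀ m, ∫ x in U, g m x * fderiv ℝ η x v = -∫ x in U, b m x * inner ℝ v (G x)) :
    ∫ x in U, g₀ x * fderiv ℝ η x v = -∫ x in U, b₀ x * inner ℝ v (G x) := by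
  have hη1 : ContDiff ℝ 1 η := hη.1.of_le (by exact_mod_cast le_top)
  have hL1 : Tendsto (fun m => ∫ x in U, g m x * fderiv ℝ η x v) atTop
      (𝓝 (∫ x in U, g₀ x * fderiv ℝ η x v)) := by
    have hcη : Continuous (fun x => fderiv ℝ η x v) :=
      (hη1.continuous_fderiv one_ne_zero).clm_apply continuous_const
    refine tendsto_integral_of_dominated_convergence (fun x => C * |fderiv ℝ η x v|) (fun m => ?_)
      ?_ (fun m => ae_of_all _ fun x => ?_) (ae_of_all _ fun x => ?_)
    · exact ((hg m).mul hcη).aestronglyMeasurable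
    · exact ((hcη.abs.integrable_of_hasCompactSupport
        ((hη.2.1.fderiv_apply ℝ v).comp_left abs_zero)).const_mul C).integrableOn
    · rw [norm_mul]
      exact mul_le_mul_of_nonneg_right (hgC m x) (norm_nonneg _)
    · exact (hg₀ x).mul_const _
  have hL2 : Tendsto (fun m => ∫ x in U, b m x * inner ℝ v (G x)) atTop
      (𝓝 (∫ x in U, b₀ x * inner ℝ v (G x))) := by
    have e : ∀ c : E n → ℝ, (∀ x, x ∉ K → c x = 0) → ∫ x in U, c x * inner ℝ v (G x) =
        ∫ x in K, c x * inner ℝ v (G x) := fun c hc =>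
      setIntegral_eq_of_subset_of_forall_sdiff_eq_zero hU.measurableSet hKU fun x hx => by
        rw [hc x hx.2, zero_mul]
    have hb₀K : ∀ x, x ∉ K → b₀ x = 0 := fun x hx =>
      tendsto_nhds_unique (hb₀ x) (tendsto_const_nhds.congr fun m => (hbK m x hx).symm)
    rw [e b₀ hb₀K]
    simp only [fun m => e (b m) (hbK m)]
    refine tendsto_integral_of_dominated_convergence (fun x => D * (‖v‖ * ‖G x‖))
      (fun m => ?_) ?_ (fun m => ae_of_all _ fun x => ?_) (ae_of_all _ fun x => ?_)
    · exact (hb m).aestronglyMeasurable.mul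
        (aestronglyMeasurable_const.inner hGK.aestronglyMeasurable)
    · exact (hGK.norm.const_mul _).const_mul _
    · rw [norm_mul]
      exact mul_le_mul (hbD m x) (norm_inner_le_norm _ _) (norm_nonneg _)
        ((abs_nonneg _).trans (hbD m x))
    · exact (hb₀ x).mul_const _
  exact tendsto_nhds_unique hL1 (hL2.neg.congr fun m => (hid m).symm)

/-- Chain rule for continuous weakly differentiable functions. -/
theorem HasWeakGradient.comp_contDiff {U : Set (E n)} (hU : IsOpen U) {f : E n → ℝ}
    {G : E n → E n} (h : HasWeakGradient U f G) (hfc : ContinuousOn f U) {ψ : ℝ → ℝ}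
    (hψ : ContDiff ℝ ((⊤ : ℕ∞) : WithTop ℕ∞) ψ) :
    HasWeakGradient U (fun x => ψ (f x)) (fun x => deriv ψ (f x) • G x) := by
  have hψ' : ContDiff ℝ ((⊤ : ℕ∞) : WithTop ℕ∞) (deriv ψ) := by
    have := (contDiff_infty_iff_deriv (f := ψ)).1 hψ
    exact this.2
  have hcψ : ContinuousOn (fun x => ψ (f x)) U := hψ.continuous.comp_continuousOn hfc
  refine hasWeakGradient_of_integral_mul_fderiv hU
    (hcψ.locallyIntegrableOn hU.measurableSet)
    (h.2.1.continuousOn_smul hU.isLocallyClosed (hψ'.continuous.comp_continuousOn hfc))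
    fun η hη v => ?_
  have hη1 : ContDiff ℝ 1 η := hη.1.of_le (by exact_mod_cast le_top)
  obtain ⟨χ, hχ, V, hVo, hKV, hVU, hχ1⟩ := exists_isTest_eq_one_nhds hU hη.2.1 hη.2.2
  obtain ⟨δ, hδ, hδV⟩ := IsCompact.exists_cthickening_subset_open hη.2.1 hVo hKV
  set K' := Metric.cthickening δ (tsupport η) with hK'
  have hK'c : IsCompact K' := IsCompact.cthickening hη.2.1
  have hK'U : K' ⊆ U := hδV.trans hVU
  have hKK' : tsupport η ⊆ K' := Metric.self_subset_cthickening _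
  -- a continuous compactly supported function which agrees with `f` near the support of `η`
  set F : E n → ℝ := fun x => χ x * f x with hF
  have hFs : tsupport F ⊆ tsupport χ := tsupport_mul_subset_left
  have hFc : Continuous F :=
    (hχ.1.continuous.continuousOn.mul hfc).continuous_of_tsupport_subset hU (hFs.trans hχ.2.2)
  have hFcs : HasCompactSupport F := hχ.2.1.of_isClosed_subset (isClosed_tsupport F) hFs
  have hFf : ∀ x ∈ K', F x = f x := fun x hx => by
    simp only [hF]
    rw [hχ1 x (hδV hx), one_mul]
  obtain ⟨M, hM⟩ := hFcs.exists_bound_of_continuous hFc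
  obtain ⟨C₀, hC₀⟩ := (isCompact_Icc (a := -M) (b := M)).exists_bound_of_continuousOn
    hψ.continuous.continuousOn
  obtain ⟨C₁, hC₁⟩ := (isCompact_Icc (a := -M) (b := M)).exists_bound_of_continuousOn
    hψ'.continuous.continuousOn
  obtain ⟨D, hD⟩ := hη.exists_bound
  obtain ⟨ρ, hρ, hρδ⟩ := exists_bump_seq (n := n) hδ
  set f' : ℕ → E n → ℝ := fun m => mollify (ρ m) F with hf'
  have hf'M : ∀ m x, f' m x ∈ Icc (-M) M := fun m x =>
    abs_le.1 (abs_mollify_le (ρ m) hFc hM x)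
  have hf's : ∀ m, ContDiff ℝ ((⊤ : ℕ∞) : WithTop ℕ∞) (f' m) := fun m => contDiff_mollify _ hFc
  set a : ℕ → E n → ℝ := fun m x => η x * deriv ψ (f' m x) with ha
  have has : ∀ m, ContDiff ℝ ((⊤ : ℕ∞) : WithTop ℕ∞) (a m) := fun m =>
    hη.1.mul (hψ'.comp (hf's m))
  have hats : ∀ m, tsupport (a m) ⊆ tsupport η := fun m => tsupport_mul_subset_left
  -- The radii are at most `δ`, so these functions live in `K'` and are test functions in `U`; they
  -- can be inserted into the hypothesis on `f`.
  set b : ℕ → E n → ℝ := fun m => mollify (ρ m) (a m) with hb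
  have hb0 : ∀ m x, x ∉ K' → b m x = 0 := fun m x hx => by
    refine mollify_eq_zero _ fun y hy => ?_
    refine image_eq_zero_of_notMem_tsupport fun hy' => hx ?_
    refine Metric.mem_cthickening_of_dist_le x y δ _ (hats m hy') ?_
    rw [dist_comm]
    exact (le_of_lt hy).trans (hρδ m)
  have hbts : ∀ m, tsupport (b m) ⊆ K' := fun m =>
    closure_minimal (fun x hx => by_contra fun hx' => hx (hb0 m x hx')) hK'c.isClosed
  have hbt : ∀ m, IsTest U (b m) := fun m =>
    ⟨contDiff_mollify _ (has m).continuous,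
      hK'c.of_isClosed_subset (isClosed_tsupport _) (hbts m), (hbts m).trans hK'U⟩
  have hC : ∀ m x, |a m x| ≤ D * C₁ := fun m x => by
    simp only [ha, abs_mul]
    exact mul_le_mul (hD x) (hC₁ _ (hf'M m x)) (abs_nonneg _) ((norm_nonneg _).trans (hD x))
  have hbC : ∀ m x, |b m x| ≤ D * C₁ := fun m x =>
    abs_mollify_le (ρ m) (has m).continuous (hC m) x
  -- the identity for the mollified functions
  have hid : ∀ m, ∫ x in U, ψ (f' m x) * fderiv ℝ η x v =
      -∫ x in U, b m x * inner ℝ v (G x) := by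
    intro m
    have e1 : ∫ x in U, ψ (f' m x) * fderiv ℝ η x v = ∫ x, ψ (f' m x) * fderiv ℝ η x v := by
      refine setIntegral_eq_integral_of_forall_compl_eq_zero fun x hx => ?_
      rw [← inner_gradient, gradient_eq_zero_of_notMem fun h' => hx (hη.2.2 h'),
        inner_zero_right, mul_zero]
    have e2 : ∫ x, ψ (f' m x) * fderiv ℝ η x v = ∫ x, F x * fderiv ℝ (b m) x v :=
      integral_comp_mollify_mul_fderiv (ρ m) hFc hψ hη v
    have e5 : ∫ x, F x * fderiv ℝ (b m) x v = ∫ x in U, f x * fderiv ℝ (b m) x v := by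
      have h0 : ∀ x, x ∉ K' → fderiv ℝ (b m) x v = 0 := fun x hx => by
        rw [← inner_gradient, gradient_eq_zero_of_notMem fun h' => hx (hbts m h'),
          inner_zero_right]
      rw [← setIntegral_eq_integral_of_forall_compl_eq_zero (s := U)]
      · refine setIntegral_congr_fun hU.measurableSet fun x hx => ?_
        beta_reduce
        by_cases hxK : x ∈ K'
        · rw [hFf x hxK]
        · rw [h0 x hxK, mul_zero, mul_zero]
      · intro x hx
        rw [h0 x fun h' => hx (hK'U h'), mul_zero]
    rw [e1, e2, e5, h.integral_mul_fderiv hU (hbt m) v]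
  -- passage to the limit
  have hlimf : ∀ x, Tendsto (fun z : ℕ × E n => f' z.1 z.2) (atTop ×ˢ 𝓝 x) (𝓝 (F x)) :=
    fun x => tendsto_mollify hρ hFc x
  have hlimf' : ∀ x, Tendsto (fun m => f' m x) atTop (𝓝 (F x)) := fun x =>
    Tendsto.comp (g := fun z : ℕ × E n => f' z.1 z.2) (f := fun m => (m, x)) (hlimf x)
      (tendsto_id.prodMk tendsto_const_nhds)
  have hlimb : ∀ x, Tendsto (fun m => b m x) atTop (𝓝 (η x * deriv ψ (F x))) := by
    intro x
    refine ContDiffBump.convolution_tendsto_right (φ := ρ) (g := a) (k := fun _ => x) hρ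
      (Eventually.of_forall fun m => (has m).continuous.aestronglyMeasurable) ?_ tendsto_const_nhds
    exact ((hη.1.continuous.tendsto x).comp tendsto_snd).mul
      ((hψ'.continuous.tendsto (F x)).comp (hlimf x))
  have hGK : IntegrableOn G K' := h.2.1.integrableOn_compact_subset hK'U hK'c
  have hfin : ∫ x in U, ψ (F x) * fderiv ℝ η x v =
      -∫ x in U, (η x * deriv ψ (F x)) * inner ℝ v (G x) :=
    integral_mul_fderiv_of_tendsto (g := fun m x => ψ (f' m x)) hU hK'U hGK hη v
      (fun m => hψ.continuous.comp (hf's m).continuous) (fun m x => hC₀ _ (hf'M m x))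
      (fun x => (hψ.continuous.tendsto _).comp (hlimf' x)) (fun m => (hbt m).1.continuous) hbC
      hlimb hb0 hid
  have e2 : ∫ x in U, η x * inner ℝ v (deriv ψ (f x) • G x) =
      ∫ x in U, η x * deriv ψ (F x) * inner ℝ v (G x) := by
    refine setIntegral_congr_fun hU.measurableSet fun x hx => ?_
    beta_reduce
    by_cases hxK : x ∈ K'
    · rw [hFf x hxK, inner_smul_right, mul_assoc]
    · rw [image_eq_zero_of_notMem_tsupport fun h' => hxK (hKK' h'), zero_mul, zero_mul, zero_mul]
  rw [e2, ← hfin]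
  refine setIntegral_congr_fun hU.measurableSet fun x hx => ?_
  beta_reduce
  by_cases hxK : x ∈ K'
  · rw [hFf x hxK]
  · rw [← inner_gradient, gradient_eq_zero_of_notMem fun h' => hxK (hKK' h'), inner_zero_right,
      mul_zero, mul_zero]

/-! ### Tools for the comparison principle -/

theorem IsTest.mono {U D : Set (E n)} (hDU : D ⊆ U) {φ : E n → ℝ} (hφ : IsTest D φ) :
    IsTest U φ := ⟨hφ.1, hφ.2.1, hφ.2.2.trans hDU⟩

theorem HasWeakGradient.mono {U D : Set (E n)} (hU : IsOpen U) (hDU : D ⊆ U)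
    {f : E n → ℝ} {G : E n → E n} (h : HasWeakGradient U f G) : HasWeakGradient D f G := by
  refine ⟨h.1.mono_set hDU, h.2.1.mono_set hDU, fun φ hφ => ?_⟩
  have h1 := h.2.2 φ (hφ.mono hDU)
  rwa [setIntegral_eq_of_subset_of_forall_sdiff_eq_zero hU.measurableSet hDU fun x hx => by
      rw [gradient_eq_zero_of_notMem fun h' => hx.2 (hφ.2.2 h'), smul_zero],
    setIntegral_eq_of_subset_of_forall_sdiff_eq_zero hU.measurableSet hDU fun x hx => by
      rw [hφ.eq_zero_of_notMem hx.2, zero_smul]] at h1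

theorem HasWeakGradient.sub {U : Set (E n)} (hU : IsOpen U) {f f' : E n → ℝ}
    {G G' : E n → E n} (h : HasWeakGradient U f G) (h' : HasWeakGradient U f' G') :
    HasWeakGradient U (fun x => f x - f' x) (fun x => G x - G' x) := by
  refine ⟨h.1.sub h'.1, h.2.1.sub h'.2.1, fun φ hφ => ?_⟩
  simp only [sub_smul, smul_sub]
  rw [integral_sub (hφ.integrableOn_smul_gradient hU h.1) (hφ.integrableOn_smul_gradient hU h'.1),
    integral_sub (hφ.integrableOn_smul hU h.2.1) (hφ.integrableOn_smul hU h'.2.1),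
    h.2.2 φ hφ, h'.2.2 φ hφ]
  abel

/-- Integration by parts against a multiple of the position vector field. -/
theorem HasWeakGradient.integral_mul_inner_self {D : Set (E n)} (hD : IsOpen D) {φ : E n → ℝ}
    {Φ : E n → E n} (h : HasWeakGradient D φ Φ) {K : Set (E n)} (hK : IsCompact K) (hKD : K ⊆ D)
    (hφ : ∀ x ∈ D \ K, φ x = 0) (hΦ : ∀ x ∈ D \ K, Φ x = 0) {g : E n → ℝ}
    (hg : ContDiff ℝ ((⊤ : ℕ∞) : WithTop ℕ∞) g) :
    ∫ x in D, g x * inner ℝ x (Φ x) = -∫ x in D, φ x * (n * g x + fderiv ℝ g x x) := by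
  obtain ⟨χ, hχ, V, hVo, hKV, hVD, hχ1⟩ := exists_isTest_eq_one_nhds hD hK hKD
  have hcoord : ∀ i : Fin n, ContDiff ℝ ((⊤ : ℕ∞) : WithTop ℕ∞) (fun x : E n => x i) := fun i =>
    (EuclideanSpace.proj (𝕜 := ℝ) i : E n →L[ℝ] ℝ).contDiff
  -- Testing with `χ g x_i` in the direction `e_i` and summing over `i` produces the divergence `n g
  -- + x · ∇g` of `g x`.
  have htest : ∀ i : Fin n, IsTest D (fun x : E n => χ x * (g x * x i)) := fun i =>
    ⟨hχ.1.mul (hg.mul (hcoord i)),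
      hχ.2.1.of_isClosed_subset (isClosed_tsupport _) tsupport_mul_subset_left,
      tsupport_mul_subset_left.trans hχ.2.2⟩
  have hgd : Differentiable ℝ g := hg.differentiable (by simp)
  have hfd : ∀ (i : Fin n) (x : E n), x ∈ K →
      fderiv ℝ (fun x : E n => χ x * (g x * x i)) x (EuclideanSpace.single i 1) =
        g x + x i * fderiv ℝ g x (EuclideanSpace.single i 1) := by
    intro i x hx
    have h1 : HasFDerivAt (fun x : E n => g x * x i)
        (g x • (EuclideanSpace.proj (𝕜 := ℝ) i : E n →L[ℝ] ℝ) + x i • fderiv ℝ g x) x :=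
      (hgd x).hasFDerivAt.mul (EuclideanSpace.proj (𝕜 := ℝ) i : E n →L[ℝ] ℝ).hasFDerivAt
    have h2 : (fun x : E n => χ x * (g x * x i)) =ᶠ[𝓝 x] fun x : E n => g x * x i := by
      filter_upwards [hVo.mem_nhds (hKV hx)] with y hy
      rw [hχ1 y hy, one_mul]
    rw [(h1.congr_of_eventuallyEq h2).fderiv]
    simp
  have hid : ∀ i : Fin n, _ := fun i =>
    h.integral_mul_fderiv hD (htest i) (EuclideanSpace.single i 1)
  have hsum := Finset.sum_congr (rfl : (Finset.univ : Finset (Fin n)) = Finset.univ)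
    fun i _ => hid i
  have hsingle : ∀ (i : Fin n) (x : E n), inner ℝ (EuclideanSpace.single i (1 : ℝ)) x = x i := by
    intro i x
    simp [EuclideanSpace.inner_single_left]
  rw [Finset.sum_neg_distrib, ← integral_finsetSum, ← integral_finsetSum] at hsum
  · have e1 : ∫ x in D, ∑ i, φ x * fderiv ℝ (fun x : E n => χ x * (g x * x i)) x
        (EuclideanSpace.single i 1) = ∫ x in D, φ x * (n * g x + fderiv ℝ g x x) := by
      refine setIntegral_congr_fun hD.measurableSet fun x hx => ?_
      beta_reduce
      by_cases hxK : x ∈ K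
      · rw [← Finset.mul_sum, Finset.sum_congr rfl fun i _ => hfd i x hxK, Finset.sum_add_distrib]
        congr 2
        · simp
        · have hx' : x = ∑ i, x i • EuclideanSpace.single i (1 : ℝ) := by
            have := (EuclideanSpace.basisFun (Fin n) ℝ).sum_repr x
            simpa using this.symm
          conv_rhs => rw [hx', map_sum]
          rw [← hx']
          simp
      · simp [hφ x ⟨hx, hxK⟩]
    have e2 : ∫ x in D, ∑ i, χ x * (g x * x i) * inner ℝ (EuclideanSpace.single i (1 : ℝ)) (Φ x) =
        ∫ x in D, g x * inner ℝ x (Φ x) := by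
      refine setIntegral_congr_fun hD.measurableSet fun x hx => ?_
      beta_reduce
      by_cases hxK : x ∈ K
      · simp only [hsingle, hχ1 x (hKV hxK), one_mul, PiLp.inner_apply, Finset.mul_sum]
        refine Finset.sum_congr rfl fun i _ => ?_
        simp
        ring
      · simp [hΦ x ⟨hx, hxK⟩]
    rw [e1, e2] at hsum
    linarith
  · intro i _
    have := ((htest i).integrableOn_smul hD h.2.1).const_inner (𝕜 := ℝ)
      (EuclideanSpace.single i (1 : ℝ))
    simpa only [inner_smul_right] using this
  · intro i _
    have := ((htest i).integrableOn_smul_gradient hD h.1).const_inner (𝕜 := ℝ)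
      (EuclideanSpace.single i (1 : ℝ))
    simpa only [inner_smul_right, inner_gradient] using this

/-- A compactly supported continuous nonnegative function with vanishing gradient vanishes. -/
theorem HasWeakGradient.eq_zero_of_ae_eq_zero (hn : 0 < n) {D : Set (E n)} (hD : IsOpen D)
    {φ : E n → ℝ} {Φ : E n → E n} (h : HasWeakGradient D φ Φ) {K : Set (E n)} (hK : IsCompact K)
    (hKD : K ⊆ D) (hφ : ∀ x ∈ D \ K, φ x = 0) (hΦ : ∀ x ∈ D \ K, Φ x = 0)
    (hφc : ContinuousOn φ D) (hφ0 : ∀ x ∈ D, 0 ≤ φ x)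
    (hae : ∀ᵐ x ∂(volume.restrict D), Φ x = 0) : ∀ x ∈ D, φ x = 0 := by
  -- The field `x` has constant divergence `n`, so a vanishing gradient gives `n ∫ φ = 0`.
  have h1 := h.integral_mul_inner_self hD hK hKD hφ hΦ (g := fun _ => 1) contDiff_const
  have h2 : ∫ x in D, 1 * inner ℝ x (Φ x) = 0 := by
    refine integral_eq_zero_of_ae ?_
    filter_upwards [hae] with x hx
    simp [hx]
  simp only [h2, fderiv_fun_const, Pi.zero_apply, zero_apply, add_zero, mul_one] at h1
  rw [integral_mul_const, eq_comm, neg_eq_zero, mul_eq_zero] at h1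
  have h3 : ∫ x in D, φ x = 0 := h1.resolve_right (by exact_mod_cast hn.ne')
  have hint : IntegrableOn φ D :=
    (h.1.integrableOn_compact_subset hKD hK).of_forall_sdiff_eq_zero hD.measurableSet hφ
  rw [setIntegral_eq_zero_iff_of_nonneg_ae
    ((ae_restrict_iff' hD.measurableSet).2 (ae_of_all _ hφ0)) hint] at h3
  exact Measure.eqOn_open_of_ae_eq h3 hD hφc continuousOn_const

theorem fderiv_regularized {ε : ℝ} (hε : 0 < ε) (α : ℝ) (x : E n) :
    fderiv ℝ (fun x : E n => (‖x‖ ^ 2 + ε) ^ α) x x =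
      2 * α * ‖x‖ ^ 2 * (‖x‖ ^ 2 + ε) ^ (α - 1) := by
  have hpos : 0 < ‖x‖ ^ 2 + ε := by positivity
  have h1 : HasFDerivAt (fun x : E n => ‖x‖ ^ 2 + ε) (2 • innerSL ℝ x) x :=
    ((hasStrictFDerivAt_norm_sq x).hasFDerivAt).add_const ε
  rw [(h1.rpow_const (Or.inl hpos.ne')).fderiv]
  simp
  ring

/-- The field `x |x|^{-n}`, whose divergence is nonnegative, pairs nonpositively with the gradients
of compactly supported nonnegative functions. -/
theorem HasWeakGradient.integral_inner_newton_nonpos {D : Set (E n)} (hD : IsOpen D) {φ : E n → ℝ}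
    {Φ : E n → E n} (h : HasWeakGradient D φ Φ) {K : Set (E n)} (hK : IsCompact K) (hKD : K ⊆ D)
    (hφ : ∀ x ∈ D \ K, φ x = 0) (hΦ : ∀ x ∈ D \ K, Φ x = 0) (hφ0 : ∀ x ∈ D, 0 ≤ φ x)
    (hint : IntegrableOn (fun x => (‖x‖ ^ n)⁻¹ * ‖x‖ * ‖Φ x‖) D) :
    ∫ x in D, (‖x‖ ^ n)⁻¹ * inner ℝ x (Φ x) ≤ 0 := by
  -- The regularized field `x(|x|² + ε)^{-n/2}` is smooth through the origin. Its divergence `n ε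
  -- (|x|² + ε)^{-n/2-1}` is positive, and the field is dominated by `|x|^{1-n}` as `ε → 0`.
  have hsm : ∀ ε : ℝ, 0 < ε → ContDiff ℝ ((⊤ : ℕ∞) : WithTop ℕ∞)
      (fun x : E n => (‖x‖ ^ 2 + ε) ^ (-(n : ℝ) / 2)) := fun ε hε =>
    ((contDiff_norm_sq ℝ).add contDiff_const).rpow_const_of_ne fun x => by positivity
  have hle : ∀ ε ∈ Ioi (0 : ℝ),
      ∫ x in D, (‖x‖ ^ 2 + ε) ^ (-(n : ℝ) / 2) * inner ℝ x (Φ x) ≤ 0 := by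
    intro ε hε
    rw [mem_Ioi] at hε
    rw [h.integral_mul_inner_self hD hK hKD hφ hΦ (hsm ε hε), neg_nonpos]
    refine setIntegral_nonneg hD.measurableSet fun x hx => mul_nonneg (hφ0 x hx) ?_
    have hpos : 0 < ‖x‖ ^ 2 + ε := by positivity
    rw [fderiv_regularized hε, Real.rpow_sub_one hpos.ne']
    have : n * (‖x‖ ^ 2 + ε) ^ (-(n : ℝ) / 2) + 2 * (-(n : ℝ) / 2) * ‖x‖ ^ 2 *
        ((‖x‖ ^ 2 + ε) ^ (-(n : ℝ) / 2) / (‖x‖ ^ 2 + ε)) =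
        n * (‖x‖ ^ 2 + ε) ^ (-(n : ℝ) / 2) * (ε / (‖x‖ ^ 2 + ε)) := by
      field_simp
      ring
    rw [this]
    positivity
  have hpow : ∀ x : E n, (‖x‖ ^ 2) ^ (-(n : ℝ) / 2) = (‖x‖ ^ n)⁻¹ := fun x => by
    rw [neg_div, Real.rpow_neg (by positivity), ← Real.rpow_natCast ‖x‖ 2,
      ← Real.rpow_mul (norm_nonneg x), ← Real.rpow_natCast ‖x‖ n]
    congr 2
    push_cast
    ring
  have hΦm : AEStronglyMeasurable Φ (volume.restrict D) := h.2.1.aestronglyMeasurable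
  refine le_of_tendsto (f := fun ε : ℝ => ∫ x in D, (‖x‖ ^ 2 + ε) ^ (-(n : ℝ) / 2) *
    inner ℝ x (Φ x)) (x := 𝓝[>] 0) ?_ (eventually_nhdsWithin_of_forall hle)
  refine tendsto_integral_filter_of_dominated_convergence _ ?_ ?_ hint (ae_of_all _ fun x => ?_)
  · filter_upwards [self_mem_nhdsWithin] with ε hε
    exact (hsm ε hε).continuous.aestronglyMeasurable.mul
      (continuous_id.aestronglyMeasurable.inner hΦm)
  · filter_upwards [self_mem_nhdsWithin] with ε hε
    refine ae_of_all _ fun x => ?_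
    rw [mem_Ioi] at hε
    rcases eq_or_ne x 0 with rfl | hx
    · simp
    have hx0 : 0 < ‖x‖ := norm_pos_iff.2 hx
    rw [norm_mul, Real.norm_of_nonneg (by positivity), mul_assoc]
    refine mul_le_mul ?_ (norm_inner_le_norm _ _) (norm_nonneg _) (by positivity)
    rw [← hpow]
    exact Real.rpow_le_rpow_of_nonpos (by positivity) (by linarith)
      (by have : (0 : ℝ) ≤ n := Nat.cast_nonneg n
          linarith)
  · rcases eq_or_ne x 0 with rfl | hx
    · simp
    have hx0 : 0 < ‖x‖ := norm_pos_iff.2 hx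
    refine Tendsto.mul_const _ ?_
    rw [← hpow]
    have h1 : Tendsto (fun ε : ℝ => ‖x‖ ^ 2 + ε) (𝓝[>] 0) (𝓝 (‖x‖ ^ 2)) := by
      have : Continuous (fun ε : ℝ => ‖x‖ ^ 2 + ε) := by fun_prop
      simpa using (this.tendsto 0).mono_left nhdsWithin_le_nhds
    exact h1.rpow_const (Or.inl (by positivity))

/-- Strict monotonicity of the vector field defining the operator. -/
theorem inner_rpow_smul_sub {p : ℝ} (hp : 1 < p) (a b : E n) :
    0 ≤ inner ℝ (‖a‖ ^ (p - 2) • a - ‖b‖ ^ (p - 2) • b) (a - b) ∧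
      (inner ℝ (‖a‖ ^ (p - 2) • a - ‖b‖ ^ (p - 2) • b) (a - b) = 0 → a = b) := by
  have hmul : ∀ s : ℝ, 0 ≤ s → s ^ (p - 2) * s = s ^ (p - 1) := fun s hs => by
    rw [← Real.rpow_add_one' hs (by linarith)]
    congr 1
    ring
  have hs := norm_nonneg a
  have ht := norm_nonneg b
  have hα : 0 ≤ ‖a‖ ^ (p - 2) := Real.rpow_nonneg hs _
  have hβ : 0 ≤ ‖b‖ ^ (p - 2) := Real.rpow_nonneg ht _
  have hcs : inner ℝ a b ≤ ‖a‖ * ‖b‖ := real_inner_le_norm a b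
  -- Both summands are nonnegative: one by monotonicity of `s ↦ s^{p-1}`, the other by
  -- Cauchy–Schwarz. Vanishing of both gives equal norms and equality in Cauchy–Schwarz.
  have e : inner ℝ (‖a‖ ^ (p - 2) • a - ‖b‖ ^ (p - 2) • b) (a - b) =
      (‖a‖ ^ (p - 1) - ‖b‖ ^ (p - 1)) * (‖a‖ - ‖b‖) +
        (‖a‖ ^ (p - 2) + ‖b‖ ^ (p - 2)) * (‖a‖ * ‖b‖ - inner ℝ a b) := by
    rw [← hmul _ hs, ← hmul _ ht]
    simp only [inner_sub_left, inner_sub_right, real_inner_smul_left, real_inner_self_eq_norm_sq,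
      real_inner_comm a b]
    ring
  have h1 : 0 ≤ (‖a‖ ^ (p - 1) - ‖b‖ ^ (p - 1)) * (‖a‖ - ‖b‖) := by
    rcases le_total ‖a‖ ‖b‖ with hle | hle
    · exact mul_nonneg_of_nonpos_of_nonpos
        (sub_nonpos.2 (Real.rpow_le_rpow hs hle (by linarith))) (sub_nonpos.2 hle)
    · exact mul_nonneg (sub_nonneg.2 (Real.rpow_le_rpow ht hle (by linarith))) (sub_nonneg.2 hle)
  have h2 : 0 ≤ (‖a‖ ^ (p - 2) + ‖b‖ ^ (p - 2)) * (‖a‖ * ‖b‖ - inner ℝ a b) :=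
    mul_nonneg (add_nonneg hα hβ) (sub_nonneg.2 hcs)
  rw [e]
  refine ⟨add_nonneg h1 h2, fun h0 => ?_⟩
  have h3 : (‖a‖ ^ (p - 1) - ‖b‖ ^ (p - 1)) * (‖a‖ - ‖b‖) = 0 := by linarith
  have h4 : (‖a‖ ^ (p - 2) + ‖b‖ ^ (p - 2)) * (‖a‖ * ‖b‖ - inner ℝ a b) = 0 := by linarith
  have hst : ‖a‖ = ‖b‖ := by
    rcases mul_eq_zero.1 h3 with h5 | h5
    · exact (Real.rpow_left_inj hs ht (by linarith)).1 (sub_eq_zero.1 h5)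
    · exact sub_eq_zero.1 h5
  rcases hs.eq_or_lt with h5 | h5
  · have h6 : ‖b‖ = 0 := hst ▸ h5.symm
    rw [norm_eq_zero.1 h5.symm, norm_eq_zero.1 h6]
  · have h6 : 0 < ‖a‖ ^ (p - 2) := Real.rpow_pos_of_pos h5 _
    have h7 : ‖a‖ * ‖b‖ - inner ℝ a b = 0 :=
      (mul_eq_zero.1 h4).resolve_left (by positivity)
    have h8 : ‖a - b‖ ^ 2 = 0 := by
      rw [norm_sub_sq_real, ← hst]
      rw [← hst] at h7
      linarith
    exact sub_eq_zero.1 (norm_eq_zero.1 (pow_eq_zero_iff two_ne_zero |>.1 h8))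

/-! ### Superharmonicity of `u` -/

/-- The truncation of `u` at the level `k`. -/
def truncFund (n : ℕ) (P W : ℝ → ℝ) (k : ℝ) (x : E n) : ℝ :=
  (min (fundE n P W x) (ENNReal.ofReal k)).toReal

theorem coe_truncFund_le (k : ℝ) (x : E n) :
    (truncFund n P W k x : EReal) ≤ (fundE n P W x : EReal) := by
  rw [truncFund, EReal.coe_ennreal_toReal (by simp)]
  exact_mod_cast min_le_left _ _

theorem le_truncFund {k t : ℝ} (htk : t ≤ k) {x : E n}
    (ht : (t : EReal) ≤ (fundE n P W x : EReal)) :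
    t ≤ truncFund n P W k x := by
  rcases le_or_gt t 0 with h0 | h0
  · exact h0.trans ENNReal.toReal_nonneg
  · rw [truncFund, ← ENNReal.ofReal_le_iff_le_toReal (by simp)]
    refine le_min ?_ (ENNReal.ofReal_le_ofReal htk)
    have : ((ENNReal.ofReal t : ℝ≥0∞) : EReal) = (t : EReal) := by
      rw [EReal.coe_ennreal_ofReal, max_eq_left h0.le]
    rw [← this] at ht
    exact_mod_cast ht

namespace Admissible

/-- The intervals `(‖a i‖, 1)` exhaust `(0,1)`, so the integrals converge in `[0,∞]` whether `u(0)`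
is finite or not. -/
theorem tendsto_fundE (h : Admissible n P W) {α : Type*} {l : Filter α} [l.IsCountablyGenerated]
    {a : α → E n} (ha : Tendsto (fun i => ‖a i‖) l (𝓝 0)) :
    Tendsto (fun i => fundE n P W (a i)) l (𝓝 (fundE n P W 0)) := by
  have hcov : AECover (volume.restrict (Ioo (0 : ℝ) 1)) l (fun i => Ioo ‖a i‖ 1) :=
    aecover_Ioo_of_Ioo ha tendsto_const_nhds
  have hm : AEMeasurable (fun ρ => ENNReal.ofReal ((W ρ * ρ ^ (n - 1)) ^ (-1 / (P ρ - 1))))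
      (volume.restrict (Ioo (0 : ℝ) 1)) :=
    (h.continuousOn_slope.aemeasurable measurableSet_Ioo).ennreal_ofReal
  have h1 := hcov.lintegral_tendsto_of_countably_generated hm
  rw [fundE, norm_zero]
  refine h1.congr fun i => ?_
  rw [fundE, Measure.restrict_restrict measurableSet_Ioo,
    inter_eq_left.2 (Ioo_subset_Ioo_left (norm_nonneg _))]

theorem continuousOn_fundE (h : Admissible n P W) :
    ContinuousOn (fundE n P W) (unitBall n) := by
  intro x hx
  refine ContinuousAt.continuousWithinAt ?_
  rcases eq_or_ne x 0 with rfl | h0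
  · exact h.tendsto_fundE (tendsto_norm_zero)
  · have h1 : ContinuousAt (fun y : E n => ENNReal.ofReal (profile n P W 0 ‖y‖)) x :=
      ENNReal.continuous_ofReal.continuousAt.comp
        ((h.contDiffOn_profile_norm (by simp)).continuousOn.continuousAt
          (isOpen_punctured.mem_nhds ⟨hx, h0⟩))
    refine h1.congr ?_
    filter_upwards [isOpen_punctured.mem_nhds ⟨hx, h0⟩] with y hy
    exact (h.fundE_eq hy.1 hy.2).symm

/-- Truncating in `[0,∞]` before passing to real values preserves continuity at the origin even when
`u(0) = ∞`. -/
theorem continuousOn_truncFund (h : Admissible n P W) (k : ℝ) :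
    ContinuousOn (truncFund n P W k) (unitBall n) := by
  intro x hx
  refine (ENNReal.tendsto_toReal (by simp)).comp
    ((h.continuousOn_fundE x hx).min continuousWithinAt_const)

theorem truncFund_eq (h : Admissible n P W) {k : ℝ} (hk : 0 ≤ k) {x : E n} (hx : x ∈ unitBall n)
    (h0 : x ≠ 0) : truncFund n P W k x = min (profile n P W 0 ‖x‖) k := by
  have h1 := h.profile_nonneg (r := 0) (by simp) (Ioo_subset_Icc_self (norm_mem_Ioo hx h0))
  rw [truncFund, h.fundE_eq hx h0, ← ENNReal.ofReal_min, ENNReal.toReal_ofReal (le_min h1 hk)]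

theorem hasWeakGradient_truncFund (h : Admissible n P W) {k : ℝ} (hk : 0 ≤ k) :
    HasWeakGradient (unitBall n) (truncFund n P W k) (truncField n P W 0 k) :=
  (h.hasWeakGradient_min_profile_zero k).congr
    (h.ae_eq_of_punctured fun _ hx h0 => (h.truncFund_eq hk hx h0).symm) (ae_eq_refl _)

theorem continuousOn_radial_exp (h : Admissible n P W) : ContinuousOn (radial n P) (unitBall n) :=
  h.continuousOn_exp.comp continuous_norm.continuousOn fun _ hx => norm_mem_Ico hx

theorem continuousOn_radial_weight (h : Admissible n P W) :
    ContinuousOn (radial n W) (unitBall n) :=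
  h.continuousOn_weight.comp continuous_norm.continuousOn fun _ hx => norm_mem_Ico hx

theorem aemeasurable_norm_rpow (h : Admissible n P W) {D : Set (E n)} (hD : MeasurableSet D)
    (hDB : D ⊆ unitBall n) {G : E n → E n} (hG : AEStronglyMeasurable G (volume.restrict D))
    (c : ℝ) : AEMeasurable (fun x => ‖G x‖ ^ (radial n P x - c)) (volume.restrict D) :=
  hG.norm.aemeasurable.pow
    (((h.continuousOn_radial_exp.mono hDB).aemeasurable hD).sub aemeasurable_const)

theorem aestronglyMeasurable_flux (h : Admissible n P W) {D : Set (E n)} (hD : MeasurableSet D)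
    (hDB : D ⊆ unitBall n) {G : E n → E n} (hG : AEStronglyMeasurable G (volume.restrict D)) :
    AEStronglyMeasurable (flux (radial n W) (radial n P) G) (volume.restrict D) :=
  (((h.continuousOn_radial_weight.mono hDB).aemeasurable hD).mul
    (h.aemeasurable_norm_rpow hD hDB hG 2)).aestronglyMeasurable.smul hG

theorem integrableOn_norm_rpow_exp (h : Admissible n P W) {K : Set (E n)} (hK : MeasurableSet K)
    (hKB : K ⊆ unitBall n) {G : E n → E n} (hG : AEStronglyMeasurable G (volume.restrict K))
    (hm : modular (radial n P) K (fun x => ‖G x‖) < ⊤) :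
    IntegrableOn (fun x => ‖G x‖ ^ radial n P x) K := by
  have h1 := h.aemeasurable_norm_rpow hK hKB hG 0
  simp only [sub_zero] at h1
  refine ⟨h1.aestronglyMeasurable, ?_⟩
  rw [hasFiniteIntegral_iff_ofReal (ae_of_all _ fun x => by positivity)]
  simpa only [modular, abs_norm] using hm

theorem norm_flux (h : Admissible n P W) (G : E n → E n) {x : E n} (hx : x ∈ unitBall n) :
    ‖flux (radial n W) (radial n P) G x‖ = W ‖x‖ * ‖G x‖ ^ (P ‖x‖ - 1) := by
  have h1 := h.weight_pos (norm_mem_Ico hx)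
  have h2 := h.exp_gt_one (norm_mem_Ico hx)
  rw [flux, norm_smul, radial, radial, norm_mul, Real.norm_of_nonneg h1.le,
    Real.norm_of_nonneg (by positivity), mul_assoc,
    ← Real.rpow_add_one' (norm_nonneg _) (by linarith)]
  congr 2
  ring

/-- In place of Young's inequality, `s^{p-1} t ≤ s^p + t^p` follows by comparing `s` with `t`,
uniformly in the exponent. -/
theorem integrableOn_norm_flux_mul (h : Admissible n P W) {D K : Set (E n)} (hD : MeasurableSet D)
    (hDB : D ⊆ unitBall n) (hK : MeasurableSet K) (hKD : K ⊆ D) {G Φ : E n → E n}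
    (hG : AEStronglyMeasurable G (volume.restrict D))
    (hΦ : AEStronglyMeasurable Φ (volume.restrict D))
    (hGm : modular (radial n P) K (fun x => ‖G x‖) < ⊤)
    (hΦm : modular (radial n P) K (fun x => ‖Φ x‖) < ⊤) (hΦ0 : ∀ x ∈ D \ K, Φ x = 0) :
    IntegrableOn (fun x => ‖flux (radial n W) (radial n P) G x‖ * ‖Φ x‖) D := by
  have hKB := hKD.trans hDB
  have hGK := hG.mono_measure (Measure.restrict_mono hKD le_rfl)
  have hΦK := hΦ.mono_measure (Measure.restrict_mono hKD le_rfl)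
  obtain ⟨C, hC⟩ := h.weight_bounds
  have h1 := ((h.integrableOn_norm_rpow_exp hK hKB hGK hGm).add
    (h.integrableOn_norm_rpow_exp hK hKB hΦK hΦm)).const_mul C
  have h2 : IntegrableOn (fun x => ‖flux (radial n W) (radial n P) G x‖ * ‖Φ x‖) K := by
    refine Integrable.mono' h1 ((h.aestronglyMeasurable_flux hK hKB hGK).norm.mul hΦK.norm)
      ((ae_restrict_iff' hK).2 (ae_of_all _ fun x hx => ?_))
    have hxB := norm_mem_Ico (hKB hx)
    have hp := h.exp_gt_one hxB
    have hW := hC _ hxB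
    rw [norm_mul, norm_norm, norm_norm, h.norm_flux G (hKB hx), mul_assoc]
    refine mul_le_mul hW.2 ?_ (by positivity) (by linarith)
    have hmul : ∀ s : ℝ, 0 ≤ s → s ^ (P ‖x‖ - 1) * s = s ^ P ‖x‖ := fun s hs => by
      rw [← Real.rpow_add_one' hs (by linarith)]
      congr 1
      ring
    simp only [Pi.add_apply, radial]
    rcases le_total ‖G x‖ ‖Φ x‖ with hle | hle
    · calc ‖G x‖ ^ (P ‖x‖ - 1) * ‖Φ x‖ ≤ ‖Φ x‖ ^ (P ‖x‖ - 1) * ‖Φ x‖ :=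
            mul_le_mul_of_nonneg_right (Real.rpow_le_rpow (norm_nonneg _) hle (by linarith))
              (norm_nonneg _)
        _ = ‖Φ x‖ ^ P ‖x‖ := hmul _ (norm_nonneg _)
        _ ≤ _ := le_add_of_nonneg_left (by positivity)
    · calc ‖G x‖ ^ (P ‖x‖ - 1) * ‖Φ x‖ ≤ ‖G x‖ ^ (P ‖x‖ - 1) * ‖G x‖ :=
            mul_le_mul_of_nonneg_left hle (by positivity)
        _ = ‖G x‖ ^ P ‖x‖ := hmul _ (norm_nonneg _)
        _ ≤ _ := le_add_of_nonneg_right (by positivity)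
  exact h2.of_forall_sdiff_eq_zero hD fun x hx => by rw [hΦ0 x hx, norm_zero, mul_zero]

theorem modular_smul_sub_lt_top (h : Admissible n P W) {K : Set (E n)} (hK : MeasurableSet K)
    (hKB : K ⊆ unitBall n) {G U : E n → E n} {c : E n → ℝ} {C : ℝ} (hc : ∀ x ∈ K, |c x| ≤ C)
    (hU : AEStronglyMeasurable U (volume.restrict K))
    (hGm : modular (radial n P) K (fun x => ‖G x‖) < ⊤)
    (hUm : modular (radial n P) K (fun x => ‖U x‖) < ⊤) :
    modular (radial n P) K (fun x => ‖c x • (G x - U x)‖) < ⊤ := by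
  obtain ⟨p₁, p₂, hp₁, hp⟩ := h.exp_bounds
  set M : ℝ := max (2 * C) 1 with hM
  have hM0 : (0 : ℝ) ≤ M ^ p₂ := by positivity
  have hle : ∀ x ∈ K, ENNReal.ofReal (|‖c x • (G x - U x)‖| ^ radial n P x) ≤
      ENNReal.ofReal (M ^ p₂) * (ENNReal.ofReal (|‖G x‖| ^ radial n P x) +
        ENNReal.ofReal (|‖U x‖| ^ radial n P x)) := by
    intro x hx
    have hpx := hp _ (norm_mem_Ico (hKB hx))
    have hp0 : 0 ≤ P ‖x‖ := by linarith
    simp only [abs_norm, radial]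
    rw [← ENNReal.ofReal_add (by positivity) (by positivity), ← ENNReal.ofReal_mul hM0]
    refine ENNReal.ofReal_le_ofReal ?_
    set m := max ‖G x‖ ‖U x‖ with hm
    have hm0 : 0 ≤ m := (norm_nonneg _).trans (le_max_left _ _)
    have hC0 : 0 ≤ C := (abs_nonneg _).trans (hc x hx)
    have h1 : ‖c x • (G x - U x)‖ ≤ M * m := by
      rw [norm_smul]
      calc ‖c x‖ * ‖G x - U x‖ ≤ C * (m + m) :=
            mul_le_mul (hc x hx) ((norm_sub_le _ _).trans
              (add_le_add (le_max_left _ _) (le_max_right _ _))) (norm_nonneg _) hC0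
        _ = (2 * C) * m := by ring
        _ ≤ M * m := mul_le_mul_of_nonneg_right (le_max_left _ _) hm0
    calc ‖c x • (G x - U x)‖ ^ P ‖x‖ ≤ (M * m) ^ P ‖x‖ :=
          Real.rpow_le_rpow (norm_nonneg _) h1 hp0
      _ = M ^ P ‖x‖ * m ^ P ‖x‖ := Real.mul_rpow (by positivity) hm0
      _ ≤ M ^ p₂ * (‖G x‖ ^ P ‖x‖ + ‖U x‖ ^ P ‖x‖) := by
          refine mul_le_mul (Real.rpow_le_rpow_of_exponent_le (le_max_right _ _) hpx.2) ?_
            (by positivity) hM0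
          rcases max_choice ‖G x‖ ‖U x‖ with h2 | h2
          · rw [hm, h2]
            exact le_add_of_nonneg_right (by positivity)
          · rw [hm, h2]
            exact le_add_of_nonneg_left (by positivity)
  have hmeas := (h.aemeasurable_norm_rpow hK hKB hU 0).ennreal_ofReal
  simp only [sub_zero] at hmeas
  refine lt_of_le_of_lt (setLIntegral_mono' hK hle) ?_
  rw [lintegral_const_mul' _ _ ENNReal.ofReal_ne_top, lintegral_add_right' _ (by
    simpa only [abs_norm] using hmeas)]
  exact ENNReal.mul_lt_top ENNReal.ofReal_lt_top (ENNReal.add_lt_top.2 ⟨hGm, hUm⟩)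

/-- If the growth is at least `1`, the truncated gradient vanishes near the origin and is bounded
elsewhere. If it is below `1`, split `s^p = s · s^{p-1}`: the flux identity bounds the second factor
by `|x|^{-(n-1)}`, and the total exponent `n - 1 + β` stays below `n`. -/
theorem modular_truncField_lt_top (h : Admissible n P W) (k : ℝ) {K : Set (E n)}
    (hKB : K ⊆ unitBall n) :
    modular (radial n P) K (fun x => ‖truncField n P W 0 k x‖) < ⊤ := by
  have := h.nontrivial
  rcases le_or_gt 1 (growth n P) with hβ | hβ
  · obtain ⟨r, hr, hk⟩ := h.exists_lt_profile hβ k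
    obtain ⟨C, hC⟩ := h.slope_max_le_const hr
    refine h.modular_lt_top_of_bounded hKB (C := max C 0) (h.ae_punctured fun x hx h0 => ?_)
    have hx' := norm_mem_Ioo hx h0
    rw [abs_norm]
    rcases lt_or_ge ‖x‖ r with hlt | hge
    · rw [truncField_of_le, norm_zero]
      · exact le_max_right _ _
      · exact hk.le.trans (h.profile_strictAnti (by simp) hx'.1.le (lt_max_of_lt_left hx'.1)
          hlt hr.2.le).le
    · refine (norm_indicator_le_norm_self _ _).trans ?_
      rw [h.norm_radialField (by simp) hx h0, max_eq_left hx'.1.le]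
      have := hC _ hx'
      rw [max_eq_left hge] at this
      exact this.trans (le_max_left _ _)
  · obtain ⟨c, hc, hb⟩ := h.slope_bounds
    have hint : IntegrableOn (fun x : E n => c * ‖x‖ ^ (-((n : ℝ) - 1 + growth n P)))
        (unitBall n) := (integrableOn_norm_rpow (by linarith)).const_mul c
    refine lt_of_le_of_lt (lintegral_mono_set hKB) ?_
    refine lt_of_le_of_lt (lintegral_mono_ae ?_) hint.lintegral_lt_top
    refine h.ae_punctured fun x hx h0 => ENNReal.ofReal_le_ofReal ?_
    have hx' := norm_mem_Ioo hx h0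
    have hp := h.exp_gt_one (norm_mem_Ico hx)
    have hs := h.slope_pos hx'
    obtain ⟨C, hC⟩ := h.weight_bounds
    have hW := (hC _ (norm_mem_Ico hx)).1
    have hle : ‖truncField n P W 0 k x‖ ≤ slope n P W ‖x‖ := by
      refine (norm_indicator_le_norm_self _ _).trans ?_
      rw [h.norm_radialField (by simp) hx h0, max_eq_left hx'.1.le]
    have hpow : ‖x‖ ^ (n - 1) = ‖x‖ ^ ((n : ℝ) - 1) := by
      rw [← Real.rpow_natCast, Nat.cast_sub (by have := h.two_le; omega), Nat.cast_one]
    have hpp : 0 < ‖x‖ ^ (n - 1) := pow_pos hx'.1 _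
    rw [abs_norm, radial]
    calc ‖truncField n P W 0 k x‖ ^ P ‖x‖ ≤ slope n P W ‖x‖ ^ P ‖x‖ :=
          Real.rpow_le_rpow (norm_nonneg _) hle (by linarith)
      _ = slope n P W ‖x‖ * slope n P W ‖x‖ ^ (P ‖x‖ - 1) := by
          rw [mul_comm, ← Real.rpow_add_one hs.ne']
          congr 1
          ring
      _ ≤ c * ‖x‖ ^ (-growth n P) * (‖x‖ ^ (n - 1))⁻¹ := by
          refine mul_le_mul (hb _ hx').2 ?_ (by positivity) ?_
          · rw [h.slope_rpow hx']
            exact inv_anti₀ hpp (le_mul_of_one_le_left hpp.le hW)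
          · exact mul_nonneg (by linarith) (Real.rpow_nonneg hx'.1.le _)
      _ = c * ‖x‖ ^ (-((n : ℝ) - 1 + growth n P)) := by
          rw [hpow, ← Real.rpow_neg hx'.1.le, mul_assoc, ← Real.rpow_add hx'.1]
          congr 2
          ring

end Admissible

/-- A smooth nondecreasing function with values in `[0, 1]` vanishing exactly on `(-∞, ε]`. -/
def cutoff (ε t : ℝ) : ℝ := Real.smoothTransition (t - ε)

theorem contDiff_cutoff (ε : ℝ) : ContDiff ℝ ((⊤ : ℕ∞) : WithTop ℕ∞) (cutoff ε) :=
  Real.smoothTransition.contDiff.comp (contDiff_id.sub contDiff_const)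

theorem deriv_cutoff_nonneg (ε t : ℝ) : 0 ≤ deriv (cutoff ε) t :=
  Monotone.deriv_nonneg fun _ _ hst =>
    Real.smoothTransition.monotone (sub_le_sub_right hst ε)

theorem cutoff_eq_zero {ε t : ℝ} (ht : t ≤ ε) : cutoff ε t = 0 :=
  Real.smoothTransition.zero_of_nonpos (by linarith)

theorem deriv_cutoff_eq_zero {ε t : ℝ} (ht : t < ε) : deriv (cutoff ε) t = 0 := by
  have : cutoff ε =ᶠ[𝓝 t] fun _ => 0 := by
    filter_upwards [gt_mem_nhds ht] with s hs using cutoff_eq_zero hs.le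
  rw [this.deriv_eq, deriv_const]

namespace Admissible

/-- The test function is a cutoff of `v - min(u,k)`. The flux of `v` pairs to zero with its
gradient, the flux of the truncation pairs nonnegatively, and monotonicity makes the difference of
the integrands nonnegative. Hence that difference vanishes almost everywhere, and so do the gradient
of the cutoff and the cutoff itself. -/
theorem sub_truncFund_le (h : Admissible n P W) {D : Set (E n)} (hD : IsOpen D)
    (hDc : IsCompact (closure D)) (hDB : closure D ⊆ unitBall n) {v : E n → ℝ}
    (hv : ContinuousOn v (closure D)) (hsol : IsWeakSolution (radial n W) (radial n P) D v)
    {k : ℝ} (hk : 0 ≤ k) (hvk : ∀ x ∈ closure D, v x < k)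
    (hfr : ∀ x ∈ frontier D, v x ≤ truncFund n P W k x) {ε : ℝ} (hε : 0 < ε) :
    ∀ x ∈ D, v x - truncFund n P W k x ≤ ε := by
  have hn : 0 < n := by have := h.two_le; omega
  have hDB' : D ⊆ unitBall n := subset_closure.trans hDB
  obtain ⟨H, ⟨hH, hHm⟩, htest⟩ := hsol
  set U := truncField n P W 0 k with hU
  set f : E n → ℝ := fun x => v x - truncFund n P W k x with hf
  have hfc : ContinuousOn f (closure D) := hv.sub ((h.continuousOn_truncFund k).mono hDB)
  have hTU := (h.hasWeakGradient_truncFund hk).mono Metric.isOpen_ball hDB'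
  have hfG : HasWeakGradient D f (fun x => H x - U x) := hH.sub hD hTU
  set φ : E n → ℝ := fun x => cutoff ε (f x) with hφ
  set Φ : E n → E n := fun x => deriv (cutoff ε) (f x) • (H x - U x) with hΦ
  have hφΦ : HasWeakGradient D φ Φ :=
    hfG.comp_contDiff hD (hfc.mono subset_closure) (contDiff_cutoff ε)
  -- The boundary inequality keeps this closed set off the frontier, so the cutoff has compact
  -- support in `D`; the gap `ε` is what makes this possible.
  set K : Set (E n) := closure D ∩ f ⁻¹' Ici ε with hK
  have hKcl : IsClosed K := hfc.preimage_isClosed_of_isClosed isClosed_closure isClosed_Ici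
  have hKc : IsCompact K := hDc.of_isClosed_subset hKcl inter_subset_left
  have hKD : K ⊆ D := by
    intro x hx
    by_contra hxD
    have hxf : x ∈ frontier D := ⟨hx.1, by rwa [hD.interior_eq]⟩
    have h1 := hfr x hxf
    have h2 : ε ≤ v x - truncFund n P W k x := hx.2
    linarith
  have hlt : ∀ x ∈ D \ K, f x < ε := fun x hx =>
    not_le.1 fun h' => hx.2 ⟨subset_closure hx.1, h'⟩
  have hφ0 : ∀ x ∈ D \ K, φ x = 0 := fun x hx => cutoff_eq_zero (hlt x hx).le
  have hΦ0 : ∀ x ∈ D \ K, Φ x = 0 := fun x hx => by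
    simp only [hΦ]
    rw [deriv_cutoff_eq_zero (hlt x hx), zero_smul]
  -- where `Φ` does not vanish, the truncated field is the gradient of `u`
  have hUR : ∀ x ∈ K, x ≠ 0 → U x = radialField n P W 0 x := by
    intro x hx h0
    refine truncField_of_lt (hDB hx.1) h0 ?_
    have h1 := h.truncFund_eq hk (hDB hx.1) h0
    have h2 := hvk x hx.1
    have h3 : ε ≤ v x - truncFund n P W k x := hx.2
    have h4 : truncFund n P W k x < k := by linarith
    rw [h1] at h4
    exact (min_lt_iff.1 h4).resolve_right (lt_irrefl _)
  have hψ' : Continuous (deriv (cutoff ε)) :=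
    (contDiff_cutoff ε).continuous_deriv (by exact_mod_cast le_top)
  obtain ⟨C, hC⟩ := hDc.exists_bound_of_continuousOn (hψ'.comp_continuousOn hfc)
  have hUmeas : AEStronglyMeasurable U (volume.restrict D) := hTU.2.1.aestronglyMeasurable
  have hHmeas : AEStronglyMeasurable H (volume.restrict D) := hH.2.1.aestronglyMeasurable
  have hΦmeas : AEStronglyMeasurable Φ (volume.restrict D) := hφΦ.2.1.aestronglyMeasurable
  have hΦm : ∀ L : Set (E n), IsCompact L → L ⊆ D →
      modular (radial n P) L (fun x => ‖Φ x‖) < ⊤ := fun L hL hLD =>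
    h.modular_smul_sub_lt_top hL.measurableSet (hLD.trans hDB')
      (fun x hx => hC x (subset_closure (hLD hx)))
      (hUmeas.mono_measure (Measure.restrict_mono hLD le_rfl)) (hHm L hL hLD).2
      (h.modular_truncField_lt_top k (hLD.trans hDB'))
  have hSob : MemSobolevLoc (radial n P) D φ Φ := by
    refine ⟨hφΦ, fun L hL hLD => ⟨?_, hΦm L hL hLD⟩⟩
    refine h.modular_lt_top_of_bounded (hLD.trans hDB') (C := 1) (ae_of_all _ fun x => ?_)
    exact abs_le.2 ⟨by linarith [show 0 ≤ φ x from Real.smoothTransition.nonneg _],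
      Real.smoothTransition.le_one _⟩
  have hzero := htest φ Φ hSob ⟨K, hKc, hKD, hφ0⟩
  have hiH := h.integrableOn_norm_flux_mul hD.measurableSet hDB' hKc.measurableSet hKD hHmeas
    hΦmeas (hHm K hKc hKD).2 (hΦm K hKc hKD) hΦ0
  have hiU := h.integrableOn_norm_flux_mul hD.measurableSet hDB' hKc.measurableSet hKD hUmeas
    hΦmeas (h.modular_truncField_lt_top k (hKD.trans hDB')) (hΦm K hKc hKD) hΦ0
  have hinner : ∀ {G : E n → E n}, AEStronglyMeasurable G (volume.restrict D) →
      IntegrableOn (fun x => ‖flux (radial n W) (radial n P) G x‖ * ‖Φ x‖) D →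
      IntegrableOn (fun x => inner ℝ (flux (radial n W) (radial n P) G x) (Φ x)) D :=
    fun hG hi => Integrable.mono' hi
      ((h.aestronglyMeasurable_flux hD.measurableSet hDB' hG).inner hΦmeas)
      (ae_of_all _ fun x => norm_inner_le_norm _ _)
  have hD0 : ∀ᵐ x ∂(volume.restrict D), x ∈ D ∧ x ≠ 0 := by
    have h1 : ∀ᵐ x ∂(volume.restrict (unitBall n)), x ≠ 0 :=
      h.ae_punctured fun x _ h0 => h0
    filter_upwards [ae_restrict_mem hD.measurableSet,
      ae_restrict_of_ae_restrict_of_subset hDB' h1] with x hx h0 using ⟨hx, h0⟩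
  have hfluxU : ∀ x ∈ K, x ≠ 0 →
      flux (radial n W) (radial n P) U x = (-(‖x‖ ^ n)⁻¹) • x := by
    intro x hx h0
    have hxB := hDB hx.1
    have hx' := norm_mem_Ioo hxB h0
    rw [h.flux_eq (r := 0) (by simp) hxB h0 (hUR x hx h0), h.fluxProfile_of_le hx' hx'.1.le,
      one_mul, ← mul_inv, ← pow_succ, Nat.sub_add_cancel hn]
  -- The supersolution property of `u`: its flux is minus the Newtonian field, and `D` is allowed to
  -- contain the origin.
  have hpos : 0 ≤ ∫ x in D, inner ℝ (flux (radial n W) (radial n P) U x) (Φ x) := by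
    have e1 : ∫ x in D, inner ℝ (flux (radial n W) (radial n P) U x) (Φ x) =
        -∫ x in D, (‖x‖ ^ n)⁻¹ * inner ℝ x (Φ x) := by
      rw [← integral_neg]
      refine integral_congr_ae ?_
      filter_upwards [hD0] with x hx
      by_cases hxK : x ∈ K
      · rw [hfluxU x hxK hx.2, real_inner_smul_left, neg_mul]
      · simp [hΦ0 x ⟨hx.1, hxK⟩]
    rw [e1, neg_nonneg]
    refine hφΦ.integral_inner_newton_nonpos hD hKc hKD hφ0 hΦ0
      (fun x _ => Real.smoothTransition.nonneg _) (hiU.congr ?_)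
    filter_upwards [hD0] with x hx
    by_cases hxK : x ∈ K
    · rw [hfluxU x hxK hx.2, norm_smul, norm_neg, Real.norm_of_nonneg (by positivity)]
    · simp [hΦ0 x ⟨hx.1, hxK⟩]
  -- the integrand is nonnegative and has a nonpositive integral
  have hmono : ∀ x ∈ D, 0 ≤ inner ℝ (flux (radial n W) (radial n P) H x -
      flux (radial n W) (radial n P) U x) (Φ x) ∧ (inner ℝ (flux (radial n W) (radial n P) H x -
      flux (radial n W) (radial n P) U x) (Φ x) = 0 → Φ x = 0) := by
    intro x hx
    have hxB := norm_mem_Ico (hDB' hx)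
    have hw := h.weight_pos hxB
    obtain ⟨m1, m2⟩ := inner_rpow_smul_sub (h.exp_gt_one hxB) (H x) (U x)
    have e : inner ℝ (flux (radial n W) (radial n P) H x - flux (radial n W) (radial n P) U x)
        (Φ x) = W ‖x‖ * deriv (cutoff ε) (f x) *
          inner ℝ (‖H x‖ ^ (P ‖x‖ - 2) • H x - ‖U x‖ ^ (P ‖x‖ - 2) • U x) (H x - U x) := by
      simp only [flux, radial, hΦ, mul_smul, ← smul_sub, real_inner_smul_left,
        real_inner_smul_right]
      ring
    have hd := deriv_cutoff_nonneg ε (f x)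
    rw [e]
    refine ⟨mul_nonneg (mul_nonneg hw.le hd) m1, fun h0 => ?_⟩
    simp only [hΦ]
    rcases mul_eq_zero.1 h0 with h1 | h1
    · rw [(mul_eq_zero.1 h1).resolve_left hw.ne', zero_smul]
    · rw [m2 h1, sub_self, smul_zero]
  have hΦae : ∀ᵐ x ∂(volume.restrict D), Φ x = 0 := by
    have hint := (hinner hHmeas hiH).sub (hinner hUmeas hiU)
    have h1 : ∫ x in D, inner ℝ (flux (radial n W) (radial n P) H x -
        flux (radial n W) (radial n P) U x) (Φ x) ≤ 0 := by
      simp only [inner_sub_left]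
      rw [integral_sub (hinner hHmeas hiH) (hinner hUmeas hiU), hzero]
      linarith
    have hnn : 0 ≤ᵐ[volume.restrict D] fun x => inner ℝ (flux (radial n W) (radial n P) H x -
        flux (radial n W) (radial n P) U x) (Φ x) :=
      (ae_restrict_iff' hD.measurableSet).2 (ae_of_all _ fun x hx => (hmono x hx).1)
    have h2 := (integral_eq_zero_iff_of_nonneg_ae hnn (hint.congr (ae_of_all _ fun x => by
      simp only [Pi.sub_apply, inner_sub_left]))).1 (le_antisymm h1 (integral_nonneg_of_ae hnn))
    filter_upwards [h2, ae_restrict_mem hD.measurableSet] with x hx hxD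
    exact (hmono x hxD).2 hx
  have hφz := hφΦ.eq_zero_of_ae_eq_zero hn hD hKc hKD hφ0 hΦ0
    ((contDiff_cutoff ε).continuous.comp_continuousOn (hfc.mono subset_closure))
    (fun x _ => Real.smoothTransition.nonneg _) hΦae
  intro x hx
  by_contra hcon
  exact (Real.smoothTransition.pos_of_pos (sub_pos.2 (not_le.1 hcon))).ne' (hφz x hx)

theorem isSuperharmonic_fundE (h : Admissible n P W) :
    IsSuperharmonic (radial n W) (radial n P) (unitBall n)
      (fun x => (fundE n P W x : EReal)) where
  ne_bot x _ := EReal.coe_ennreal_ne_bot _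
  lsc := (continuous_coe_ennreal_ereal.comp_continuousOn
    h.continuousOn_fundE).lowerSemicontinuousOn
  finite_ae := h.ae_punctured fun x hx h0 => by
    simpa using h.fundE_ne_top hx h0
  comparison := by
    intro D hD hDc hDB v hv hsol hfr x hx
    obtain ⟨M, hM⟩ := hDc.exists_bound_of_continuousOn hv
    have hM0 : 0 ≤ M := (norm_nonneg _).trans (hM x (subset_closure hx))
    have hvk : ∀ y ∈ closure D, v y < M + 1 := fun y hy => by
      linarith [(le_abs_self _).trans (hM y hy)]
    -- The level `M + 1` lies strictly above `v` on the closure, so the truncation still dominates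
    -- `v` on the frontier.
    have key : v x ≤ truncFund n P W (M + 1) x := by
      refine le_of_forall_pos_le_add fun ε hε => ?_
      have := h.sub_truncFund_le hD hDc hDB hv hsol (by linarith) hvk (fun y hy =>
        le_truncFund (hvk y (frontier_subset_closure hy)).le (hfr y hy)) hε x hx
      linarith
    exact (EReal.coe_le_coe_iff.2 key).trans (coe_truncFund_le _ _)

/-- Off the origin `v_r = u` for small `r`. At the origin `v_r(0) = u(r) + r s(r)`, with `u(r)` the
value at radius `r`. For growth at least `1` the first term already tends to infinity; for growth
below `1` the second is at most `c r^{1-β} → 0`. -/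
theorem tendsto_capped (h : Admissible n P W) {x : E n} (hx : x ∈ unitBall n) :
    Tendsto (fun r => ((capped n P W r (profile n P W 0 r + r * slope n P W r)
      (slope n P W r) x : ℝ) : EReal)) (𝓝[>] 0) (𝓝 (fundE n P W x : EReal)) := by
  rcases eq_or_ne x 0 with rfl | h0
  · have := h.nontrivial
    obtain ⟨e, he⟩ := exists_norm_eq (E n) (zero_le_one (α := ℝ))
    have hid : Tendsto (fun r : ℝ => r) (𝓝[>] 0) (𝓝 0) := tendsto_id.mono_left nhdsWithin_le_nhds
    have h1 : Tendsto (fun r : ℝ => (fundE n P W (r • e) : EReal)) (𝓝[>] 0)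
        (𝓝 (fundE n P W 0 : EReal)) := by
      refine (continuous_coe_ennreal_ereal.tendsto _).comp (h.tendsto_fundE ?_)
      simpa [norm_smul, he] using hid.norm
    have h2 : ∀ r ∈ Ioo (0 : ℝ) 1, (fundE n P W (r • e) : EReal) = (profile n P W 0 r : ℝ) := by
      intro r hr
      have hnorm : ‖r • e‖ = r := by rw [norm_smul, he, mul_one, Real.norm_of_nonneg hr.1.le]
      have hmem : r • e ∈ unitBall n := by simpa [hnorm] using hr.2
      have hne : r • e ≠ 0 := by
        rw [← norm_ne_zero_iff, hnorm]
        exact hr.1.ne'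
      rw [h.fundE_eq hmem hne, hnorm, EReal.coe_ennreal_ofReal,
        max_eq_left (h.profile_nonneg (by simp) (Ioo_subset_Icc_self hr))]
    have h3 : ∀ r ∈ Ioo (0 : ℝ) 1, capped n P W r (profile n P W 0 r + r * slope n P W r)
        (slope n P W r) (0 : E n) = profile n P W 0 r + r * slope n P W r := by
      intro r hr
      simp [capped, hr.1.le]
    rcases le_or_gt 1 (growth n P) with hβ | hβ
    · have htop : (fundE n P W (0 : E n) : EReal) = ⊤ := by
        rw [EReal.eq_top_iff_forall_lt]
        intro k
        obtain ⟨r, hr, hk⟩ := h.exists_lt_profile hβ k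
        refine lt_of_lt_of_le (EReal.coe_lt_coe_iff.2 hk) ?_
        rw [← h2 r hr]
        have : fundE n P W (r • e) ≤ fundE n P W 0 := by
          refine lintegral_mono_set (Ioo_subset_Ioo_left ?_)
          rw [norm_zero]
          exact norm_nonneg _
        exact_mod_cast this
      rw [htop] at h1 ⊢
      refine tendsto_nhds_top_mono h1 ?_
      filter_upwards [eventually_mem_Ioo] with r hr
      rw [h2 r hr, h3 r hr, EReal.coe_le_coe_iff]
      exact le_add_of_nonneg_right (mul_nonneg hr.1.le (h.slope_pos hr).le)
    · obtain ⟨c, hc, hb⟩ := h.slope_bounds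
      have h4 : Tendsto (fun r => r * slope n P W r) (𝓝[>] 0) (𝓝 0) := by
        have h5 : Tendsto (fun r : ℝ => c * r ^ (1 - growth n P)) (𝓝[>] 0) (𝓝 0) := by
          have h6 : Tendsto (fun r : ℝ => r ^ (1 - growth n P)) (𝓝[>] 0) (𝓝 0) := by
            have := hid.rpow_const (p := 1 - growth n P) (Or.inr (by linarith))
            rwa [Real.zero_rpow (by linarith)] at this
          simpa using h6.const_mul c
        refine squeeze_zero' ?_ ?_ h5
        · filter_upwards [eventually_mem_Ioo] with r hr
          exact mul_nonneg hr.1.le (h.slope_pos hr).le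
        · filter_upwards [eventually_mem_Ioo] with r hr
          refine (mul_le_mul_of_nonneg_left (hb r hr).2 hr.1.le).trans_eq ?_
          rw [sub_eq_add_neg, Real.rpow_add hr.1, Real.rpow_one]
          ring
      have h5 : Tendsto (fun r => ((r * slope n P W r : ℝ) : EReal)) (𝓝[>] 0) (𝓝 0) := by
        exact (continuous_coe_real_ereal.tendsto 0).comp h4
      have h6 := (EReal.continuousAt_add (p := ((fundE n P W (0 : E n) : EReal), 0))
        (Or.inr (by simp)) (Or.inr (by simp))).tendsto.comp (h1.prodMk_nhds h5)
      rw [add_zero] at h6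
      refine h6.congr' ?_
      filter_upwards [eventually_mem_Ioo] with r hr
      rw [h3 r hr, EReal.coe_add, ← h2 r hr]
      rfl
  · refine tendsto_const_nhds.congr' ?_
    filter_upwards [eventually_lt_norm h0] with r hr
    have hx' := norm_mem_Ioo hx h0
    rw [h.capped_eq ⟨hr.1, hr.2.trans hx'.2⟩ hx, profile_eq_of_le hr.1.le hr.2.le hx'.2.le,
      h.fundE_eq hx h0, EReal.coe_ennreal_ofReal,
      max_eq_left (h.profile_nonneg (by simp) (Ioo_subset_Icc_self hx'))]

end Admissible

/-! ### From smooth radial exponents to admissible profiles -/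

/-- Restricting `p` to a line through the origin shows that the even extension of `P` is `C^1`
across `0`. This bounds `P'` near `0` and gives the Lipschitz estimate there. -/
theorem contDiffOn_comp_abs (hn : 2 ≤ n)
    (hP : ContDiffOn ℝ ((⊤ : ℕ∞) : WithTop ℕ∞) (radial n P) (unitBall n)) :
    ContDiffOn ℝ 1 (fun t => P |t|) (Ioo (-1) 1) := by
  have : Nonempty (Fin n) := ⟨⟨0, by omega⟩⟩
  obtain ⟨e, he⟩ := exists_norm_eq (E n) (zero_le_one (α := ℝ))
  have hnorm : ∀ t : ℝ, ‖t • e‖ = |t| := fun t => by rw [norm_smul, he, mul_one, Real.norm_eq_abs]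
  have h1 : ContDiff ℝ 1 (fun t : ℝ => t • e) := contDiff_id.smul contDiff_const
  have h2 := (hP.of_le (m := 1) (by exact_mod_cast le_top)).comp h1.contDiffOn (s := Ioo (-1) 1)
    fun t ht => by
      rw [mem_ball_zero_iff, hnorm, abs_lt]
      exact ht
  refine h2.congr fun t _ => ?_
  simp only [Function.comp_apply, radial, hnorm]

theorem Admissible.of_radial (hn : 2 ≤ n) {p₁ p₂ : ℝ} (hp₁ : 1 < p₁)
    (hP : ∀ ρ ∈ Ico (0 : ℝ) 1, p₁ ≤ P ρ ∧ P ρ ≤ p₂)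
    (hPs : ContDiffOn ℝ ((⊤ : ℕ∞) : WithTop ℕ∞) (radial n P) (unitBall n))
    (hW : W = P ∨ W = fun _ => 1) : Admissible n P W := by
  set Q : ℝ → ℝ := fun t => P |t| with hQ
  have hQd : ContDiffOn ℝ 1 Q (Ioo (-1) 1) := contDiffOn_comp_abs hn hPs
  have hPQ : ∀ t, 0 ≤ t → P t = Q t := fun t ht => by simp only [hQ, abs_of_nonneg ht]
  have hPd : ContDiffOn ℝ 1 P (Ioo 0 1) :=
    (hQd.mono (Ioo_subset_Ioo_left (by norm_num))).congr fun t ht => hPQ t ht.1.le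
  have hPc : ContinuousOn P (Ico 0 1) :=
    (hQd.continuousOn.mono fun t ht => ⟨by linarith [ht.1], ht.2⟩).congr fun t ht => hPQ t ht.1
  have hderiv : ∀ ρ, 0 < ρ → deriv P ρ = deriv Q ρ := fun ρ hρ => by
    refine Filter.EventuallyEq.deriv_eq ?_
    filter_upwards [lt_mem_nhds hρ] with t ht using hPQ t ht.le
  have hQb : ∀ R < (1 : ℝ), ∃ C, ∀ ρ ∈ Icc (0 : ℝ) R, |deriv Q ρ| ≤ C := fun R hR =>
    isCompact_Icc.exists_bound_of_continuousOn
      ((hQd.continuousOn_deriv_of_isOpen isOpen_Ioo le_rfl).mono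
        fun t ht => ⟨by linarith [ht.1], ht.2.trans_lt hR⟩)
  have hp0 := hP 0 (by simp)
  refine
    { two_le := hn
      exp_bounds := ⟨p₁, p₂, hp₁, hP⟩
      weight_bounds := ?_
      contDiffOn_exp := hPd
      contDiffOn_weight := ?_
      continuousOn_exp := hPc
      continuousOn_weight := ?_
      deriv_bounds := fun R hR => ?_
      lipschitz_zero := ?_ }
  · refine ⟨p₂, fun ρ hρ => ?_⟩
    have := hP ρ hρ
    rcases hW with rfl | rfl
    · exact ⟨by linarith, this.2⟩
    · exact ⟨le_rfl, by linarith⟩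
  · rcases hW with rfl | rfl
    · exact hPd
    · exact contDiffOn_const
  · rcases hW with rfl | rfl
    · exact hPc
    · exact continuousOn_const
  · obtain ⟨C, hC⟩ := hQb R hR
    refine ⟨C, fun ρ hρ => ?_⟩
    have h1 := hC ρ (Ioo_subset_Icc_self hρ)
    rw [← hderiv ρ hρ.1] at h1
    refine ⟨h1, ?_⟩
    rcases hW with rfl | rfl
    · exact h1
    · simpa using (abs_nonneg _).trans h1
  · obtain ⟨C, hC⟩ := hQb (1 / 2) (by norm_num)
    -- Up to `1/2` the mean value inequality applies. Beyond it `P'` may be unbounded near `1`, but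
    -- the oscillation `p₂ - p₁` is at most `2 (p₂ - p₁) ρ`.
    refine ⟨max C (2 * (p₂ - p₁)), fun ρ hρ => ?_⟩
    have hρP := hP ρ hρ
    rcases le_or_gt ρ (1 / 2) with hle | hlt
    · have h1 := Convex.norm_image_sub_le_of_norm_deriv_le (f := Q) (s := Icc (0 : ℝ) (1 / 2))
        (x := 0) (y := ρ) (fun t ht => ?_) hC (convex_Icc _ _) ⟨le_rfl, by norm_num⟩ ⟨hρ.1, hle⟩
      · rw [sub_zero, Real.norm_eq_abs, Real.norm_of_nonneg hρ.1] at h1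
        rw [hPQ ρ hρ.1, hPQ 0 le_rfl]
        exact h1.trans (mul_le_mul_of_nonneg_right (le_max_left _ _) hρ.1)
      · have ht' : t ∈ Ioo (-1 : ℝ) 1 := ⟨by linarith [ht.1], by linarith [ht.2]⟩
        exact ((hQd.differentiableOn one_ne_zero) t ht').differentiableAt (isOpen_Ioo.mem_nhds ht')
    · have h1 : |P ρ - P 0| ≤ p₂ - p₁ := abs_le.2 ⟨by linarith, by linarith⟩
      have h2 : p₂ - p₁ ≤ 2 * (p₂ - p₁) * ρ := by nlinarith
      exact (h1.trans h2).trans (mul_le_mul_of_nonneg_right (le_max_right _ _) hρ.1)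

end VarExp

end

theorem mainTheorem10 (n : ℕ) (hn : 2 ≤ n) (P W : ℝ → ℝ) (p₁ p₂ : ℝ)
    (hp₁ : 1 < p₁) (hP : ∀ ρ ∈ Set.Ico (0 : ℝ) 1, p₁ ≤ P ρ ∧ P ρ ≤ p₂)
    (hPsmooth : ContDiffOn ℝ ((⊤ : ℕ∞) : WithTop ℕ∞) (VarExp.radial n P) (VarExp.unitBall n))
    (hW : W = P ∨ W = fun _ => 1) :
    -- `u` is superharmonic, continuously differentiable off the origin, and `-div(...) = K δ`
    (VarExp.IsSuperharmonic (VarExp.radial n W) (VarExp.radial n P) (VarExp.unitBall n)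
        (fun x => (VarExp.fundE n P W x : EReal)) ∧
      (∀ x ∈ VarExp.unitBall n, x ≠ 0 → VarExp.fundE n P W x ≠ ⊤) ∧
      ContDiffOn ℝ 1 (VarExp.fund n P W) (VarExp.unitBall n \ {0}) ∧
      VarExp.HasTruncGradient (VarExp.unitBall n) (VarExp.fund n P W)
        (gradient (VarExp.fund n P W)) ∧
      (2 ≤ P 0 → VarExp.HasWeakGradient (VarExp.unitBall n) (VarExp.fund n P W)
        (gradient (VarExp.fund n P W))) ∧
      ∃ K : ℝ, 0 < K ∧
        VarExp.SatisfiesEq (VarExp.radial n W) (VarExp.radial n P) (VarExp.unitBall n)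
          (gradient (VarExp.fund n P W))
          (fun φ => ∫ x, φ x ∂(ENNReal.ofReal K • MeasureTheory.Measure.dirac 0))) ∧
    -- the characterizations of membership in the weak spaces
    (∀ q : VarExp.E n → ℝ, VarExp.IsExponent (VarExp.unitBall n) q →
      VarExp.IsLogHolder (VarExp.unitBall n) q →
        (P 0 < n → (VarExp.MemWeakL q (VarExp.unitBall n) (VarExp.fund n P W) ↔
          q 0 ≤ n * (P 0 - 1) / (n - P 0))) ∧
        (VarExp.MemWeakL q (VarExp.unitBall n) (fun x => ‖gradient (VarExp.fund n P W) x‖) ↔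
          q 0 ≤ n * (P 0 - 1) / (n - 1))) ∧
    -- the constants in the modifications `v_r` are determined by continuous differentiability
    (∀ r ∈ Set.Ioo (0 : ℝ) 1, ∃! c : ℝ × ℝ,
      ContDiffOn ℝ 1 (VarExp.capped n P W r c.1 c.2) (VarExp.unitBall n \ {0})) ∧
    -- properties of the modifications `v_r`
    (∀ a b : ℝ → ℝ,
      (∀ r ∈ Set.Ioo (0 : ℝ) 1,
        ContDiffOn ℝ 1 (VarExp.capped n P W r (a r) (b r)) (VarExp.unitBall n \ {0})) →
      (∀ x ∈ VarExp.unitBall n, x ≠ 0 → b ‖x‖ = ‖gradient (VarExp.fund n P W) x‖) ∧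
      (∃ c : ℝ, 1 ≤ c ∧ ∀ r ∈ Set.Ioo (0 : ℝ) 1,
        c⁻¹ * r ^ (-(((n : ℝ) - 1) / (P 0 - 1))) ≤ b r ∧
          b r ≤ c * r ^ (-(((n : ℝ) - 1) / (P 0 - 1)))) ∧
      (∀ r ∈ Set.Ioo (0 : ℝ) 1,
        VarExp.MemSobolevLoc (VarExp.radial n P) (VarExp.unitBall n)
          (VarExp.capped n P W r (a r) (b r)) (gradient (VarExp.capped n P W r (a r) (b r))) ∧
        MeasureTheory.IntegrableOn (VarExp.cappedData n P W r (b r)) (VarExp.unitBall n) ∧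
        VarExp.SatisfiesEq (VarExp.radial n W) (VarExp.radial n P) (VarExp.unitBall n)
          (gradient (VarExp.capped n P W r (a r) (b r)))
          (fun φ => ∫ x in VarExp.unitBall n, φ x * VarExp.cappedData n P W r (b r) x)) ∧
      (∀ x ∈ VarExp.unitBall n,
        Filter.Tendsto (fun r => ((VarExp.capped n P W r (a r) (b r) x : ℝ) : EReal))
          (nhdsWithin 0 (Set.Ioi 0)) (nhds (VarExp.fundE n P W x : EReal))) ∧
      ∃ r₀ ∈ Set.Ioo (0 : ℝ) 1,
        (∀ r ∈ Set.Ioo (0 : ℝ) r₀, ∀ x : VarExp.E n, 0 < ‖x‖ → ‖x‖ < r →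
          0 < VarExp.cappedData n P W r (b r) x) ∧
        (∃ M : ℝ, ∀ r ∈ Set.Ioo (0 : ℝ) r₀,
          ∫ x in VarExp.unitBall n, |VarExp.cappedData n P W r (b r) x| ≤ M) ∧
        (∀ r ∈ Set.Ioo (0 : ℝ) r₀, ∀ s ∈ Set.Ioc (0 : ℝ) r, ∀ x ∈ VarExp.unitBall n,
          VarExp.capped n P W r (a r) (b r) x ≤ VarExp.capped n P W s (a s) (b s) x) ∧
        (∀ q : VarExp.E n → ℝ, VarExp.IsExponent (VarExp.unitBall n) q →
          VarExp.IsLogHolder (VarExp.unitBall n) q →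
            (P 0 < n →
              ((⨆ r ∈ Set.Ioo (0 : ℝ) r₀,
                  VarExp.weakNorm q (VarExp.unitBall n)
                    (VarExp.capped n P W r (a r) (b r))) < ⊤ ↔
                q 0 ≤ n * (P 0 - 1) / (n - P 0))) ∧
            ((⨆ r ∈ Set.Ioo (0 : ℝ) r₀,
                VarExp.weakNorm q (VarExp.unitBall n)
                  (fun x => ‖gradient (VarExp.capped n P W r (a r) (b r)) x‖)) < ⊤ ↔
              q 0 ≤ n * (P 0 - 1) / (n - 1)))) := by
  have h : VarExp.Admissible n P W := VarExp.Admissible.of_radial hn hp₁ hP hPsmooth hW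
  have hnt := h.nontrivial
  refine ⟨⟨h.isSuperharmonic_fundE, fun x hx h0 => h.fundE_ne_top hx h0, h.contDiffOn_fund,
    h.hasTruncGradient_fund, h.hasWeakGradient_fund, _, VarExp.toSphere_real_univ_pos,
    h.satisfiesEq_dirac fun x hx h0 => h.gradient_fund hx h0⟩,
    fun q he hq => ⟨fun hP0 => h.memWeakL_fund_iff he hq hP0, h.memWeakL_gradient_fund_iff he hq⟩,
    fun r hr => ⟨(_, _), h.contDiffOn_capped hr, fun c hc => ?_⟩, fun a b hab => ?_⟩
  · obtain ⟨h1, h2⟩ := h.capped_unique hr hc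
    exact Prod.ext h1 h2
  -- Uniqueness identifies any `C^1` choice of constants with the explicit one, so all claims about
  -- `v_r` become claims about `profile r`.
  have ha : ∀ r ∈ Set.Ioo (0 : ℝ) 1,
      a r = VarExp.profile n P W 0 r + r * VarExp.slope n P W r := fun r hr =>
    (h.capped_unique hr (hab r hr)).1
  have hb : ∀ r ∈ Set.Ioo (0 : ℝ) 1, b r = VarExp.slope n P W r := fun r hr =>
    (h.capped_unique hr (hab r hr)).2
  have hcap : ∀ r ∈ Set.Ioo (0 : ℝ) 1, ∀ x ∈ VarExp.unitBall n,
      VarExp.capped n P W r (a r) (b r) x = VarExp.profile n P W r ‖x‖ := fun r hr x hx => by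
    rw [ha r hr, hb r hr, h.capped_eq hr hx]
  have hgrad : ∀ r ∈ Set.Ioo (0 : ℝ) 1, ∀ x ∈ VarExp.unitBall n, x ≠ 0 →
      gradient (VarExp.capped n P W r (a r) (b r)) x = VarExp.radialField n P W r x :=
    fun r hr x hx h0 => by rw [ha r hr, hb r hr, h.gradient_capped hr hx h0]
  refine ⟨fun x hx h0 => ?_, ?_, fun r hr => ⟨h.memSobolevLoc_profile hr (hcap r hr) (hgrad r hr),
    ?_, ?_⟩, fun x hx => ?_, ?_⟩
  · have hx' := VarExp.norm_mem_Ioo hx h0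
    rw [hb _ hx', h.gradient_fund hx h0, h.norm_radialField (by simp) hx h0, max_eq_left hx'.1.le]
  · obtain ⟨c, hc, hs⟩ := h.slope_bounds
    refine ⟨c, hc, fun r hr => ?_⟩
    rw [hb r hr]
    exact hs r hr
  · exact h.integrableOn_cappedData hr.2 (hb r hr ▸ h.slope_pos hr)
  · have := h.satisfiesEq_capped hr (hgrad r hr)
    rwa [← hb r hr] at this
  · refine (h.tendsto_capped hx).congr' ?_
    filter_upwards [VarExp.Admissible.eventually_mem_Ioo] with r hr
    rw [ha r hr, hb r hr]
  · obtain ⟨r₀, h₀⟩ := h.exists_isSmallRadius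
    have hsub : Set.Ioo 0 r₀ ⊆ Set.Ioo (0 : ℝ) 1 := Set.Ioo_subset_Ioo_right h₀.1.2.le
    have hI : Set.Ioo 0 r₀ ⊆ Set.Ico (0 : ℝ) 1 := hsub.trans Set.Ioo_subset_Ico_self
    have hI0 : ∀ δ > (0 : ℝ), ∃ r ∈ Set.Ioo 0 r₀, r < δ := fun δ hδ => by
      obtain ⟨r, h1, h2⟩ := exists_between (lt_min h₀.1.1 hδ)
      exact ⟨r, ⟨h1, h2.trans_le (min_le_left _ _)⟩, h2.trans_le (min_le_right _ _)⟩
    -- The bound for the data is the constant `K` of the equation for `u`, attained for every small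
    -- `r`.
    refine ⟨r₀, h₀.1, fun r hr x hx hxr => ?_, ⟨(MeasureTheory.volume :
      MeasureTheory.Measure (VarExp.E n)).toSphere.real Set.univ, fun r hr => ?_⟩,
      fun r hr s hs x hx => ?_, fun q he hq => ⟨fun hP0 => ?_, ?_⟩⟩
    · rw [hb r (hsub hr), VarExp.cappedData, if_pos hxr]
      exact h₀.2 r hr ‖x‖ ⟨hx, hxr⟩
    · rw [hb r (hsub hr)]
      exact (h.integral_abs_cappedData h₀ hr).le
    · rw [hcap r (hsub hr) x hx, hcap s (hsub ⟨hs.1, hs.2.trans_lt hr.2⟩) x hx]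
      exact h.profile_le_profile h₀ hs.1 hs.2 hr.2 (VarExp.norm_mem_Ico hx)
    · exact h.iSup_weakNorm_profile_lt_top_iff he hq hP0 hI hI0 fun r hr x hx _ =>
        hcap r (hsub hr) x hx
    · exact h.iSup_weakNorm_slope_lt_top_iff he hq hI hI0 fun r hr x hx h0 => by
        rw [hgrad r (hsub hr) x hx h0, h.norm_radialField (hI hr) hx h0]
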